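/- **Setting.** Let $\Omega$ be a finite state space with at least three states, $I=\{1,\dots,n\}$ ($n\ge 1$) a set of traders, and $\Pi=(\Pi_1,\dots,\Pi_n)$ partitions of $\Omega$ with $\bigcap_i\Pi_i(\omega)=\{\omega\}$ for every $\omega$, where $\Pi_i(\omega)$ is the cell of $\omega$. Let $X:\Omega\to\mathbb R$ be a security and $Y=[\min X,\max X]$. A prior is any $\mu\in\Delta(\Omega)$, not necessarily of full support; $\mu_{\Pi_i(\omega)}$ is $\mu$ conditioned on $\Pi_i(\omega)$. A signal $\mathcal R$ has finitely or countably many realizations $\tau$, drawn with probability $\mathcal R(\tau|\omega)$ in state $\omega$; at a belief $\mu$ the realization $\tau$ has probability $m_\mu(\tau)=\sum_\omega\mu(\omega)\mathcal R(\tau|\omega)$ and leads to the Bayesian posterior $\gamma^\tau$, and $\mathcal R_\mu$ is the resulting distribution of posteriors. A cost structure $\kappa=(K,c)$ consists of a set $\mathcal E$ of available signals, a measurable $K:\mathcal E\to[0,\infty]$ and $c>0$, such that some uninformative $\mathcal R_0\in\mathcal E$ has $K(\mathcal R_0)=0$; acquiring $\mathcal R$ costs $cK(\mathcal R)$. Let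 $s(y,x)$ be a scoring rule, continuous in $y\in Y$ and strictly proper, $y_0\in Y$ and $0<\beta\le1$. *Assumption 1.* For every prior $\mu$, every $\mathcal R\in\mathcal E$ and every family $(\mathcal R^\tau)_\tau$ in $\mathcal E$ there is $\mathcal R'\in\mathcal E$ such that $\mathcal R'_\mu$ is the distribution of posteriors generated at $\mu$ by $\mathcal R$ followed by $\mathcal R^\tau$ after each realization $\tau$, and $K(\mathcal R')\le K(\mathcal R)+\sum_\tau m_\mu(\tau)K(\mathcal R^\tau)$. *Assumption 2.* If the supports of $\mathcal R(\cdot|\omega)$ and $\mathcal R(\cdot|\omega')$ differ for some $\omega,\omega'$, then $K(\mathcal R)=+\infty$. **$\kappa$ separability.** The net gain of $\mathcal R$ at a belief $\gamma$ is $\sum_\tau m_\gamma(\tau)\sum_{\omega}\gamma^\tau(\omega)\big[s(E_{\gamma^\tau}[X],X(\omega))-s(E_\gamma[X],X(\omega))\big]-cK(\mathcal R)$. The security $X$ is $\kappa$ non-separable under $\Pi$ if there are a prior $\mu$ and $v\in\mathbb R$ such that $X(\omega)\ne v$ for some $\omega\in\mathrm{Supp}(\mu)$, $E_\mu[X|\Pi_i(\omega)]=v$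 for all $i$ and all $\omega\in\mathrm{Supp}(\mu)$, and for all $\omega\in\mathrm{Supp}(\mu)$, all $i$ and all $\mathcal R\in\mathcal E$ the net gain of $\mathcal R$ at $\mu_{\Pi_i(\omega)}$ is at most $0$. Otherwise $X$ is $\kappa$ separable. **Market.** The state $\omega$ is drawn from $\mu$. In periods $k=1,2,\dots$ the traders move in turn, in the order $1,\dots,n,1,\dots$. The mover chooses a signal $\mathcal R_k\in\mathcal E$ and, for each of its realizations, an announcement in $Y$, as a measurable function of his cell, his own past signals and their realizations, all past announcements, and a fresh independent uniform draw from $[0,1]$; the realization is drawn, given $\omega$, independently of everything else, and only the resulting announcement $y_k$ becomes public. His payoff from period $k$ is $\beta^k\big(s(y_k,X(\omega))-s(y_{k-1},X(\omega))-cK(\mathcal R_k)\big)$, and a trader's total payoff is the expected sum over his periods (if $\beta=1$, where the sum need not converge: the lower limit of the expected partial sums). Nash equilibria are those of this game with common prior $\mu$. If the announcements converge in probability to $p^m$ in an equilibrium $l$, then $p^m$ is the prediction of the market and $A^m(\mu,l)=E_\mu[1-|p^m-X|]$; $A^m(\mu)=\inf_l A^m(\mu,l)$ over all Nash equilibria $l$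 (with $\inf\emptyset=+\infty$). **Poll.** Each trader $i$ in his cell acquires a signal that maximizes the net gain at $\mu_{\Pi_i(\omega)}$, observes its realization, independently across traders given $\omega$, and announces his posterior expectation $y_i$ of $X$. The prediction is $p^p=\frac1n\sum_i y_i$ and the accuracy is $A^p(\mu)=E_\mu[1-|p^p-X|]$. **Proposition.** Under Assumptions 1 and 2, for every prior the announcements converge in probability in every Nash equilibrium of the market. Moreover, $X$ is $\kappa$ separable under $\Pi$ if and only if $$A^m(\mu)>A^p(\mu)$$ for every choice of optimal signals in the poll and every prior $\mu$ under which at least one trader is uncertain about $X$, that is, for which there are a trader $i$ and states $\omega,\omega'\in\mathrm{Supp}(\mu)$ with $\omega'\in\Pi_i(\omega)$ and $X(\omega)\ne X(\omega')$. -/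

import Mathlib

open MeasureTheory Filter Topology
open scoped ENNReal

noncomputable section

namespace InfoMarket

/-! ### Signals and beliefs -/

/-- A signal on the state space `Ω`: in state `ω` the realization `τ` is drawn with probability
`prob ω τ`. The (finitely or countably many) realizations of a signal are labelled by natural
numbers; labels of probability zero in every state are not used. -/
structure Signal (Ω : Type*) where
  prob : Ω → ℕ → ℝ
  nonneg : ∀ ω τ, 0 ≤ prob ω τ
  hasSum_one : ∀ ω, HasSum (prob ω) 1

/-- The σ-algebra on signals generated by the probabilities of the realizations. -/
instance (Ω : Type*) : MeasurableSpace (Signal Ω) :=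
  MeasurableSpace.comap Signal.prob inferInstance

/-- Expected value of `X` under the belief `γ`. -/
def mean {Ω : Type*} [Fintype Ω] (γ X : Ω → ℝ) : ℝ := ∑ ω, γ ω * X ω

/-- Ex ante probability of the realization `τ` of the signal `R` under the belief `γ`. -/
def marg {Ω : Type*} [Fintype Ω] (γ : Ω → ℝ) (R : Signal Ω) (τ : ℕ) : ℝ :=
  ∑ ω, γ ω * R.prob ω τ

/-- Bayesian posterior after the realization `τ` of `R` (meaningful when `marg γ R τ > 0`). -/
def posterior {Ω : Type*} [Fintype Ω] (γ : Ω → ℝ) (R : Signal Ω) (τ : ℕ) : Ω → ℝ :=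
  fun ω => γ ω * R.prob ω τ / marg γ R τ

open Classical in
/-- The random posterior generated by `R` at the belief `γ`: the probability with which the
posterior is `δ`. -/
def randPost {Ω : Type*} [Fintype Ω] (γ : Ω → ℝ) (R : Signal Ω) (δ : Ω → ℝ) : ℝ :=
  ∑' τ, if posterior γ R τ = δ then marg γ R τ else 0

open Classical in
/-- The belief `μ` conditioned on the cell of `ω` in the partition `P` (a partition is given by
its equivalence relation); meaningful when `μ ω > 0`. -/
def cellBelief {Ω : Type*} [Fintype Ω] (P : Setoid Ω) (μ : Ω → ℝ) (ω : Ω) : Ω → ℝ :=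
  fun ω' => if P.r ω ω' then μ ω' / ∑ ω'' with P.r ω ω'', μ ω'' else 0

/-! ### Cost of information -/

/-- A set of available signals, with a cost function `K` and a marginal cost `c`; the signal `R`
costs `c * K R`. -/
structure CostStructure (Ω : Type*) where
  avail : Set (Signal Ω)
  K : avail → ℝ≥0∞
  measurable_K : Measurable K
  c : ℝ
  c_pos : 0 < c
  /-- There is a free uninformative signal. -/
  exists_free : ∃ R₀ : avail, (∀ ω ω', R₀.1.prob ω = R₀.1.prob ω') ∧ K R₀ = 0

/-- A random posterior that is generated by the signal `R` followed, after each realization `τ`,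
by the signal `S τ`, can be generated by one signal that is not more expensive. -/
def CostStructure.SequentialProof {Ω : Type*} [Fintype Ω] (κ : CostStructure Ω) : Prop :=
  ∀ μ ∈ stdSimplex ℝ Ω, ∀ (R : κ.avail) (S : ℕ → κ.avail), ∃ R' : κ.avail,
    (∀ δ, randPost μ R'.1 δ =
      ∑' τ, marg μ R.1 τ * randPost (posterior μ R.1 τ) (S τ).1 δ) ∧
    κ.K R' ≤ κ.K R + ∑' τ, ENNReal.ofReal (marg μ R.1 τ) * κ.K (S τ)

/-- A signal whose support is not the same in all states has infinite cost. -/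
def CostStructure.NoExclusion {Ω : Type*} (κ : CostStructure Ω) : Prop :=
  ∀ (R : κ.avail) (ω ω' : Ω),
    Function.support (R.1.prob ω) ≠ Function.support (R.1.prob ω') → κ.K R = ∞

/-! ### The game -/

/-- All the data of the trading game with `n` traders, except the common prior. -/
structure Game (Ω : Type*) [Fintype Ω] (n : ℕ) where
  /-- The partitions of the traders. -/
  part : Fin n → Setoid Ω
  three_le_card : 3 ≤ Fintype.card Ω
  /-- The pooled private information reveals the state. -/
  join_eq : ∀ ω ω', (∀ i, (part i).r ω ω') → ω = ω'
  /-- The security. -/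
  X : Ω → ℝ
  κ : CostStructure Ω
  /-- The scoring rule `s y x`, for the prediction `y` and the true value `x`. It is continuous in
  the prediction and strictly proper. -/
  s : ℝ → ℝ → ℝ
  s_continuous : ∀ ω, ContinuousOn (fun y => s y (X ω)) (Set.Icc (⨅ ω, X ω) (⨆ ω, X ω))
  s_strictlyProper : ∀ γ ∈ stdSimplex ℝ Ω, ∀ y ∈ Set.Icc (⨅ ω, X ω) (⨆ ω, X ω),
    y ≠ mean γ X → ∑ ω, γ ω * s y (X ω) < ∑ ω, γ ω * s (mean γ X) (X ω)
  /-- The initial announcement of the market maker. -/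
  y₀ : Set.Icc (⨅ ω, X ω) (⨆ ω, X ω)
  /-- The common discount factor. -/
  β : ℝ
  β_pos : 0 < β
  β_le_one : β ≤ 1

namespace Game

variable {Ω : Type*} [Fintype Ω] {n : ℕ} (G : Game Ω n)

/-- The possible announcements: the interval from the least to the greatest value of `X`. -/
abbrev Ann : Type := Set.Icc (⨅ ω, G.X ω) (⨆ ω, G.X ω)

/-! ### Separability -/

/-- Myopic expected gain from the signal `R` at the belief `γ`, gross of its cost. -/
def gain (γ : Ω → ℝ) (R : Signal Ω) : ℝ :=
  ∑' τ, marg γ R τ * ∑ ω, posterior γ R τ ω *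
    (G.s (mean (posterior γ R τ) G.X) (G.X ω) - G.s (mean γ G.X) (G.X ω))

/-- Myopic expected gain from the signal `R` at the belief `γ`, net of its cost. -/
def netGain (γ : Ω → ℝ) (R : G.κ.avail) : EReal :=
  (G.gain γ R.1 : EReal) - ((ENNReal.ofReal G.κ.c * G.κ.K R : ℝ≥0∞) : EReal)

/-- `X` is non-separable at `μ`. -/
def NonSeparableAt (μ : Ω → ℝ) : Prop :=
  ∃ v : ℝ, (∃ ω, 0 < μ ω ∧ G.X ω ≠ v) ∧
    ∀ i ω, 0 < μ ω → mean (cellBelief (G.part i) μ ω) G.X = v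

/-- There is no (myopic) information acquisition at `μ`. -/
def NoAcquisition (μ : Ω → ℝ) : Prop :=
  ∀ ω, 0 < μ ω → ∀ i (R : G.κ.avail), G.netGain (cellBelief (G.part i) μ ω) R ≤ 0

/-- `X` is `κ` separable. -/
def KSeparable : Prop :=
  ¬ ∃ μ ∈ stdSimplex ℝ Ω, G.NonSeparableAt μ ∧ G.NoAcquisition μ

/-- Under the prior `μ`, some trader does not learn the value of `X` from his partition alone. -/
def SomeTraderUncertain (μ : Ω → ℝ) : Prop :=
  ∃ i ω ω', 0 < μ ω ∧ 0 < μ ω' ∧ (G.part i).r ω ω' ∧ G.X ω ≠ G.X ω'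

end Game

/-! ### Full states -/

/-- A full state `(ω, ι, u)`: the state `ω`, the private randomizations `ι k` of the traders, and
the draws `u k` with which nature selects the signal realizations. -/
abbrev FullState (Ω : Type*) : Type _ := Ω × (ℕ → unitInterval) × (ℕ → unitInterval)

/-- `ω` is drawn from `μ`, all other draws are uniform on `[0,1]`, and everything is independent. -/
def law {Ω : Type*} [Fintype Ω] [MeasurableSpace Ω] (μ : Ω → ℝ) : Measure (FullState Ω) :=
  (∑ ω, ENNReal.ofReal (μ ω) • Measure.dirac ω).prod
    ((Measure.infinitePi fun _ : ℕ => (volume : Measure unitInterval)).prod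
      (Measure.infinitePi fun _ : ℕ => (volume : Measure unitInterval)))

/-- Inverse transform sampling: if `u` is uniform on `[0,1]`, then `realize p u` is equal to `τ`
with probability `p τ`. -/
def realize (p : ℕ → ℝ) (u : unitInterval) : ℕ :=
  sInf {m | (u : ℝ) < ∑ j ∈ Finset.range (m + 1), p j}

namespace Game

variable {Ω : Type*} [Fintype Ω] [MeasurableSpace Ω] {n : ℕ} [NeZero n] (G : Game Ω n)

/-! ### Strategies and play

Periods are counted from `0`, so that period `k` is the time `t_{k+1}`. -/

/-- The trader who moves in period `k`. -/
def mover (n : ℕ) [NeZero n] (k : ℕ) : Fin n := Fin.ofNat n k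

/-- What trader `i` knows in period `k` before he moves: his cell, the signals that he acquired in
his own earlier periods with their realizations, and all earlier announcements. -/
abbrev Info (i : Fin n) (k : ℕ) : Type _ :=
  Quotient (G.part i) × ({j : Fin k // mover n j = i} → G.κ.avail × ℕ) × (Fin k → G.Ann)

/-- A mixed strategy of trader `i`: in period `k` it selects, as a function of his information and
of a uniform draw from `[0,1]`, a signal and an announcement for each realization of the signal.
Only the periods in which `i` moves matter. -/
structure Strategy (i : Fin n) where
  signal : (k : ℕ) → G.Info i k × unitInterval → G.κ.avail
  announce : (k : ℕ) → (G.Info i k × unitInterval) × ℕ → G.Ann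
  measurable_signal : ∀ k, Measurable (signal k)
  measurable_announce : ∀ k, Measurable (announce k)

/-- A strategy profile. -/
abbrev Profile : Type _ := (i : Fin n) → G.Strategy i

/-- What happens in one period: the acquired signal, its realization and the announcement. -/
abbrev Record : Type _ := (G.κ.avail × ℕ) × G.Ann

/-- The information of trader `i` in state `ω` after the records `h` of periods `0, …, k - 1`. -/
def infoOf (i : Fin n) (ω : Ω) {k : ℕ} (h : Fin k → G.Record) : G.Info i k :=
  (Quotient.mk (G.part i) ω, fun j => (h j.1).1, fun j => (h j).2)

/-- The record of period `k`, given the records of the earlier periods. -/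
def step (σ : G.Profile) (φ : FullState Ω) (k : ℕ) (h : Fin k → G.Record) : G.Record :=
  let i := mover n k
  let a := (G.infoOf i φ.1 h, φ.2.1 k)
  let R := (σ i).signal k a
  let τ := realize (R.1.prob φ.1) (φ.2.2 k)
  ((R, τ), (σ i).announce k (a, τ))

/-- The records of periods `0, …, k - 1` when `σ` is played in the full state `φ`. -/
def play (σ : G.Profile) (φ : FullState Ω) : (k : ℕ) → Fin k → G.Record
  | 0 => Fin.elim0
  | k + 1 => Fin.snoc (α := fun _ => G.Record) (play σ φ k) (G.step σ φ k (play σ φ k))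

/-- The price before period `k`: the initial announcement if `k = 0`, and otherwise the
announcement made in period `k - 1`. -/
def price (σ : G.Profile) (φ : FullState Ω) : ℕ → ℝ
  | 0 => G.y₀
  | k + 1 => (G.step σ φ k (G.play σ φ k)).2

/-- The signal acquired in period `k`. -/
def acquired (σ : G.Profile) (φ : FullState Ω) (k : ℕ) : G.κ.avail :=
  (G.step σ φ k (G.play σ φ k)).1.1

/-! ### Nash equilibrium -/

/-- Expected discounted payoff of the trader who moves in period `k`, from that period. It is `-∞`
if the expected cost is infinite. -/
def stagePayoff (μ : Ω → ℝ) (σ : G.Profile) (k : ℕ) : EReal :=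
  ((G.β ^ (k + 1) : ℝ) : EReal) *
    (((∫ φ, (G.s (G.price σ φ (k + 1)) (G.X φ.1) - G.s (G.price σ φ k) (G.X φ.1)) ∂(law μ) : ℝ)
        : EReal) -
      ((ENNReal.ofReal G.κ.c * ∫⁻ φ, G.κ.K (G.acquired σ φ k) ∂(law μ) : ℝ≥0∞) : EReal))

/-- Expected total payoff of trader `i`, the limit of the expected payoffs from the first `N`
periods. The limit exists if `β < 1`; if `β = 1` it may fail to exist, and the lower limit is
taken. -/
def payoff (μ : Ω → ℝ) (σ : G.Profile) (i : Fin n) : EReal :=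
  liminf (fun N : ℕ => ∑ k ∈ Finset.range N with mover n k = i, G.stagePayoff μ σ k) atTop

/-- `σ` is a Nash equilibrium of the game with common prior `μ`. -/
def IsNash (μ : Ω → ℝ) (σ : G.Profile) : Prop :=
  ∀ (i : Fin n) (σ' : G.Strategy i),
    G.payoff μ (Function.update σ i σ') i ≤ G.payoff μ σ i

/-! ### Accuracy of the market and of the poll -/

/-- The expected accuracy `E[1 - |p - X|]` of a prediction `p`. -/
def accuracy (μ : Ω → ℝ) (p : FullState Ω → ℝ) : ℝ :=
  ∫ φ, (1 - |p φ - G.X φ.1|) ∂(law μ)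

/-- `p` is the prediction of the market when `σ` is played: the limit (in probability) of the
announcements. -/
def IsMarketPrediction (μ : Ω → ℝ) (σ : G.Profile) (p : FullState Ω → ℝ) : Prop :=
  TendstoInMeasure (law μ) (fun k φ => G.price σ φ k) atTop p

/-- The worst expected accuracy of the market among all Nash equilibria (`+∞` if there is none). -/
def marketAccuracy (μ : Ω → ℝ) : EReal :=
  ⨅ (σ : G.Profile) (_ : G.IsNash μ σ) (p : FullState Ω → ℝ) (_ : G.IsMarketPrediction μ σ p),
    (G.accuracy μ p : EReal)

/-- A choice of a signal for every trader and every cell of his partition. -/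
abbrev PollChoice : Type _ := (i : Fin n) → Quotient (G.part i) → G.κ.avail

/-- All the chosen signals are myopically optimal. -/
def PollChoice.IsOptimal {G : Game Ω n} (μ : Ω → ℝ) (ρ : G.PollChoice) : Prop :=
  ∀ i ω, 0 < μ ω → ∀ R : G.κ.avail,
    G.netGain (cellBelief (G.part i) μ ω) R ≤
      G.netGain (cellBelief (G.part i) μ ω) (ρ i (Quotient.mk _ ω))

/-- The prediction of the poll: the average of the expected values of `X` after each trader has
observed his cell and the realization of his chosen signal. -/
def pollPrediction (μ : Ω → ℝ) (ρ : G.PollChoice) (φ : FullState Ω) : ℝ :=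
  (∑ i : Fin n,
    let R := (ρ i (Quotient.mk _ φ.1)).1
    mean (posterior (cellBelief (G.part i) μ φ.1) R (realize (R.prob φ.1) (φ.2.2 i))) G.X) / n

end Game

end InfoMarket

end

set_option linter.unusedSectionVars false

noncomputable section

namespace InfoMarket

/-! ### Signals and inverse transform sampling -/

/-! Vanishing incentives. A trader who echoes the current price without buying information earns
nothing, whatever the others do, so equilibrium continuation payoffs are nonnegative. Scores are
bounded by some `B`, so the telescoping sum of all traders' discounted stage payoffs leaves at most
`2Bβ^(T+1)` after period `T`. In current value this remainder tends to zero: it is summable if `β <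
1`, and it is the tail of a convergent sum if `β = 1`. Hence the gain from any one-period deviation
is at most some `e k → 0` (`exists_vanishing_bound`, `IsNash.exists_devGain_le`).

Convergence. One deviation is to announce the mean of `X` under the public belief. Strict properness
and compactness then force the price close to that mean in probability. Public beliefs form a
bounded martingale and converge, and so does the price (`IsNash.isMarketPrediction`).

Separable securities. Suppose that with positive probability the limit belief leaves `X` uncertain.
At such a belief separability gives one trader, in one cell, a signal and a plan of announcements
with strictly positive gain. For a fixed plan this gain is continuous in belief and price, so it
stays positive nearby and contradicts `e k → 0` (`IsNash.mean_limitBelief_eq`). Thus every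
equilibrium has accuracy 1. The poll does not: take a state with maximal `X` among those at which
some trader is uncertain. There nobody expects more than the true value, and the uncertain trader
expects strictly less, because by Assumption 2 no finite-cost signal excludes a lower state
(`accuracy_pollPrediction_lt_one`).

Non-separable securities. Suppose that at `μ` all traders expect `v` and none wants to buy
information. Let everybody announce `v` for ever. A deviator learns only from his own signals, and
by Assumption 1 any sequence of purchases is no better than a single one, which does not pay
(`sum_treeSum_le`). This is therefore an equilibrium (`echo_isNash`). The poll without information
also predicts `v`, so the strict inequality fails. -/

theorem Signal.measurable_prob {Ω : Type*} (ω : Ω) :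
    Measurable fun R : Signal Ω => R.prob ω :=
  (measurable_pi_apply ω).comp (comap_measurable _)

theorem measurable_realize :
    Measurable fun x : (ℕ → ℝ) × unitInterval => realize x.1 x.2 := by
  have hm : ∀ m : ℕ, MeasurableSet {x : (ℕ → ℝ) × unitInterval |
      (x.2 : ℝ) < ∑ j ∈ Finset.range (m + 1), x.1 j} := fun m =>
    measurableSet_lt (by fun_prop) (by fun_prop)
  refine measurable_to_countable' fun m => ?_
  -- The second set accounts for `sInf ∅ = 0`: here `x.1` is any sequence, and its partial sums may
  -- never exceed `x.2`.
  have : (fun x : (ℕ → ℝ) × unitInterval => realize x.1 x.2) ⁻¹' {m} =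
      ({x | (x.2 : ℝ) < ∑ j ∈ Finset.range (m + 1), x.1 j} ∩
        ⋂ j : Fin m, {x | (x.2 : ℝ) < ∑ l ∈ Finset.range ((j : ℕ) + 1), x.1 l}ᶜ) ∪
      ({x | m = 0} ∩ ⋂ j : ℕ, {x | (x.2 : ℝ) < ∑ l ∈ Finset.range (j + 1), x.1 l}ᶜ) := by
    ext x
    simp only [Set.mem_preimage, Set.mem_singleton_iff, realize, Set.mem_union, Set.mem_inter_iff,
      Set.mem_ofPred_eq, Set.mem_iInter, Set.mem_compl_iff]
    set S : Set ℕ := {m | (x.2 : ℝ) < ∑ j ∈ Finset.range (m + 1), x.1 j} with hS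
    constructor
    · rintro rfl
      rcases S.eq_empty_or_nonempty with h | h
      · right
        refine ⟨by rw [h, Nat.sInf_empty], fun j hj => ?_⟩
        have : j ∈ S := hj
        simp [h] at this
      · exact Or.inl ⟨Nat.sInf_mem h, fun j hj => Nat.notMem_of_lt_sInf j.2 hj⟩
    · rintro (⟨h1, h2⟩ | ⟨rfl, h2⟩)
      · refine le_antisymm (Nat.sInf_le h1) ?_
        by_contra! hlt
        exact h2 ⟨_, hlt⟩ (Nat.sInf_mem (s := S) ⟨m, h1⟩)
      · have : S = ∅ := Set.eq_empty_of_forall_notMem fun j hj => h2 j hj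
        rw [this, Nat.sInf_empty]
  rw [this]
  refine ((hm m).inter (MeasurableSet.iInter fun j : Fin m => (hm j).compl)).union
    (MeasurableSet.inter (MeasurableSet.const _) (MeasurableSet.iInter fun j => (hm j).compl))

theorem measurable_realize_right (p : ℕ → ℝ) : Measurable (realize p) :=
  measurable_realize.comp (measurable_const.prodMk measurable_id)

/-- Up to a null set the event is the interval between two consecutive partial sums of `p`. -/
theorem volume_realize_eq {p : ℕ → ℝ} (h0 : ∀ τ, 0 ≤ p τ) (h1 : HasSum p 1) (τ : ℕ) :
    volume {v : unitInterval | realize p v = τ} = ENNReal.ofReal (p τ) := by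
  have hmono : Monotone fun m => ∑ j ∈ Finset.range m, p j :=
    monotone_nat_of_le_succ fun m => by
      rw [Finset.sum_range_succ]; linarith [h0 m]
  have hle : ∀ m, ∑ j ∈ Finset.range m, p j ≤ 1 := fun m =>
    sum_le_hasSum _ (fun j _ => h0 j) h1
  have hnn : ∀ m, 0 ≤ ∑ j ∈ Finset.range m, p j := fun m => Finset.sum_nonneg fun j _ => h0 j
  let a : unitInterval := ⟨∑ j ∈ Finset.range τ, p j, hnn τ, hle τ⟩
  let b : unitInterval := ⟨∑ j ∈ Finset.range (τ + 1), p j, hnn _, hle _⟩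
  have hae : {v : unitInterval | realize p v = τ} =ᵐ[volume] Set.Ico a b := by
    -- At `v = 1` no partial sum need exceed `v`, and `realize` takes its default value.
    have hne : ∀ᵐ v : unitInterval, v ≠ 1 := by
      rw [ae_iff]; simp
    filter_upwards [hne] with v hv
    have hv1 : (v : ℝ) < 1 := lt_of_le_of_ne v.2.2 fun h => hv (Subtype.ext h)
    have hex : ∃ m, (v : ℝ) < ∑ j ∈ Finset.range (m + 1), p j := by
      have := ((tendsto_add_atTop_iff_nat 1).2 h1.tendsto_sum_nat).eventually (lt_mem_nhds hv1)
      exact this.exists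
    apply propext
    change realize p v = τ ↔ a ≤ v ∧ v < b
    rw [← Subtype.coe_le_coe, ← Subtype.coe_lt_coe]
    change _ ↔ ∑ j ∈ Finset.range τ, p j ≤ (v : ℝ) ∧ (v : ℝ) < ∑ j ∈ Finset.range (τ + 1), p j
    constructor
    · intro h
      have hmem : τ ∈ {m | (v : ℝ) < ∑ j ∈ Finset.range (m + 1), p j} := by
        rw [← h]; exact Nat.sInf_mem hex
      refine ⟨?_, hmem⟩
      rcases τ with _ | τ
      · simpa using v.2.1
      · by_contra! hlt
        have : realize p v ≤ τ := Nat.sInf_le hlt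
        omega
    · rintro ⟨h2, h3⟩
      refine le_antisymm (Nat.sInf_le h3) ?_
      by_contra! hlt
      have hmem : (v : ℝ) < ∑ j ∈ Finset.range (realize p v + 1), p j := Nat.sInf_mem hex
      exact absurd (hmono (show realize p v + 1 ≤ τ from hlt)) (by simp only [not_le]; linarith)
  rw [measure_congr hae, unitInterval.volume_Ico]
  congr 1
  simp [a, b, Finset.sum_range_succ]

theorem lintegral_realize {p : ℕ → ℝ} (h0 : ∀ τ, 0 ≤ p τ) (h1 : HasSum p 1) (F : ℕ → ℝ≥0∞) :
    ∫⁻ v : unitInterval, F (realize p v) = ∑' τ, ENNReal.ofReal (p τ) * F τ := by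
  rw [← lintegral_map (Measurable.of_discrete) (measurable_realize_right p), lintegral_countable']
  refine tsum_congr fun τ => ?_
  rw [Measure.map_apply (measurable_realize_right p) (measurableSet_singleton τ), mul_comm]
  congr 1
  exact volume_realize_eq h0 h1 τ

theorem integral_realize {p : ℕ → ℝ} (h0 : ∀ τ, 0 ≤ p τ) (h1 : HasSum p 1) {F : ℕ → ℝ} {B : ℝ}
    (hF : ∀ τ, |F τ| ≤ B) :
    ∫ v : unitInterval, F (realize p v) = ∑' τ, p τ * F τ := by
  have : IsProbabilityMeasure ((volume : Measure unitInterval).map (realize p)) :=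
    Measure.isProbabilityMeasure_map (measurable_realize_right p).aemeasurable
  rw [← integral_map (measurable_realize_right p).aemeasurable
    (Measurable.of_discrete.aestronglyMeasurable), integral_countable]
  · refine tsum_congr fun τ => ?_
    rw [measureReal_def, Measure.map_apply (measurable_realize_right p) (measurableSet_singleton τ)]
    change (volume {v : unitInterval | realize p v = τ}).toReal • _ = _
    rw [volume_realize_eq h0 h1 τ, ENNReal.toReal_ofReal (h0 τ), smul_eq_mul]
  · exact Integrable.of_bound Measurable.of_discrete.aestronglyMeasurable B (ae_of_all _ hF)

/-! ### The law of the full state -/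

section Law

variable {Ω : Type*} [Fintype Ω] [MeasurableSpace Ω]

/-- The law of the state. -/
def stateLaw (μ : Ω → ℝ) : Measure Ω := ∑ ω, ENNReal.ofReal (μ ω) • Measure.dirac ω

theorem isProbabilityMeasure_stateLaw {μ : Ω → ℝ} (hμ : μ ∈ stdSimplex ℝ Ω) :
    IsProbabilityMeasure (stateLaw μ) := by
  constructor
  simp only [stateLaw, Measure.coe_finsetSum, Finset.sum_apply, Measure.smul_apply, measure_univ,
    smul_eq_mul, mul_one]
  rw [← ENNReal.ofReal_sum_of_nonneg fun ω _ => hμ.1 ω, hμ.2, ENNReal.ofReal_one]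

instance (μ : Ω → ℝ) : IsFiniteMeasure (stateLaw μ) := by
  constructor
  simp only [stateLaw, Measure.coe_finsetSum, Finset.sum_apply, Measure.smul_apply, measure_univ,
    smul_eq_mul, mul_one]
  exact ENNReal.sum_lt_top.2 fun ω _ => ENNReal.ofReal_lt_top

instance (μ : Ω → ℝ) : IsFiniteMeasure (law μ) := by
  change IsFiniteMeasure ((stateLaw μ).prod _)
  infer_instance

theorem isProbabilityMeasure_law {μ : Ω → ℝ} (hμ : μ ∈ stdSimplex ℝ Ω) :
    IsProbabilityMeasure (law μ) := by
  have := isProbabilityMeasure_stateLaw hμ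
  change IsProbabilityMeasure ((stateLaw μ).prod _)
  infer_instance

/-- In an i.i.d. sequence one coordinate may be replaced by a fresh draw. This is how nature's draw
in period `k` is integrated out with the past held fixed. -/
theorem measurePreserving_update (k : ℕ) :
    MeasurePreserving (fun x : (ℕ → unitInterval) × unitInterval => Function.update x.1 k x.2)
      ((Measure.infinitePi fun _ : ℕ => (volume : Measure unitInterval)).prod volume)
      (Measure.infinitePi fun _ : ℕ => (volume : Measure unitInterval)) := by
  have hm : Measurable
      (fun x : (ℕ → unitInterval) × unitInterval => Function.update x.1 k x.2) := by
    refine measurable_pi_lambda _ fun j => ?_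
    by_cases h : j = k
    · subst h; simpa using measurable_snd
    · simp only [Function.update_of_ne h]; fun_prop
  refine ⟨hm, ?_⟩
  refine Measure.eq_infinitePi _ fun s t ht => ?_
  have hs : MeasurableSet (Set.pi (s : Set ℕ) t) :=
    MeasurableSet.pi s.countable_toSet fun j _ => ht j
  rw [Measure.map_apply hm hs]
  by_cases hk : k ∈ s
  · have : (fun x : (ℕ → unitInterval) × unitInterval => Function.update x.1 k x.2) ⁻¹'
        (Set.pi (s : Set ℕ) t) = (Set.pi ((s.erase k : Finset ℕ) : Set ℕ) t) ×ˢ (t k) := by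
      ext x
      simp only [Set.mem_preimage, Set.mem_pi, Finset.mem_coe, Set.mem_prod, Finset.mem_erase]
      constructor
      · intro h
        refine ⟨fun j hj => ?_, ?_⟩
        · simpa [Function.update_of_ne hj.1] using h j hj.2
        · simpa using h k hk
      · rintro ⟨h1, h2⟩ j hj
        by_cases hjk : j = k
        · subst hjk; simpa using h2
        · simpa [Function.update_of_ne hjk] using h1 j ⟨hjk, hj⟩
    rw [this, Measure.prod_prod, Measure.infinitePi_pi _ fun j _ => ht j, mul_comm,
      Finset.mul_prod_erase s (fun i => volume (t i)) hk]
  · have : (fun x : (ℕ → unitInterval) × unitInterval => Function.update x.1 k x.2) ⁻¹'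
        (Set.pi (s : Set ℕ) t) = (Set.pi (s : Set ℕ) t) ×ˢ Set.univ := by
      ext x
      simp only [Set.mem_preimage, Set.mem_pi, Finset.mem_coe, Set.mem_prod, Set.mem_univ,
        and_true]
      refine forall₂_congr fun j hj => ?_
      rw [Function.update_of_ne (by rintro rfl; exact hk hj)]
    rw [this, Measure.prod_prod, measure_univ, mul_one, Measure.infinitePi_pi _ fun j _ => ht j]

/-- Redraw the randomization of nature in period `k`. -/
def redraw (k : ℕ) (x : FullState Ω × unitInterval) : FullState Ω :=
  (x.1.1, x.1.2.1, Function.update x.1.2.2 k x.2)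

theorem measurePreserving_redraw (μ : Ω → ℝ) (k : ℕ) :
    MeasurePreserving (redraw (Ω := Ω) k) ((law μ).prod volume) (law μ) := by
  have h1 := (MeasurePreserving.id (stateLaw μ)).prod
    ((MeasurePreserving.id (Measure.infinitePi fun _ : ℕ => (volume : Measure unitInterval))).prod
      (measurePreserving_update k))
  have h2 := measurePreserving_prodAssoc (stateLaw μ)
    ((Measure.infinitePi fun _ : ℕ => (volume : Measure unitInterval)).prod
      (Measure.infinitePi fun _ : ℕ => (volume : Measure unitInterval)))
    (volume : Measure unitInterval)
  have h3 := measurePreserving_prodAssoc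
    (Measure.infinitePi fun _ : ℕ => (volume : Measure unitInterval))
    (Measure.infinitePi fun _ : ℕ => (volume : Measure unitInterval))
    (volume : Measure unitInterval)
  exact h1.comp (((MeasurePreserving.id (stateLaw μ)).prod h3).comp h2)

variable [MeasurableSingletonClass Ω]

theorem lintegral_law (μ : Ω → ℝ) {F : FullState Ω → ℝ≥0∞} (hF : Measurable F) :
    ∫⁻ φ, F φ ∂(law μ) = ∑ ω, ENNReal.ofReal (μ ω) *
      ∫⁻ ι, ∫⁻ u, F (ω, ι, u) ∂(Measure.infinitePi fun _ : ℕ => (volume : Measure unitInterval))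
        ∂(Measure.infinitePi fun _ : ℕ => (volume : Measure unitInterval)) := by
  change ∫⁻ φ, F φ ∂((stateLaw μ).prod _) = _
  rw [lintegral_prod _ hF.aemeasurable, stateLaw, lintegral_finsetSum_measure]
  refine Finset.sum_congr rfl fun ω _ => ?_
  rw [lintegral_smul_measure, lintegral_dirac, smul_eq_mul, lintegral_prod]
  exact (hF.comp measurable_prodMk_left).aemeasurable

end Law

/-! ### Bounded scores, the free signal and the last price -/

namespace Game

section Basic

variable {Ω : Type*} [Fintype Ω] {n : ℕ} (G : Game Ω n)

/-- The score of the announcement `y` in the state `ω`. -/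
def score (y : G.Ann) (ω : Ω) : ℝ := G.s y (G.X ω)

theorem continuous_score (ω : Ω) : Continuous fun y : G.Ann => G.score y ω :=
  continuousOn_iff_continuous_domRestrict.1 (G.s_continuous ω)

theorem exists_score_bound : ∃ B : ℝ, 0 < B ∧ ∀ y ω, |G.score y ω| ≤ B := by
  have h : ∀ ω, ∃ B, ∀ y : G.Ann, |G.score y ω| ≤ B := fun ω => by
    obtain ⟨B, hB⟩ := (isCompact_range (G.continuous_score ω)).isBounded.exists_norm_le
    exact ⟨B, fun y => hB _ ⟨y, rfl⟩⟩
  choose B hB using h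
  refine ⟨1 + ∑ ω, |B ω|, by positivity, fun y ω => (hB ω y).trans ?_⟩
  have := Finset.single_le_sum (f := fun ω => |B ω|) (fun ω _ => abs_nonneg _) (Finset.mem_univ ω)
  linarith [le_abs_self (B ω)]

/-- A bound for the scores. -/
def scoreBound : ℝ := G.exists_score_bound.choose

theorem scoreBound_pos : 0 < G.scoreBound := G.exists_score_bound.choose_spec.1

theorem abs_score_le (y : G.Ann) (ω : Ω) : |G.score y ω| ≤ G.scoreBound :=
  G.exists_score_bound.choose_spec.2 y ω

/-- A free uninformative signal. -/
def free : G.κ.avail := G.κ.exists_free.choose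

theorem free_prob (ω ω' : Ω) : G.free.1.prob ω = G.free.1.prob ω' :=
  G.κ.exists_free.choose_spec.1 ω ω'

theorem K_free : G.κ.K G.free = 0 := G.κ.exists_free.choose_spec.2

theorem X_mem (ω : Ω) : G.X ω ∈ Set.Icc (⨅ ω, G.X ω) (⨆ ω, G.X ω) :=
  ⟨ciInf_le (Set.finite_range G.X).bddBelow ω, le_ciSup (Set.finite_range G.X).bddAbove ω⟩

theorem mean_mem {γ : Ω → ℝ} (hγ : γ ∈ stdSimplex ℝ Ω) :
    mean γ G.X ∈ Set.Icc (⨅ ω, G.X ω) (⨆ ω, G.X ω) :=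
  (convex_Icc _ _).sum_mem (fun ω _ => hγ.1 ω) hγ.2 fun ω _ => G.X_mem ω

/-- The last of the announcements `h`, or the initial one if there is none. -/
def lastPrice : {k : ℕ} → (Fin k → G.Ann) → G.Ann
  | 0, _ => G.y₀
  | k + 1, h => h (Fin.last k)

theorem measurable_lastPrice : (k : ℕ) → Measurable (G.lastPrice (k := k))
  | 0 => measurable_const
  | k + 1 => measurable_pi_apply (Fin.last k)

end Basic

variable {Ω : Type*} [Fintype Ω] [MeasurableSpace Ω] {n : ℕ} [NeZero n] (G : Game Ω n)

/-! ### Play -/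

/-- The signal acquired in period `k` after the records `h`. -/
def chosen (σ : G.Profile) (ω : Ω) (ι : ℕ → unitInterval) (k : ℕ) (h : Fin k → G.Record) :
    G.κ.avail :=
  (σ (mover n k)).signal k (G.infoOf (mover n k) ω h, ι k)

/-- The record of period `k` after the records `h` if the realization of the signal is `τ`. -/
def respond (σ : G.Profile) (ω : Ω) (ι : ℕ → unitInterval) (k : ℕ) (h : Fin k → G.Record)
    (τ : ℕ) : G.Record :=
  ((G.chosen σ ω ι k h, τ),
    (σ (mover n k)).announce k ((G.infoOf (mover n k) ω h, ι k), τ))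

theorem step_eq (σ : G.Profile) (φ : FullState Ω) (k : ℕ) (h : Fin k → G.Record) :
    G.step σ φ k h = G.respond σ φ.1 φ.2.1 k h
      (realize ((G.chosen σ φ.1 φ.2.1 k h).1.prob φ.1) (φ.2.2 k)) := rfl

/-- All announcements before period `k`. -/
def hist (σ : G.Profile) (φ : FullState Ω) (k : ℕ) : Fin k → G.Ann := fun j => (G.play σ φ k j).2

theorem play_succ_castSucc (σ : G.Profile) (φ : FullState Ω) (k : ℕ) (j : Fin k) :
    G.play σ φ (k + 1) j.castSucc = G.play σ φ k j :=
  Fin.snoc_castSucc (α := fun _ => G.Record) _ _ j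

theorem play_succ_last (σ : G.Profile) (φ : FullState Ω) (k : ℕ) :
    G.play σ φ (k + 1) (Fin.last k) = G.step σ φ k (G.play σ φ k) :=
  Fin.snoc_last (α := fun _ => G.Record) _ _

/-- The price before period `k`, as an announcement. -/
def ann (σ : G.Profile) (φ : FullState Ω) (k : ℕ) : G.Ann := G.lastPrice (G.hist σ φ k)

theorem ann_succ (σ : G.Profile) (φ : FullState Ω) (k : ℕ) :
    G.ann σ φ (k + 1) = (G.step σ φ k (G.play σ φ k)).2 := by
  simp only [ann, lastPrice, hist, play_succ_last]

theorem price_eq (σ : G.Profile) (φ : FullState Ω) (k : ℕ) : G.price σ φ k = G.ann σ φ k := by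
  cases k with
  | zero => rfl
  | succ k => rw [ann_succ]; rfl

theorem play_congr {σ σ' : G.Profile} {φ φ' : FullState Ω} {k : ℕ}
    (h : ∀ j < k, ∀ h, G.step σ φ j h = G.step σ' φ' j h) : G.play σ φ k = G.play σ' φ' k := by
  induction k with
  | zero => rfl
  | succ k ih =>
    rw [play, play, ih fun j hj => h j (by omega), h k (by omega)]

/-- Play before period `k` only reads nature's draws with index below `k`. -/
theorem play_redraw (σ : G.Profile) (φ : FullState Ω) (k : ℕ) (v : unitInterval) :
    G.play σ (redraw k (φ, v)) k = G.play σ φ k := by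
  refine G.play_congr fun j hj h => ?_
  simp only [step_eq, redraw]
  rw [Function.update_of_ne (by omega)]

variable [MeasurableSingletonClass Ω]

theorem measurable_infoOf (i : Fin n) (k : ℕ) :
    Measurable fun x : Ω × (Fin k → G.Record) => G.infoOf i x.1 x.2 := by
  unfold infoOf
  refine Measurable.prodMk ?_ (Measurable.prodMk ?_ ?_)
  · exact measurable_quotient_mk''.comp measurable_fst
  · fun_prop
  · fun_prop

theorem measurable_chosen (σ : G.Profile) (k : ℕ) :
    Measurable fun x : (Ω × (ℕ → unitInterval)) × (Fin k → G.Record) =>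
      G.chosen σ x.1.1 x.1.2 k x.2 := by
  unfold chosen
  refine ((σ _).measurable_signal k).comp (Measurable.prodMk ?_ (by fun_prop))
  exact (G.measurable_infoOf _ k).comp ((measurable_fst.comp measurable_fst).prodMk measurable_snd)

theorem measurable_respond (σ : G.Profile) (k : ℕ) :
    Measurable fun x : ((Ω × (ℕ → unitInterval)) × (Fin k → G.Record)) × ℕ =>
      G.respond σ x.1.1.1 x.1.1.2 k x.1.2 x.2 := by
  unfold respond
  refine Measurable.prodMk (((G.measurable_chosen σ k).comp measurable_fst).prodMk
    measurable_snd) ?_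
  refine ((σ _).measurable_announce k).comp (Measurable.prodMk (Measurable.prodMk ?_ (by fun_prop))
    (by fun_prop))
  exact (G.measurable_infoOf _ k).comp
    ((measurable_fst.comp (measurable_fst.comp measurable_fst)).prodMk
      (measurable_snd.comp measurable_fst))

theorem measurable_prob :
    Measurable fun x : Ω × G.κ.avail => x.2.1.prob x.1 :=
  measurable_from_prod_countable_right fun ω =>
    (Signal.measurable_prob ω).comp measurable_subtype_coe

theorem measurable_step (σ : G.Profile) (k : ℕ) :
    Measurable fun x : FullState Ω × (Fin k → G.Record) => G.step σ x.1 k x.2 := by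
  simp only [step_eq]
  have h1 : Measurable fun x : FullState Ω × (Fin k → G.Record) =>
      G.chosen σ x.1.1 x.1.2.1 k x.2 :=
    (G.measurable_chosen σ k).comp
      (f := fun x : FullState Ω × (Fin k → G.Record) => ((x.1.1, x.1.2.1), x.2)) (by fun_prop)
  have h2 : Measurable fun x : FullState Ω × (Fin k → G.Record) =>
      realize ((G.chosen σ x.1.1 x.1.2.1 k x.2).1.prob x.1.1) (x.1.2.2 k) :=
    measurable_realize.comp (Measurable.prodMk
      (G.measurable_prob.comp (Measurable.prodMk (by fun_prop) h1)) (by fun_prop))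
  exact (G.measurable_respond σ k).comp
    (f := fun x : FullState Ω × (Fin k → G.Record) => (((x.1.1, x.1.2.1), x.2), _))
    (Measurable.prodMk (by fun_prop) h2)

theorem measurable_snoc {α A : Type*} [MeasurableSpace α] [MeasurableSpace A] {k : ℕ}
    {f : α → Fin k → A} {g : α → A} (hf : Measurable f) (hg : Measurable g) :
    Measurable fun x => (Fin.snoc (α := fun _ => A) (f x) (g x) : Fin (k + 1) → A) := by
  refine measurable_pi_lambda _ fun j => ?_
  refine Fin.lastCases ?_ (fun j => ?_) j
  · simpa using hg
  · simpa [Function.comp_def] using (measurable_pi_apply j).comp hf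

theorem measurable_play (σ : G.Profile) (k : ℕ) : Measurable fun φ => G.play σ φ k := by
  induction k with
  | zero => exact measurable_const
  | succ k ih =>
    exact measurable_snoc ih ((G.measurable_step σ k).comp (measurable_id.prodMk ih))

theorem measurable_hist (σ : G.Profile) (k : ℕ) : Measurable fun φ => G.hist σ φ k := by
  have := G.measurable_play σ k
  unfold hist
  fun_prop

theorem measurable_ann (σ : G.Profile) (k : ℕ) : Measurable fun φ => G.ann σ φ k :=
  (G.measurable_lastPrice k).comp (G.measurable_hist σ k)

theorem measurable_acquired (σ : G.Profile) (k : ℕ) : Measurable fun φ => G.acquired σ φ k :=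
  (measurable_fst.comp measurable_fst).comp
    ((G.measurable_step σ k).comp (measurable_id.prodMk (G.measurable_play σ k)))

theorem measurable_score : Measurable fun x : G.Ann × Ω => G.score x.1 x.2 :=
  measurable_from_prod_countable_left fun ω => (G.continuous_score ω).measurable

theorem integrable_score (μ : Ω → ℝ) {y : FullState Ω → G.Ann} (hy : Measurable y) :
    Integrable (fun φ => G.score (y φ) φ.1) (law μ) :=
  Integrable.of_bound (G.measurable_score.comp (hy.prodMk measurable_fst)).aestronglyMeasurable
    G.scoreBound (ae_of_all _ fun _ => G.abs_score_le _ _)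

/-- Expected score of the price before period `k`. -/
def expScore (μ : Ω → ℝ) (σ : G.Profile) (k : ℕ) : ℝ := ∫ φ, G.score (G.ann σ φ k) φ.1 ∂(law μ)

theorem abs_expScore_le {μ : Ω → ℝ} (hμ : μ ∈ stdSimplex ℝ Ω) (σ : G.Profile) (k : ℕ) :
    |G.expScore μ σ k| ≤ G.scoreBound := by
  have := isProbabilityMeasure_law hμ
  have := norm_integral_le_of_norm_le_const (μ := law μ) (C := G.scoreBound)
    (f := fun φ => G.score (G.ann σ φ k) φ.1) (ae_of_all _ fun φ => G.abs_score_le _ _)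
  simpa [expScore] using this

theorem stagePayoff_eq (μ : Ω → ℝ) (σ : G.Profile) (k : ℕ) :
    G.stagePayoff μ σ k = ((G.β ^ (k + 1) : ℝ) : EReal) *
      (((G.expScore μ σ (k + 1) - G.expScore μ σ k : ℝ) : EReal) -
      ((ENNReal.ofReal G.κ.c * ∫⁻ φ, G.κ.K (G.acquired σ φ k) ∂(law μ) : ℝ≥0∞) : EReal)) := by
  unfold stagePayoff expScore
  rw [← integral_sub (G.integrable_score μ (G.measurable_ann σ (k + 1)))
    (G.integrable_score μ (G.measurable_ann σ k))]
  simp only [price_eq]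
  rfl

/-! ### Deviation in one period -/

/-- Play the strategy `τ` before period `k`, choose the signal `f` and the announcement `g` in
period `k`, and acquire no information and repeat the last announcement afterwards. -/
def deviation {i : Fin n} (τ : G.Strategy i) (k : ℕ) {f : G.Info i k × unitInterval → G.κ.avail}
    {g : (G.Info i k × unitInterval) × ℕ → G.Ann} (hf : Measurable f) (hg : Measurable g) :
    G.Strategy i where
  signal := Function.update (fun j => if j < k then τ.signal j else fun _ => G.free) k f
  announce := Function.update
    (fun j => if j < k then τ.announce j else fun a => G.lastPrice a.1.1.2.2) k g
  measurable_signal j := by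
    by_cases h : j = k
    · subst h; simpa using hf
    · rw [Function.update_of_ne h]
      split_ifs
      · exact τ.measurable_signal j
      · exact measurable_const
  measurable_announce j := by
    by_cases h : j = k
    · subst h; simpa using hg
    · rw [Function.update_of_ne h]
      split_ifs
      · exact τ.measurable_announce j
      · exact (G.measurable_lastPrice j).comp (by fun_prop)

section Deviation

variable (σ : G.Profile) (k : ℕ) {f : G.Info (mover n k) k × unitInterval → G.κ.avail}
    {g : (G.Info (mover n k) k × unitInterval) × ℕ → G.Ann} (hf : Measurable f)
    (hg : Measurable g)

/-- The profile in which the mover of period `k` deviates in that period. -/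
def devProfile : G.Profile :=
  Function.update σ (mover n k) (G.deviation (σ (mover n k)) k hf hg)

theorem devProfile_step_of_lt {j : ℕ} (hj : j < k) (φ : FullState Ω) (h : Fin j → G.Record) :
    G.step (G.devProfile σ k hf hg) φ j h = G.step σ φ j h := by
  have h1 : ∀ i', ((G.devProfile σ k hf hg) i').signal j = (σ i').signal j := by
    intro i'
    by_cases hi : i' = mover n k
    · subst hi
      simp [devProfile, deviation, Function.update_of_ne hj.ne, hj]
    · simp [devProfile, Function.update_of_ne hi]
  have h2 : ∀ i', ((G.devProfile σ k hf hg) i').announce j = (σ i').announce j := by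
    intro i'
    by_cases hi : i' = mover n k
    · subst hi
      simp [devProfile, deviation, Function.update_of_ne hj.ne, hj]
    · simp [devProfile, Function.update_of_ne hi]
  simp only [step, h1, h2]

theorem devProfile_play {j : ℕ} (hj : j ≤ k) (φ : FullState Ω) :
    G.play (G.devProfile σ k hf hg) φ j = G.play σ φ j :=
  G.play_congr fun l hl h => G.devProfile_step_of_lt σ k hf hg (by omega) φ h

/-- What the mover of period `k` knows before he moves. -/
def moverInfo (φ : FullState Ω) : G.Info (mover n k) k × unitInterval :=
  (G.infoOf (mover n k) φ.1 (G.play σ φ k), φ.2.1 k)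

theorem measurable_moverInfo : Measurable (G.moverInfo σ k) :=
  Measurable.prodMk ((G.measurable_infoOf (mover n k) k).comp
    (measurable_fst.prodMk (G.measurable_play σ k))) (by fun_prop)

/-- The announcement of the deviator in the period of the deviation. -/
def devAnn (f : G.Info (mover n k) k × unitInterval → G.κ.avail)
    (g : (G.Info (mover n k) k × unitInterval) × ℕ → G.Ann) (φ : FullState Ω) : G.Ann :=
  g (G.moverInfo σ k φ, realize ((f (G.moverInfo σ k φ)).1.prob φ.1) (φ.2.2 k))

theorem devProfile_step_self (φ : FullState Ω) :
    G.acquired (G.devProfile σ k hf hg) φ k = f (G.moverInfo σ k φ) ∧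
      G.ann (G.devProfile σ k hf hg) φ (k + 1) = G.devAnn σ k f g φ := by
  have h1 : ((G.devProfile σ k hf hg) (mover n k)).signal k = f := by
    simp [devProfile, deviation]
  have h2 : ((G.devProfile σ k hf hg) (mover n k)).announce k = g := by
    simp [devProfile, deviation]
  rw [ann_succ, acquired, G.devProfile_play σ k hf hg le_rfl]
  simp only [step, h1, h2]
  exact ⟨rfl, rfl⟩

/-- The others may react to the deviation in any way. This is irrelevant to an echoing trader, who
is paid only for score changes in his own periods. -/
theorem devProfile_step_of_gt {j : ℕ} (hj : k < j) (hm : mover n j = mover n k)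
    (φ : FullState Ω) : G.acquired (G.devProfile σ k hf hg) φ j = G.free ∧
      G.ann (G.devProfile σ k hf hg) φ (j + 1) = G.ann (G.devProfile σ k hf hg) φ j := by
  have h1 : ∀ i', i' = mover n k → ∀ a, ((G.devProfile σ k hf hg) i').signal j a = G.free := by
    rintro i' rfl a
    simp [devProfile, deviation, Function.update_of_ne hj.ne', hj.not_gt]
  have h2 : ∀ i', i' = mover n k → ∀ a, ((G.devProfile σ k hf hg) i').announce j a =
      G.lastPrice a.1.1.2.2 := by
    rintro i' rfl a
    simp [devProfile, deviation, Function.update_of_ne hj.ne', hj.not_gt]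
  rw [ann_succ, acquired]
  simp only [step, h1 _ hm, h2 _ hm]
  exact ⟨trivial, rfl⟩

theorem ann_congr {σ σ' : G.Profile} {φ : FullState Ω} {j : ℕ} 
    (h : G.play σ φ j = G.play σ' φ j) : G.ann σ φ j = G.ann σ' φ j := by
  unfold ann hist
  rw [h]

/-- Expected gain, net of costs, from the deviation in its period, undiscounted. -/
def devGain (μ : Ω → ℝ) (f : G.Info (mover n k) k × unitInterval → G.κ.avail)
    (g : (G.Info (mover n k) k × unitInterval) × ℕ → G.Ann) : EReal :=
  ((∫ φ, G.score (G.devAnn σ k f g φ) φ.1 ∂(law μ) - G.expScore μ σ k : ℝ) : EReal) -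
    ((ENNReal.ofReal G.κ.c * ∫⁻ φ, G.κ.K (f (G.moverInfo σ k φ)) ∂(law μ) : ℝ≥0∞) : EReal)

theorem stagePayoff_devProfile_of_lt (μ : Ω → ℝ) {j : ℕ} (hj : j < k) :
    G.stagePayoff μ (G.devProfile σ k hf hg) j = G.stagePayoff μ σ j := by
  have h0 := fun φ => G.devProfile_play σ k hf hg (j := j) (by omega) φ
  have h1 := fun φ => G.devProfile_play σ k hf hg (j := j + 1) (by omega) φ
  rw [stagePayoff_eq, stagePayoff_eq]
  simp only [expScore, acquired, G.ann_congr (h0 _), G.ann_congr (h1 _), h0,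
    G.devProfile_step_of_lt σ k hf hg hj]

theorem stagePayoff_devProfile_self (μ : Ω → ℝ) :
    G.stagePayoff μ (G.devProfile σ k hf hg) k =
      ((G.β ^ (k + 1) : ℝ) : EReal) * G.devGain σ k μ f g := by
  have h0 := fun φ => G.devProfile_play σ k hf hg (j := k) le_rfl φ
  rw [stagePayoff_eq]
  simp only [expScore, devGain, (G.devProfile_step_self σ k hf hg _).1, G.ann_congr (h0 _),
    (G.devProfile_step_self σ k hf hg _).2]

theorem stagePayoff_devProfile_of_gt (μ : Ω → ℝ) {j : ℕ} (hj : k < j)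
    (hm : mover n j = mover n k) : G.stagePayoff μ (G.devProfile σ k hf hg) j = 0 := by
  have h := fun φ => G.devProfile_step_of_gt σ k hf hg hj hm φ
  rw [stagePayoff_eq]
  simp only [expScore, (h _).1, (h _).2, K_free]
  simp

/-- A Nash equilibrium payoff is at least the payoff from a deviation in one period. -/
theorem IsNash.add_devGain_le {G : Game Ω n} {σ : G.Profile} {k : ℕ} 
    {f : G.Info (mover n k) k × unitInterval → G.κ.avail}
    {g : (G.Info (mover n k) k × unitInterval) × ℕ → G.Ann} {μ : Ω → ℝ} (hσ : G.IsNash μ σ)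
    (hf : Measurable f) (hg : Measurable g) :
    ∑ j ∈ Finset.range k with mover n j = mover n k, G.stagePayoff μ σ j +
      ((G.β ^ (k + 1) : ℝ) : EReal) * G.devGain σ k μ f g ≤ G.payoff μ σ (mover n k) := by
  refine le_trans (le_of_eq ?_) (hσ (mover n k) (G.deviation (σ (mover n k)) k hf hg))
  change _ = G.payoff μ (G.devProfile σ k hf hg) (mover n k)
  rw [payoff]
  symm
  -- The deviator's partial sums are constant from `k + 1` on, so the lower limit is harmless even
  -- for `β = 1`.
  refine (tendsto_const_nhds.congr' ?_).liminf_eq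
  filter_upwards [eventually_ge_atTop (k + 1)] with N hN
  obtain ⟨m, rfl⟩ := Nat.exists_eq_add_of_le hN
  induction m with
  | zero =>
    rw [add_zero, Finset.sum_filter, Finset.sum_filter, Finset.sum_range_succ, if_pos rfl,
      G.stagePayoff_devProfile_self]
    congr 1
    refine Finset.sum_congr rfl fun j hj => ?_
    rw [G.stagePayoff_devProfile_of_lt σ k hf hg μ (Finset.mem_range.1 hj)]
  | succ m ih =>
    rw [ih (by omega), Finset.sum_filter, Finset.sum_filter, ← add_assoc, Finset.sum_range_succ]
    split_ifs with hm
    · rw [G.stagePayoff_devProfile_of_gt σ k hf hg μ (by omega) hm, add_zero]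
    · rw [add_zero]

end Deviation

end Game

/-! ### Continuation payoffs vanish -/

section Continuation

variable {n : ℕ} [NeZero n] {β B : ℝ} {S C : ℕ → ℝ}

/-- Discounted payoff of trader `i` from the first `N` periods. -/
def partialPayoff (β : ℝ) (S C : ℕ → ℝ) (i : Fin n) (N : ℕ) : ℝ :=
  ∑ k ∈ Finset.range N with Game.mover n k = i, β ^ (k + 1) * (S (k + 1) - S k - C k)

theorem sum_partialPayoff (N : ℕ) :
    ∑ i : Fin n, partialPayoff β S C i N =
      ∑ k ∈ Finset.range N, β ^ (k + 1) * (S (k + 1) - S k - C k) := by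
  unfold partialPayoff
  exact Finset.sum_fiberwise (Finset.range N) (Game.mover n) _

/-- Telescoping with the potential `β ^ (k + 1) * (B - S k)`: since `B - S` is nonnegative,
discounting it once more only lowers it. -/
theorem sum_discounted_le (hβ : 0 < β) (hβ1 : β ≤ 1) (hS : ∀ k, |S k| ≤ B) (hC : ∀ k, 0 ≤ C k)
    (N m : ℕ) :
    ∑ k ∈ Finset.range (N + m), β ^ (k + 1) * (S (k + 1) - S k - C k) -
      ∑ k ∈ Finset.range N, β ^ (k + 1) * (S (k + 1) - S k - C k) ≤
      β ^ (N + 1) * (B - S N) - β ^ (N + m + 1) * (B - S (N + m)) := by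
  induction m with
  | zero => simp
  | succ m ih =>
    rw [← add_assoc, Finset.sum_range_succ]
    have h1 : 0 < β ^ (N + m + 1) := by positivity
    have h2 : β ^ (N + m + 1 + 1) * (B - S (N + m + 1)) ≤
        β ^ (N + m + 1) * (B - S (N + m + 1)) := by
      refine mul_le_mul_of_nonneg_right (pow_le_pow_of_le_one hβ.le hβ1 (by omega)) ?_
      linarith [le_abs_self (S (N + m + 1)), hS (N + m + 1)]
    have h3 := mul_nonneg h1.le (hC (N + m))
    nlinarith

/-- Think of `S` as expected scores, `C` as expected costs and `U` as equilibrium payoffs; `hle`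
says that stopping is never better than continuing. The total remaining payoff `Θ T`, in current
value `Ψ T = Θ T / β ^ (T + 1)`, is nonnegative, bounded and satisfies `Ψ T - β Ψ (T + 1) = S (T +
1) - S T - C T`. This forces `Ψ → 0`, and `Ψ` dominates what the mover still expects, hence what he
could gain by deviating. -/
theorem exists_vanishing_bound (hβ : 0 < β) (hβ1 : β ≤ 1) (hS : ∀ k, |S k| ≤ B)
    (hC : ∀ k, 0 ≤ C k) {U : Fin n → EReal}
    (hU : ∀ i, U i = liminf (fun N => (partialPayoff β S C i N : EReal)) atTop)
    (hle : ∀ i N, (partialPayoff β S C i N : EReal) ≤ U i) :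
    ∃ e : ℕ → ℝ, Tendsto e atTop (𝓝 0) ∧ ∀ k (d : EReal),
      (partialPayoff β S C (Game.mover n k) k : EReal) + ((β ^ (k + 1) : ℝ) : EReal) * d ≤
        U (Game.mover n k) → d ≤ e k := by
  have hB : 0 ≤ B := (abs_nonneg _).trans (hS 0)
  set a := partialPayoff (n := n) β S C with ha
  set A : ℕ → ℝ := fun N => ∑ k ∈ Finset.range N, β ^ (k + 1) * (S (k + 1) - S k - C k) with hA
  have hsum : ∀ N, ∑ i, a i N = A N := sum_partialPayoff
  have hAle : ∀ N m, A (N + m) - A N ≤ 2 * B * β ^ (N + 1) := by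
    intro N m
    have h1 := sum_discounted_le hβ hβ1 hS hC N m
    have h2 : 0 ≤ β ^ (N + m + 1) * (B - S (N + m)) :=
      mul_nonneg (by positivity) (by linarith [le_abs_self (S (N + m)), hS (N + m)])
    have h3 : 0 < β ^ (N + 1) := by positivity
    have h4 : B - S N ≤ 2 * B := by linarith [neg_abs_le (S N), hS N]
    have h5 := mul_le_mul_of_nonneg_left h4 h3.le
    simp only [hA]
    linarith
  have hev : ∀ (x : Fin n → ℝ), (∀ i, (x i : EReal) < U i) →
      ∀ᶠ M in atTop, ∀ i, x i < a i M := by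
    intro x hx
    refine eventually_all.2 fun i => ?_
    have := eventually_lt_of_lt_liminf ((hU i) ▸ hx i)
    filter_upwards [this] with M hM using EReal.coe_lt_coe_iff.1 hM
  have hU0 : ∀ i, 0 ≤ U i := fun i => by
    have h0 : a i 0 = 0 := by simp [ha, partialPayoff]
    simpa [h0] using hle i 0
  have htop : ∀ i, U i ≠ ⊤ := by
    intro i hi
    have h1 := hev (fun _ => -1) fun j => lt_of_lt_of_le (by norm_num) (hU0 j)
    -- The traders together never get more than `2Bβ` and the others eventually have at least `-1`
    -- each, so one trader cannot exceed `2Bβ + n`.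
    have h2 : ∀ᶠ M in atTop, 2 * B * β + n < a i M := by
      have : ((2 * B * β + n : ℝ) : EReal) < liminf (fun N => (a i N : EReal)) atTop := by
        rw [← hU i, hi]; exact EReal.coe_lt_top _
      filter_upwards [eventually_lt_of_lt_liminf this] with M hM using EReal.coe_lt_coe_iff.1 hM
    obtain ⟨M, hM1, hM2⟩ := (h1.and h2).exists
    have h3 := hAle 0 M
    have h4 := hsum M
    rw [← Finset.add_sum_erase _ _ (Finset.mem_univ i)] at h4
    have h5 : -(n : ℝ) ≤ ∑ j ∈ Finset.univ.erase i, a j M := by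
      have : ∑ j ∈ Finset.univ.erase i, (-1 : ℝ) ≤ ∑ j ∈ Finset.univ.erase i, a j M :=
        Finset.sum_le_sum fun j _ => (hM1 j).le
      refine le_trans ?_ this
      rw [Finset.sum_const, Finset.card_erase_of_mem (Finset.mem_univ i), Finset.card_univ,
        Fintype.card_fin]
      simp
    have h6 : A 0 = 0 := by simp [hA]
    simp only [zero_add, pow_one, h6, sub_zero] at h3
    linarith
  have hbot : ∀ i, U i ≠ ⊥ := fun i h => by
    have := hU0 i
    rw [h] at this
    simp at this
  set u : Fin n → ℝ := fun i => (U i).toReal with hu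
  have huU : ∀ i, U i = (u i : EReal) := fun i => (EReal.coe_toReal (htop i) (hbot i)).symm
  have hau : ∀ i N, a i N ≤ u i := fun i N => by
    have := hle i N
    rw [huU i] at this
    exact EReal.coe_le_coe_iff.1 this
  -- Although the payoffs are only lower limits, no partial payoff exceeds its lower limit by `hau`,
  -- so the partial totals do converge.
  have hApp : ∀ ε > 0, ∀ᶠ M in atTop, ∑ i, u i - ε ≤ A M := by
    intro ε hε
    have hn : (0 : ℝ) < n := Nat.cast_pos.2 (NeZero.pos n)
    have := hev (fun i => u i - ε / n) fun i => by
      rw [huU i]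
      exact EReal.coe_lt_coe_iff.2 (by have := div_pos hε hn; linarith)
    filter_upwards [this] with M hM
    rw [← hsum M]
    have h1 := Finset.sum_le_sum fun i (_ : i ∈ Finset.univ) => (hM i).le
    rw [Finset.sum_sub_distrib] at h1
    simp only [Finset.sum_const, Finset.card_univ, Fintype.card_fin, nsmul_eq_mul] at h1
    rwa [mul_div_cancel₀ _ hn.ne'] at h1
  set Θ : ℕ → ℝ := fun T => ∑ i, u i - A T with hΘ
  have hΘle : ∀ T, Θ T ≤ 2 * B * β ^ (T + 1) := by
    intro T
    refine le_of_forall_pos_le_add fun ε hε => ?_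
    obtain ⟨M, hM1, hM2⟩ := ((hApp ε hε).and (eventually_ge_atTop T)).exists
    obtain ⟨m, rfl⟩ := Nat.exists_eq_add_of_le hM2
    have := hAle T m
    simp only [hΘ]
    linarith
  have haΘ : ∀ i T, u i - a i T ≤ Θ T := by
    intro i T
    simp only [hΘ]
    rw [← hsum T, ← Finset.sum_sub_distrib]
    exact Finset.single_le_sum (f := fun i => u i - a i T)
      (fun j _ => sub_nonneg.2 (hau j T)) (Finset.mem_univ i)
  set Ψ : ℕ → ℝ := fun T => Θ T / β ^ (T + 1) with hΨ
  have hpow : ∀ T : ℕ, 0 < β ^ (T + 1) := fun T => by positivity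
  have hΘ0 : ∀ T, 0 ≤ Θ T := fun T =>
    (sub_nonneg.2 (hau 0 T)).trans (haΘ 0 T)
  have hΨ0 : ∀ T, 0 ≤ Ψ T := fun T => div_nonneg (hΘ0 T) (hpow T).le
  have hΨle : ∀ T, Ψ T ≤ 2 * B := fun T => (div_le_iff₀ (hpow T)).2 (hΘle T)
  have hrec : ∀ T, Ψ T - β * Ψ (T + 1) = S (T + 1) - S T - C T := by
    intro T
    have h1 : Θ (T + 1) = Θ T - β ^ (T + 1) * (S (T + 1) - S T - C T) := by
      simp only [hΘ, hA, Finset.sum_range_succ]; ring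
    simp only [hΨ, h1]
    field_simp
    ring
  have hΨlim : Tendsto Ψ atTop (𝓝 0) := by
    rcases hβ1.lt_or_eq with hlt | heq
    · have hsumΨ : ∀ N, (1 - β) * ∑ k ∈ Finset.range N, Ψ k + β * Ψ 0 - β * Ψ N ≤ S N - S 0 := by
        intro N
        induction N with
        | zero => simp
        | succ N ih =>
          rw [Finset.sum_range_succ]
          have := hrec N
          have := hC N
          linarith
      have hsm : Summable Ψ := by
        refine summable_of_sum_range_le (c := (2 * B + β * (2 * B)) / (1 - β)) hΨ0 fun N => ?_
        rw [le_div_iff₀ (by linarith)]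
        have h1 := hsumΨ N
        have h2 := mul_le_mul_of_nonneg_left (hΨle N) hβ.le
        have h3 := mul_nonneg hβ.le (hΨ0 0)
        have h4 := (abs_le.1 (hS N)).2
        have h5 := (abs_le.1 (hS 0)).1
        linarith
      exact hsm.tendsto_atTop_zero
    -- For `β = 1` the current value is the remainder itself, which vanishes by `hApp`.
    · have hΨΘ : ∀ T, Ψ T = Θ T := fun T => by simp [hΨ, heq]
      rw [Metric.tendsto_atTop']
      intro ε hε
      obtain ⟨N, hN⟩ := eventually_atTop.1 (hApp (ε / 2) (by positivity))
      refine ⟨N, fun T hT => ?_⟩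
      have := hN T hT.le
      rw [Real.dist_0_eq_abs, abs_of_nonneg (hΨ0 T), hΨΘ T]
      simp only [hΘ]
      linarith
  -- The bound is the mover's own remaining payoff in current value.
  refine ⟨fun k => (u (Game.mover n k) - a (Game.mover n k) k) / β ^ (k + 1), ?_, ?_⟩
  · refine squeeze_zero (fun k => div_nonneg (sub_nonneg.2 (hau _ _)) (hpow k).le) (fun k => ?_)
      hΨlim
    exact div_le_div_of_nonneg_right (haΘ _ _) (hpow k).le
  · intro k d hd
    rw [huU] at hd
    induction d with
    | bot => exact bot_le
    | top =>
      rw [EReal.coe_mul_top_of_pos (hpow k), EReal.coe_add_top, top_le_iff] at hd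
      exact absurd hd (EReal.coe_ne_top _)
    | coe d =>
      norm_cast at hd ⊢
      rw [le_div_iff₀ (hpow k)]
      linarith

end Continuation

/-! ### Vanishing gains from one-period deviations in equilibrium -/

namespace Game

variable {Ω : Type*} [Fintype Ω] [MeasurableSpace Ω] {n : ℕ} [NeZero n] {G : Game Ω n}
  [MeasurableSingletonClass Ω]

theorem exists_mover_eq (i : Fin n) (N : ℕ) : ∃ k, N ≤ k ∧ mover n k = i := by
  refine ⟨n * N + i, ?_, ?_⟩
  · have := Nat.le_mul_of_pos_left N (NeZero.pos n)
    omega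
  · ext
    simp [mover, Fin.ofNat, Nat.mod_eq_of_lt i.2]

variable (G) in
/-- Expected cost of the signal acquired in period `k`. -/
def periodCost (μ : Ω → ℝ) (σ : G.Profile) (k : ℕ) : ℝ≥0∞ :=
  ENNReal.ofReal G.κ.c * ∫⁻ φ, G.κ.K (G.acquired σ φ k) ∂(law μ)

theorem stagePayoff_of_periodCost_eq_top {μ : Ω → ℝ} {σ : G.Profile} {k : ℕ}
    (h : G.periodCost μ σ k = ⊤) : G.stagePayoff μ σ k = ⊥ := by
  rw [stagePayoff_eq]
  change _ * (_ - ((G.periodCost μ σ k : ℝ≥0∞) : EReal)) = _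
  rw [h, EReal.coe_ennreal_top, EReal.sub_top, EReal.coe_mul_bot_of_pos (pow_pos G.β_pos _)]

theorem stagePayoff_of_periodCost_ne_top {μ : Ω → ℝ} {σ : G.Profile} {k : ℕ}
    (h : G.periodCost μ σ k ≠ ⊤) : G.stagePayoff μ σ k = ((G.β ^ (k + 1) *
      (G.expScore μ σ (k + 1) - G.expScore μ σ k - (G.periodCost μ σ k).toReal) : ℝ) : EReal) := by
  rw [stagePayoff_eq]
  change _ * (_ - ((G.periodCost μ σ k : ℝ≥0∞) : EReal)) = _
  rw [← EReal.coe_ennreal_toReal h]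
  norm_cast

theorem payoff_of_periodCost_eq_top {μ : Ω → ℝ} {σ : G.Profile} {k : ℕ}
    (h : G.periodCost μ σ k = ⊤) : G.payoff μ σ (mover n k) = ⊥ := by
  refine (tendsto_const_nhds.congr' ?_).liminf_eq
  filter_upwards [eventually_gt_atTop k] with N hN
  rw [← Finset.add_sum_erase _ _ (show k ∈ (Finset.range N).filter _ by simp [hN]),
    stagePayoff_of_periodCost_eq_top h, EReal.bot_add]

theorem sum_stagePayoff {μ : Ω → ℝ} {σ : G.Profile} {i : Fin n}
    (h : ∀ k, mover n k = i → G.periodCost μ σ k ≠ ⊤) (N : ℕ) :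
    ∑ k ∈ Finset.range N with mover n k = i, G.stagePayoff μ σ k =
      (partialPayoff G.β (G.expScore μ σ) (fun k => (G.periodCost μ σ k).toReal) i N : EReal) := by
  rw [Finset.sum_congr rfl fun k hk =>
    stagePayoff_of_periodCost_ne_top (h k (Finset.mem_filter.1 hk).2), partialPayoff]
  exact (map_sum (⟨⟨Real.toEReal, EReal.coe_zero⟩, EReal.coe_add⟩ : ℝ →+ EReal) _ _).symm

/-- In a Nash equilibrium the gains from deviations in one period vanish in the limit. -/
theorem IsNash.exists_devGain_le {μ : Ω → ℝ} (hμ : μ ∈ stdSimplex ℝ Ω) {σ : G.Profile}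
    (hσ : G.IsNash μ σ) :
    ∃ e : ℕ → ℝ, Tendsto e atTop (𝓝 0) ∧ ∀ k (f : G.Info (mover n k) k × unitInterval → G.κ.avail)
      (g : (G.Info (mover n k) k × unitInterval) × ℕ → G.Ann), Measurable f → Measurable g →
      G.devGain σ k μ f g ≤ e k := by
  set A : Fin n → ℕ → EReal := fun i N =>
    ∑ k ∈ Finset.range N with mover n k = i, G.stagePayoff μ σ k with hA
  -- Stopping for good at one's own turn is a one-period deviation with gain zero.
  have hecho : ∀ k, A (mover n k) k ≤ G.payoff μ σ (mover n k) := by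
    intro k
    have := hσ.add_devGain_le (k := k) (f := fun _ => G.free) (g := fun a => G.lastPrice a.1.1.2.2)
      measurable_const ((G.measurable_lastPrice k).comp (by fun_prop))
    have h0 : G.devGain σ k μ (fun _ => G.free) (fun a => G.lastPrice a.1.1.2.2) = 0 := by
      simp only [devGain, K_free]
      have : ∫ φ, G.score (G.devAnn σ k (fun _ => G.free) (fun a => G.lastPrice a.1.1.2.2) φ) φ.1
          ∂(law μ) = G.expScore μ σ k := rfl
      rw [this]
      simp
    rwa [h0, mul_zero, add_zero] at this
  have hle : ∀ i N, A i N ≤ G.payoff μ σ i := by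
    intro i N
    -- If `N` is not a turn of `i`, his next turn is used: his partial sum does not change in
    -- between.
    have hex := exists_mover_eq i N
    classical
    have hk := Nat.find_spec hex
    have hmin := fun m (hm : m < Nat.find hex) => Nat.find_min hex hm
    set k := Nat.find hex
    have h1 := hecho k
    rw [hk.2] at h1
    refine le_trans (le_of_eq ?_) h1
    simp only [hA]
    refine Finset.sum_congr ?_ fun _ _ => rfl
    ext j
    simp only [Finset.mem_filter, Finset.mem_range]
    constructor
    · rintro ⟨h2, h3⟩; exact ⟨by omega, h3⟩
    · rintro ⟨h2, h3⟩
      refine ⟨?_, h3⟩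
      by_contra! h4
      exact hmin j h2 ⟨h4, h3⟩
  -- A single infinite expected cost gives payoff `⊥`, below the zero that stopping at once
  -- guarantees.
  have hfin : ∀ k, G.periodCost μ σ k ≠ ⊤ := by
    intro k hk
    have := hle (mover n k) 0
    rw [payoff_of_periodCost_eq_top hk] at this
    simp [hA] at this
  have hAeq : ∀ i N, A i N = (partialPayoff G.β (G.expScore μ σ)
      (fun k => (G.periodCost μ σ k).toReal) i N : EReal) := fun i N =>
    sum_stagePayoff (fun k _ => hfin k) N
  obtain ⟨e, he, hd⟩ := exists_vanishing_bound (n := n) G.β_pos G.β_le_one (G.abs_expScore_le hμ σ)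
    (C := fun k => (G.periodCost μ σ k).toReal) (fun k => ENNReal.toReal_nonneg) (U := G.payoff μ σ)
    (fun i => by simp only [← hAeq]; rfl) (fun i N => by rw [← hAeq]; exact hle i N)
  refine ⟨e, he, fun k f g hf hg => hd k _ ?_⟩
  rw [← hAeq]
  exact hσ.add_devGain_le hf hg

end Game

/-! ### Quantitative strict properness -/

namespace Game

section Proper

variable {Ω : Type*} [Fintype Ω] {n : ℕ} (G : Game Ω n)

theorem iInf_le_iSup_X : (⨅ ω, G.X ω) ≤ ⨆ ω, G.X ω := G.y₀.2.1.trans G.y₀.2.2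

/-- The mean of `X`, as an announcement. -/
def meanAnn (γ : Ω → ℝ) : G.Ann := Set.projIcc _ _ G.iInf_le_iSup_X (mean γ G.X)

theorem continuous_mean : Continuous fun γ : Ω → ℝ => mean γ G.X := by
  unfold mean
  fun_prop

/-- Projecting onto the interval keeps the announcement defined and continuous off the simplex,
where versions of conditional probabilities may lie on a null set. -/
theorem continuous_meanAnn : Continuous G.meanAnn := continuous_projIcc.comp G.continuous_mean

theorem coe_meanAnn {γ : Ω → ℝ} (hγ : γ ∈ stdSimplex ℝ Ω) : (G.meanAnn γ : ℝ) = mean γ G.X := by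
  rw [meanAnn, Set.projIcc_of_mem _ (G.mean_mem hγ)]

theorem sum_score_lt {γ : Ω → ℝ} (hγ : γ ∈ stdSimplex ℝ Ω) {y : G.Ann} (hy : (y : ℝ) ≠ mean γ G.X) :
    ∑ ω, γ ω * G.score y ω < ∑ ω, γ ω * G.score (G.meanAnn γ) ω := by
  have := G.s_strictlyProper γ hγ y y.2 hy
  rw [← G.coe_meanAnn hγ] at this
  exact this

theorem sum_score_le {γ : Ω → ℝ} (hγ : γ ∈ stdSimplex ℝ Ω) (y : G.Ann) :
    ∑ ω, γ ω * G.score y ω ≤ ∑ ω, γ ω * G.score (G.meanAnn γ) ω := by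
  by_cases hy : (y : ℝ) = mean γ G.X
  · have : y = G.meanAnn γ := Subtype.ext (by rw [G.coe_meanAnn hγ, hy])
    rw [this]
  · exact (G.sum_score_lt hγ hy).le

/-- The expected loss from the announcement `y` at the belief `γ`. -/
def loss (x : (Ω → ℝ) × G.Ann) : ℝ :=
  ∑ ω, x.1 ω * (G.score (G.meanAnn x.1) ω - G.score x.2 ω)

theorem continuous_loss : Continuous G.loss := by
  unfold loss
  refine continuous_finsetSum _ fun ω _ => ?_
  refine Continuous.mul (by fun_prop) (Continuous.sub ?_ ?_)
  · exact (G.continuous_score ω).comp (G.continuous_meanAnn.comp continuous_fst)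
  · exact (G.continuous_score ω).comp continuous_snd

theorem loss_eq (x : (Ω → ℝ) × G.Ann) :
    G.loss x = ∑ ω, x.1 ω * G.score (G.meanAnn x.1) ω - ∑ ω, x.1 ω * G.score x.2 ω := by
  simp only [loss, mul_sub, Finset.sum_sub_distrib]

theorem loss_nonneg {x : (Ω → ℝ) × G.Ann} (hx : x.1 ∈ stdSimplex ℝ Ω) : 0 ≤ G.loss x := by
  rw [loss_eq]
  linarith [G.sum_score_le hx x.2]

/-- Strict properness makes the continuous `loss` positive wherever the announcement misses the
mean. On the compact set where it misses by at least `ε`, the minimum is attained and is the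
required `δ`. -/
theorem exists_le_loss {ε : ℝ} (hε : 0 < ε) : ∃ δ > 0, ∀ x : (Ω → ℝ) × G.Ann,
    x.1 ∈ stdSimplex ℝ Ω → ε ≤ |(x.2 : ℝ) - mean x.1 G.X| → δ ≤ G.loss x := by
  set S : Set ((Ω → ℝ) × G.Ann) := (stdSimplex ℝ Ω ×ˢ Set.univ) ∩
    {x | ε ≤ |(x.2 : ℝ) - mean x.1 G.X|} with hS
  have hcomp : IsCompact S := by
    refine ((isCompact_stdSimplex ℝ Ω).prod isCompact_univ).inter_right ?_
    refine isClosed_le continuous_const (Continuous.abs (Continuous.sub ?_ ?_))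
    · exact continuous_subtype_val.comp continuous_snd
    · exact G.continuous_mean.comp continuous_fst
  rcases S.eq_empty_or_nonempty with h | h
  · refine ⟨1, one_pos, fun x hx1 hx2 => ?_⟩
    have : x ∈ S := ⟨⟨hx1, trivial⟩, hx2⟩
    simp [h] at this
  · obtain ⟨x₀, hx₀, hmin⟩ := hcomp.exists_isMinOn h G.continuous_loss.continuousOn
    refine ⟨G.loss x₀, ?_, fun x hx1 hx2 => hmin ⟨⟨hx1, trivial⟩, hx2⟩⟩
    have hne : (x₀.2 : ℝ) ≠ mean x₀.1 G.X := by
      intro h0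
      have h1 : ε ≤ |(x₀.2 : ℝ) - mean x₀.1 G.X| := hx₀.2
      rw [h0] at h1
      simp at h1
      linarith
    rw [gt_iff_lt, loss_eq]
    linarith [G.sum_score_lt hx₀.1.1 hne]

end Proper

variable {Ω : Type*} [Fintype Ω] [MeasurableSpace Ω] {n : ℕ} [NeZero n] (G : Game Ω n)
  [MeasurableSingletonClass Ω]

/-! ### Public beliefs -/

/-- The probability of the state `ω` given the information `m`. -/
def belief (μ : Ω → ℝ) (m : MeasurableSpace (FullState Ω)) (φ : FullState Ω) (ω : Ω) : ℝ :=
  ((law μ)[(Prod.fst ⁻¹' {ω}).indicator (fun _ => (1 : ℝ)) | m]) φ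

theorem measurableSet_state (ω : Ω) :
    MeasurableSet (Prod.fst ⁻¹' {ω} : Set (FullState Ω)) :=
  measurable_fst (measurableSet_singleton ω)

theorem integrable_indicator_state (μ : Ω → ℝ) (ω : Ω) :
    Integrable ((Prod.fst ⁻¹' {ω}).indicator (fun _ => (1 : ℝ)) : FullState Ω → ℝ) (law μ) :=
  (integrable_const 1).indicator (measurableSet_state ω)

section Belief

variable {μ : Ω → ℝ} {m : MeasurableSpace (FullState Ω)}

theorem stronglyMeasurable_belief (ω : Ω) : StronglyMeasurable[m] fun φ => belief μ m φ ω :=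
  stronglyMeasurable_condExp

theorem belief_mem_stdSimplex (hm : m ≤ Prod.instMeasurableSpace) :
    ∀ᵐ φ ∂(law μ), belief μ m φ ∈ stdSimplex ℝ Ω := by
  have h0 : ∀ᵐ φ ∂(law μ), ∀ ω, 0 ≤ belief μ m φ ω := by
    rw [ae_all_iff]
    intro ω
    exact condExp_nonneg (ae_of_all _ fun φ => Set.indicator_nonneg (fun _ _ => zero_le_one) φ)
  have h1 := condExp_finsetSum (μ := law μ) (m := m) (s := Finset.univ)
    (f := fun ω : Ω => ((Prod.fst ⁻¹' {ω}).indicator (fun _ => (1 : ℝ)) : FullState Ω → ℝ))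
    fun ω _ => integrable_indicator_state μ ω
  have h2 : (∑ ω : Ω, ((Prod.fst ⁻¹' {ω}).indicator (fun _ => (1 : ℝ)) : FullState Ω → ℝ)) =
      fun _ => 1 := by
    classical
    ext φ
    rw [Finset.sum_apply, Finset.sum_eq_single φ.1]
    · simp
    · intro ω _ hω
      simp [Set.indicator, Ne.symm hω]
    · simp
  rw [h2, condExp_const hm] at h1
  filter_upwards [h0, h1] with φ hφ0 hφ1
  refine ⟨hφ0, ?_⟩
  rw [Finset.sum_apply] at hφ1
  exact hφ1.symm

/-- The tower property: apart from the state, the integrand is known given `m`, so the state may be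
averaged out with the conditional belief. -/
theorem integral_belief (hm : m ≤ Prod.instMeasurableSpace) {F : FullState Ω → Ω → ℝ} {B : ℝ}
    (hF : ∀ ω, StronglyMeasurable[m] fun φ => F φ ω) (hB : ∀ φ ω, |F φ ω| ≤ B) :
    ∫ φ, F φ φ.1 ∂(law μ) = ∫ φ, ∑ ω, belief μ m φ ω * F φ ω ∂(law μ) := by
  classical
  have h1 : ∀ φ : FullState Ω, F φ φ.1 = ∑ ω, F φ ω *
      (Prod.fst ⁻¹' {ω} : Set (FullState Ω)).indicator (fun _ => (1 : ℝ)) φ := by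
    intro φ
    rw [Finset.sum_eq_single φ.1]
    · simp
    · intro ω _ hω
      simp [Set.indicator, Ne.symm hω]
    · simp
  have hb : ∀ ω, ∀ᵐ φ ∂(law μ), ‖F φ ω‖ ≤ B := fun ω => ae_of_all _ fun φ => hB φ ω
  have hi : ∀ ω, Integrable (fun φ => F φ ω *
      (Prod.fst ⁻¹' {ω} : Set (FullState Ω)).indicator (fun _ => (1 : ℝ)) φ) (law μ) := fun ω =>
    (integrable_indicator_state μ ω).bdd_mul ((hF ω).mono hm).aestronglyMeasurable (hb ω)
  have hi' : ∀ ω, Integrable (fun φ => belief μ m φ ω * F φ ω) (law μ) := fun ω =>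
    (integrable_condExp (m := m)).mul_bdd ((hF ω).mono hm).aestronglyMeasurable (hb ω)
  simp_rw [h1]
  rw [integral_finsetSum _ fun ω _ => hi ω, integral_finsetSum _ fun ω _ => hi' ω]
  refine Finset.sum_congr rfl fun ω _ => ?_
  rw [← integral_condExp hm]
  refine integral_congr_ae ?_
  filter_upwards [condExp_stronglyMeasurable_mul_of_bound hm (hF ω)
    (integrable_indicator_state μ ω) B (hb ω)] with φ hφ
  rw [mul_comm]
  exact hφ

end Belief

/-- The public information. -/
def pub (σ : G.Profile) : Filtration ℕ (inferInstance : MeasurableSpace (FullState Ω)) where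
  seq k := MeasurableSpace.comap (fun φ => G.hist σ φ k) inferInstance
  mono' := by
    refine monotone_nat_of_le_succ fun k => ?_
    have : (fun φ => G.hist σ φ k) = (fun h : Fin (k + 1) → G.Ann => fun j => h j.castSucc) ∘
        fun φ => G.hist σ φ (k + 1) := by
      ext φ j
      simp only [hist, Function.comp, play_succ_castSucc]
    rw [this, ← MeasurableSpace.comap_comp]
    exact MeasurableSpace.comap_mono (Measurable.comap_le (by fun_prop))
  le' k := (G.measurable_hist σ k).comap_le

/-- The public belief before period `k`, as a function of the past announcements. -/
theorem exists_belief_eq (μ : Ω → ℝ) (σ : G.Profile) (k : ℕ) :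
    ∃ b : (Fin k → G.Ann) → Ω → ℝ, Measurable b ∧
      ∀ φ, belief μ (G.pub σ k) φ = b (G.hist σ φ k) := by
  have h := fun ω => StronglyMeasurable.exists_eq_measurable_comp
    (f := fun φ => G.hist σ φ k) (stronglyMeasurable_belief (μ := μ) (m := G.pub σ k) ω)
  choose b hb hb' using h
  refine ⟨fun x ω => b ω x, measurable_pi_lambda _ fun ω => (hb ω).measurable, fun φ => ?_⟩
  ext ω
  exact congrFun (hb' ω) φ

/-- The public belief in the limit. -/
def limitBelief (μ : Ω → ℝ) (σ : G.Profile) : FullState Ω → Ω → ℝ :=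
  belief μ (⨆ k, G.pub σ k)

/-- Lévy's upward theorem for each of the finitely many states. -/
theorem tendsto_belief (μ : Ω → ℝ) (σ : G.Profile) :
    ∀ᵐ φ ∂(law μ), Tendsto (fun k => belief μ (G.pub σ k) φ) atTop (𝓝 (G.limitBelief μ σ φ)) := by
  have := ae_all_iff.2 fun ω : Ω => tendsto_ae_condExp (μ := law μ) (ℱ := G.pub σ)
    ((Prod.fst ⁻¹' {ω}).indicator (fun _ => (1 : ℝ)))
  filter_upwards [this] with φ hφ
  exact tendsto_pi_nhds.2 hφ

theorem measurable_belief_self {μ : Ω → ℝ} {m : MeasurableSpace (FullState Ω)} :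
    Measurable[m] (belief μ m) :=
  measurable_pi_lambda _ fun ω => (stronglyMeasurable_belief ω).measurable

theorem measurable_belief {μ : Ω → ℝ} {m : MeasurableSpace (FullState Ω)} (hm : m ≤ Prod.instMeasurableSpace) :
    Measurable[Prod.instMeasurableSpace] (belief μ m) :=
  measurable_belief_self.mono hm le_rfl

theorem stronglyMeasurable_ann (σ : G.Profile) (k : ℕ) :
    StronglyMeasurable[G.pub σ k] fun φ => G.ann σ φ k := by
  apply Measurable.stronglyMeasurable
  exact (G.measurable_lastPrice k).comp (comap_measurable _)

variable {G} in
-- The mover could buy nothing and announce the public mean. His expected gain is the expected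
-- `loss` of the current price, so that loss vanishes; Markov's inequality and `exists_le_loss`
-- conclude.
theorem IsNash.tendstoInMeasure_price_sub {μ : Ω → ℝ} (hμ : μ ∈ stdSimplex ℝ Ω) {σ : G.Profile}
    (hσ : G.IsNash μ σ) {ε : ℝ} (hε : 0 < ε) :
    Tendsto (fun k => (law μ).real {φ | ε ≤ |(G.ann σ φ k : ℝ) -
      mean (belief μ (G.pub σ k) φ) G.X|}) atTop (𝓝 0) := by
  obtain ⟨e, he, hdev⟩ := hσ.exists_devGain_le hμ
  obtain ⟨δ, hδ, hloss⟩ := G.exists_le_loss hε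
  have hprob := isProbabilityMeasure_law hμ
  refine squeeze_zero (fun k => measureReal_nonneg) (fun k => ?_)
    (by simpa using he.div_const δ)
  obtain ⟨b, hb, hb'⟩ := G.exists_belief_eq μ σ k
  have hm : (G.pub σ k : MeasurableSpace (FullState Ω)) ≤ Prod.instMeasurableSpace := (G.pub σ).le k
  have hg : Measurable fun a : (G.Info (mover n k) k × unitInterval) × ℕ =>
      G.meanAnn (b a.1.1.2.2) :=
    G.continuous_meanAnn.measurable.comp (hb.comp (by fun_prop))
  have h1 := hdev k (fun _ => G.free) _ measurable_const hg
  have hann : ∀ φ, G.devAnn σ k (fun _ => G.free) (fun a => G.meanAnn (b a.1.1.2.2)) φ =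
      G.meanAnn (belief μ (G.pub σ k) φ) := fun φ => by rw [hb' φ]; rfl
  simp only [devGain, hann, K_free] at h1
  simp only [lintegral_const, zero_mul, mul_zero, EReal.coe_ennreal_zero, sub_zero] at h1
  have h2 := EReal.coe_le_coe_iff.1 h1
  have hbm : StronglyMeasurable[G.pub σ k] fun φ => G.meanAnn (belief μ (G.pub σ k) φ) := by
    apply Measurable.stronglyMeasurable
    exact G.continuous_meanAnn.measurable.comp measurable_belief_self
  have h3 : ∫ φ, G.loss (belief μ (G.pub σ k) φ, G.ann σ φ k) ∂(law μ) ≤ e k := by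
    refine le_trans (le_of_eq ?_) h2
    rw [expScore, ← integral_sub
      (G.integrable_score μ (hbm.mono hm).measurable) (G.integrable_score μ (G.measurable_ann σ k))]
    rw [integral_belief hm (B := G.scoreBound + G.scoreBound)
      (F := fun φ ω => G.score (G.meanAnn (belief μ (G.pub σ k) φ)) ω - G.score (G.ann σ φ k) ω)]
    · rfl
    · intro ω
      exact ((G.continuous_score ω).comp_stronglyMeasurable hbm).sub
        ((G.continuous_score ω).comp_stronglyMeasurable (G.stronglyMeasurable_ann σ k))
    · intro φ ω
      exact (abs_sub _ _).trans (add_le_add (G.abs_score_le _ _) (G.abs_score_le _ _))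
  have hsimp := belief_mem_stdSimplex (μ := μ) hm
  have hint : Integrable (fun φ => G.loss (belief μ (G.pub σ k) φ, G.ann σ φ k)) (law μ) := by
    obtain ⟨C, hC⟩ := ((isCompact_stdSimplex ℝ Ω).prod
      (isCompact_univ : IsCompact (Set.univ : Set G.Ann))).exists_bound_of_continuousOn
      G.continuous_loss.continuousOn
    refine Integrable.of_bound (G.continuous_loss.measurable.comp
      ((measurable_belief hm).prodMk (G.measurable_ann σ k))).aestronglyMeasurable C ?_
    filter_upwards [hsimp] with φ hφ using hC _ ⟨hφ, trivial⟩
  -- Markov's inequality for the loss at level `δ`.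
  have h4 := mul_meas_ge_le_integral_of_nonneg (μ := law μ)
    (by filter_upwards [hsimp] with φ hφ using G.loss_nonneg hφ) hint δ
  rw [le_div_iff₀ hδ, mul_comm]
  refine le_trans (mul_le_mul_of_nonneg_left ?_ hδ.le) (h4.trans h3)
  refine ENNReal.toReal_mono (measure_ne_top _ _) (measure_mono_ae ?_)
  filter_upwards [hsimp] with φ hφ h
  exact hloss _ hφ h

variable {G} in
/-- In a Nash equilibrium the announcements converge in probability to the mean of `X` under the
limit of the public beliefs. -/
theorem IsNash.isMarketPrediction {μ : Ω → ℝ} (hμ : μ ∈ stdSimplex ℝ Ω) {σ : G.Profile}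
    (hσ : G.IsNash μ σ) :
    G.IsMarketPrediction μ σ fun φ => mean (G.limitBelief μ σ φ) G.X := by
  have hprob := isProbabilityMeasure_law hμ
  have h1 : TendstoInMeasure (law μ) (fun k φ => mean (belief μ (G.pub σ k) φ) G.X) atTop
      fun φ => mean (G.limitBelief μ σ φ) G.X := by
    refine tendstoInMeasure_of_tendsto_ae (fun k => ?_) ?_
    · exact (G.continuous_mean.measurable.comp
        (measurable_belief ((G.pub σ).le k))).aestronglyMeasurable
    · filter_upwards [G.tendsto_belief μ σ] with φ hφ
      exact (G.continuous_mean.tendsto _).comp hφ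
  unfold IsMarketPrediction
  rw [tendstoInMeasure_iff_measureReal_dist] at h1 ⊢
  intro ε hε
  have h2 := (hσ.tendstoInMeasure_price_sub hμ (half_pos hε)).add (h1 (ε / 2) (half_pos hε))
  rw [add_zero] at h2
  refine squeeze_zero (fun _ => measureReal_nonneg) (fun k => ?_) h2
  refine (measureReal_mono ?_).trans (measureReal_union_le _ _)
  intro φ hφ
  simp only [Set.mem_ofPred_eq, Set.mem_union] at hφ ⊢
  by_contra! h3
  rw [← Real.dist_eq] at h3
  have := dist_triangle (G.price σ φ k) (mean (belief μ (G.pub σ k) φ) G.X)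
    (mean (G.limitBelief μ σ φ) G.X)
  rw [G.price_eq] at this hφ
  linarith [h3.1, h3.2]

end Game

/-! ### Posteriors and beliefs conditioned on a cell -/

section Posterior

variable {Ω : Type*} [Fintype Ω] {γ : Ω → ℝ}

theorem marg_nonneg (hγ : ∀ ω, 0 ≤ γ ω) (R : Signal Ω) (τ : ℕ) : 0 ≤ marg γ R τ :=
  Finset.sum_nonneg fun ω _ => mul_nonneg (hγ ω) (R.nonneg ω τ)

/-- Bayes' rule without division. It survives at realizations of probability zero, where both sides
vanish. -/
theorem marg_mul_posterior (hγ : ∀ ω, 0 ≤ γ ω) (R : Signal Ω) (τ : ℕ) (ω : Ω) :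
    marg γ R τ * posterior γ R τ ω = γ ω * R.prob ω τ := by
  by_cases h : marg γ R τ = 0
  · have := (Finset.sum_eq_zero_iff_of_nonneg
      fun ω _ => mul_nonneg (hγ ω) (R.nonneg ω τ)).1 h ω (Finset.mem_univ ω)
    rw [h, zero_mul, this]
  · rw [posterior, mul_div_cancel₀ _ h]

theorem posterior_mem_stdSimplex (hγ : ∀ ω, 0 ≤ γ ω) (R : Signal Ω) {τ : ℕ}
    (h : marg γ R τ ≠ 0) : posterior γ R τ ∈ stdSimplex ℝ Ω := by
  refine ⟨fun ω => div_nonneg (mul_nonneg (hγ ω) (R.nonneg ω τ)) (marg_nonneg hγ R τ), ?_⟩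
  simp only [posterior]
  rw [← Finset.sum_div]
  exact div_self h

theorem hasSum_marg (γ : Ω → ℝ) (R : Signal Ω) : HasSum (marg γ R) (∑ ω, γ ω) := by
  have := hasSum_sum (s := Finset.univ) fun (ω : Ω) _ => (R.hasSum_one ω).mul_left (γ ω)
  simp only [mul_one] at this
  exact this

open Classical in
/-- The probability of the cell of `ω`. -/
def cellMass (P : Setoid Ω) (μ : Ω → ℝ) (ω : Ω) : ℝ := ∑ ω' with P.r ω ω', μ ω'

variable {P : Setoid Ω} {μ : Ω → ℝ} {ω : Ω}

theorem cellMass_pos (hμ : ∀ ω, 0 ≤ μ ω) (h : 0 < μ ω) : 0 < cellMass P μ ω := by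
  classical
  refine lt_of_lt_of_le h ?_
  exact Finset.single_le_sum (f := μ) (fun ω _ => hμ ω)
    (Finset.mem_filter.2 ⟨Finset.mem_univ ω, P.refl ω⟩)

open Classical in
theorem cellMass_mul_cellBelief (hμ : ∀ ω, 0 ≤ μ ω) (h : 0 < μ ω) (ω' : Ω) :
    cellMass P μ ω * cellBelief P μ ω ω' = if P.r ω ω' then μ ω' else 0 := by
  unfold cellBelief
  split_ifs
  · exact mul_div_cancel₀ _ (cellMass_pos hμ h).ne'
  · simp

theorem cellBelief_mem_stdSimplex (hμ : ∀ ω, 0 ≤ μ ω) (h : 0 < μ ω) :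
    cellBelief P μ ω ∈ stdSimplex ℝ Ω := by
  classical
  refine ⟨fun ω' => ?_, ?_⟩
  · unfold cellBelief
    split_ifs
    · exact div_nonneg (hμ ω') (Finset.sum_nonneg fun _ _ => hμ _)
    · exact le_rfl
  · have h1 := cellMass_pos (P := P) hμ h
    have : cellMass P μ ω * ∑ ω', cellBelief P μ ω ω' = cellMass P μ ω * 1 := by
      rw [Finset.mul_sum]
      simp only [cellMass_mul_cellBelief hμ h]
      rw [← Finset.sum_filter, mul_one]
      rfl
    exact mul_left_cancel₀ h1.ne' this

theorem cellBelief_pos (hμ : ∀ ω, 0 ≤ μ ω) (h : 0 < μ ω) {ω' : Ω} (hr : P.r ω ω')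
    (h' : 0 < μ ω') : 0 < cellBelief P μ ω ω' := by
  unfold cellBelief
  rw [if_pos hr]
  exact div_pos h' (cellMass_pos hμ h)

end Posterior

/-! ### Static gains from a signal in one cell -/

namespace Game

section Static

variable {Ω : Type*} [Fintype Ω] {n : ℕ} (G : Game Ω n)

/-- Expected score in state `ω` if the signal `R` is acquired and `a τ` is announced after the
realization `τ`. -/
def signalScore (R : Signal Ω) (a : ℕ → G.Ann) (ω : Ω) : ℝ :=
  ∑' τ, R.prob ω τ * G.score (a τ) ω

theorem summable_signalScore (R : Signal Ω) (a : ℕ → G.Ann) (ω : Ω) :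
    Summable fun τ => R.prob ω τ * G.score (a τ) ω := by
  refine Summable.of_norm_bounded ((R.hasSum_one ω).summable.mul_right G.scoreBound) fun τ => ?_
  rw [norm_mul, Real.norm_of_nonneg (R.nonneg ω τ)]
  exact mul_le_mul_of_nonneg_left (G.abs_score_le _ _) (R.nonneg ω τ)

/-- Summing over states instead of posteriors separates the plan of announcements from the belief
that weights it. The plan can then be held fixed while the belief varies. -/
theorem gain_eq {γ : Ω → ℝ} (hγ : γ ∈ stdSimplex ℝ Ω) (R : Signal Ω) :
    G.gain γ R = ∑ ω, γ ω * (G.signalScore R (fun τ => G.meanAnn (posterior γ R τ)) ω -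
      G.score (G.meanAnn γ) ω) := by
  have h1 : ∀ τ, marg γ R τ * ∑ ω, posterior γ R τ ω *
      (G.s (mean (posterior γ R τ) G.X) (G.X ω) - G.s (mean γ G.X) (G.X ω)) =
      ∑ ω, γ ω * (R.prob ω τ * G.score (G.meanAnn (posterior γ R τ)) ω -
        R.prob ω τ * G.score (G.meanAnn γ) ω) := by
    intro τ
    rw [Finset.mul_sum]
    refine Finset.sum_congr rfl fun ω _ => ?_
    rw [← mul_assoc, marg_mul_posterior hγ.1]
    by_cases h : marg γ R τ = 0
    · have := marg_mul_posterior hγ.1 R τ ω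
      rw [h, zero_mul] at this
      rw [← this, zero_mul, ← mul_sub, ← mul_assoc, ← this, zero_mul]
    · rw [score, score, G.coe_meanAnn hγ, G.coe_meanAnn (posterior_mem_stdSimplex hγ.1 R h)]
      ring
  rw [gain, tsum_congr h1]
  have h2 := fun ω => G.summable_signalScore R (fun τ => G.meanAnn (posterior γ R τ)) ω
  have h3 := fun ω => (R.hasSum_one ω).mul_right (G.score (G.meanAnn γ) ω)
  refine HasSum.tsum_eq (hasSum_sum fun ω _ => ?_)
  refine HasSum.mul_left _ ?_
  have := (h2 ω).hasSum.sub (h3 ω)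
  rwa [one_mul] at this

theorem signalScore_const (R : Signal Ω) (y : G.Ann) (ω : Ω) :
    G.signalScore R (fun _ => y) ω = G.score y ω := by
  rw [signalScore, tsum_mul_right, (R.hasSum_one ω).tsum_eq, one_mul]

theorem abs_signalScore_le (R : Signal Ω) (a : ℕ → G.Ann) (ω : Ω) :
    |G.signalScore R a ω| ≤ G.scoreBound := by
  have h := (R.hasSum_one ω).mul_right G.scoreBound
  rw [one_mul] at h
  refine tsum_of_norm_bounded (f := fun τ => R.prob ω τ * G.score (a τ) ω) h fun τ => ?_
  rw [norm_mul, Real.norm_of_nonneg (R.nonneg ω τ)]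
  exact mul_le_mul_of_nonneg_left (G.abs_score_le _ _) (R.nonneg ω τ)

open Classical in
/-- Expected gain, at the belief and the price `x`, from acquiring the signal `R` in the cell `q`
and announcing `a τ` after the realization `τ`. -/
def testGain (i : Fin n) (q : Quotient (G.part i)) (R : G.κ.avail) (a : ℕ → G.Ann)
    (x : (Ω → ℝ) × G.Ann) : ℝ :=
  ∑ ω, x.1 ω * if Quotient.mk _ ω = q then
    G.signalScore R.1 a ω - G.κ.c * (G.κ.K R).toReal - G.score x.2 ω else 0

/-- Continuity holds on the whole space because the plan `a` is fixed and the weights are not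
normalized by the mass of the cell, which may vanish. -/
theorem continuous_testGain (i : Fin n) (q : Quotient (G.part i)) (R : G.κ.avail)
    (a : ℕ → G.Ann) : Continuous (G.testGain i q R a) := by
  unfold testGain
  refine continuous_finsetSum _ fun ω _ => Continuous.mul (by fun_prop) ?_
  split_ifs
  · exact continuous_const.sub ((G.continuous_score ω).comp continuous_snd)
  · exact continuous_const

theorem testGain_cell {γ : Ω → ℝ} (hγ : γ ∈ stdSimplex ℝ Ω) {i : Fin n} {ω₀ : Ω} (hω : 0 < γ ω₀)
    (R : G.κ.avail) (a : ℕ → G.Ann) (y : G.Ann) :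
    G.testGain i (Quotient.mk _ ω₀) R a (γ, y) = cellMass (G.part i) γ ω₀ *
      (∑ ω, cellBelief (G.part i) γ ω₀ ω * (G.signalScore R.1 a ω - G.score y ω) -
        G.κ.c * (G.κ.K R).toReal) := by
  classical
  have h1 := (cellBelief_mem_stdSimplex (P := G.part i) hγ.1 hω).2
  have h2 : ∑ ω, cellBelief (G.part i) γ ω₀ ω * (G.signalScore R.1 a ω - G.score y ω) -
        G.κ.c * (G.κ.K R).toReal = ∑ ω, cellBelief (G.part i) γ ω₀ ω *
        (G.signalScore R.1 a ω - G.κ.c * (G.κ.K R).toReal - G.score y ω) := by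
    generalize G.κ.c * (G.κ.K R).toReal = c
    have h3 : c = ∑ ω, cellBelief (G.part i) γ ω₀ ω * c := by rw [← Finset.sum_mul, h1, one_mul]
    conv_lhs => rw [h3]
    rw [← Finset.sum_sub_distrib]
    exact Finset.sum_congr rfl fun ω _ => by ring
  rw [h2, Finset.mul_sum, testGain]
  refine Finset.sum_congr rfl fun ω _ => ?_
  rw [← mul_assoc, cellMass_mul_cellBelief hγ.1 hω, mul_ite, mul_zero, ite_mul, zero_mul]
  refine if_congr ?_ rfl rfl
  rw [Quotient.eq]
  exact ⟨fun h => (G.part i).symm h, fun h => (G.part i).symm h⟩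

theorem K_ne_top_of_netGain_pos {γ : Ω → ℝ} {R : G.κ.avail} (h : ⊥ < G.netGain γ R) :
    G.κ.K R ≠ ⊤ := by
  intro hK
  rw [netGain, hK, ENNReal.mul_top (by simpa using G.κ.c_pos), EReal.coe_ennreal_top,
    EReal.sub_top] at h
  exact lt_irrefl _ h

theorem netGain_eq {γ : Ω → ℝ} {R : G.κ.avail} (h : G.κ.K R ≠ ⊤) :
    G.netGain γ R = ((G.gain γ R.1 - G.κ.c * (G.κ.K R).toReal : ℝ) : EReal) := by
  rw [netGain, ← EReal.coe_ennreal_toReal (ENNReal.mul_ne_top ENNReal.ofReal_ne_top h),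
    ENNReal.toReal_mul, ENNReal.toReal_ofReal G.κ.c_pos.le]
  norm_cast

variable {G} in
-- If every cell mean equals the overall mean, then `X` is non-separable at `γ`, and separability
-- must provide a profitable signal. Otherwise some trader disagrees with the price and profits by
-- announcing his own mean, with the free signal.
theorem KSeparable.exists_testGain_pos (hG : G.KSeparable) {γ : Ω → ℝ} (hγ : γ ∈ stdSimplex ℝ Ω)
    (h : ∃ ω, 0 < γ ω ∧ G.X ω ≠ mean γ G.X) :
    ∃ (i : Fin n) (q : Quotient (G.part i)) (R : G.κ.avail) (a : ℕ → G.Ann), G.κ.K R ≠ ⊤ ∧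
      0 < G.testGain i q R a (γ, G.meanAnn γ) := by
  by_cases h1 : ∀ i ω, 0 < γ ω → mean (cellBelief (G.part i) γ ω) G.X = mean γ G.X
  · have h2 : ¬ G.NoAcquisition γ := fun h2 => hG ⟨γ, hγ, ⟨_, h, h1⟩, h2⟩
    unfold NoAcquisition at h2
    push Not at h2
    obtain ⟨ω, hω, i, R, hR⟩ := h2
    have hK := G.K_ne_top_of_netGain_pos (lt_of_le_of_lt bot_le hR)
    have hcell := cellBelief_mem_stdSimplex (P := G.part i) hγ.1 hω
    refine ⟨i, Quotient.mk _ ω, R,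
      fun τ => G.meanAnn (posterior (cellBelief (G.part i) γ ω) R.1 τ), hK, ?_⟩
    rw [G.testGain_cell hγ hω]
    refine mul_pos (cellMass_pos hγ.1 hω) ?_
    rw [G.netGain_eq hK, G.gain_eq hcell, EReal.coe_pos] at hR
    -- In this case the price agrees with the cell mean, so the test gain is the cell mass times the
    -- net gain of `R`.
    have hm : G.meanAnn γ = G.meanAnn (cellBelief (G.part i) γ ω) := by
      rw [meanAnn, meanAnn, h1 i ω hω]
    rw [hm]
    exact hR
  · push Not at h1
    obtain ⟨i, ω, hω, hne⟩ := h1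
    have hcell := cellBelief_mem_stdSimplex (P := G.part i) hγ.1 hω
    refine ⟨i, Quotient.mk _ ω, G.free, fun _ => G.meanAnn (cellBelief (G.part i) γ ω),
      by simp [K_free], ?_⟩
    rw [G.testGain_cell hγ hω]
    refine mul_pos (cellMass_pos hγ.1 hω) ?_
    rw [K_free, ENNReal.toReal_zero, mul_zero, sub_zero]
    simp only [signalScore_const, mul_sub, Finset.sum_sub_distrib]
    refine sub_pos.2 (G.sum_score_lt hcell ?_)
    rw [G.coe_meanAnn hγ]
    exact hne.symm

end Static

/-! ### Separability forces the price to reveal `X` -/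

variable {Ω : Type*} [Fintype Ω] [MeasurableSpace Ω] {n : ℕ} [NeZero n] (G : Game Ω n)
  [MeasurableSingletonClass Ω]

theorem integral_redraw (μ : Ω → ℝ) (k : ℕ) {F : FullState Ω → unitInterval → ℝ} {B : ℝ}
    (hF : Measurable (Function.uncurry F)) (hB : ∀ φ v, |F φ v| ≤ B)
    (hk : ∀ φ v w, F (redraw k (φ, v)) w = F φ w) :
    ∫ φ, F φ (φ.2.2 k) ∂(law μ) = ∫ φ, (∫ v, F φ v) ∂(law μ) := by
  have hmp := measurePreserving_redraw (Ω := Ω) μ k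
  have hm : Measurable fun φ : FullState Ω => F φ (φ.2.2 k) :=
    hF.comp (measurable_id.prodMk (by fun_prop))
  rw [← hmp.map_eq, integral_map hmp.measurable.aemeasurable hm.aestronglyMeasurable, hmp.map_eq]
  have h : ∀ x : FullState Ω × unitInterval,
      F (redraw k x) ((redraw k x).2.2 k) = F x.1 x.2 := fun x => by
    rw [hk x.1 x.2]
    simp [redraw]
  simp only [h]
  exact integral_prod (Function.uncurry F)
    (Integrable.of_bound hF.aestronglyMeasurable B (ae_of_all _ fun x => hB x.1 x.2))

theorem hist_redraw (σ : G.Profile) (φ : FullState Ω) (k : ℕ) (v : unitInterval) :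
    G.hist σ (redraw k (φ, v)) k = G.hist σ φ k := by
  unfold hist
  rw [play_redraw]

variable {G} in
/-- In a Nash equilibrium the gains from acquiring a given signal in a given cell, whenever this
is profitable given the public belief and the price, vanish. -/
theorem IsNash.exists_integral_testGain_le {μ : Ω → ℝ} (hμ : μ ∈ stdSimplex ℝ Ω) {σ : G.Profile}
    (hσ : G.IsNash μ σ) :
    ∃ e : ℕ → ℝ, Tendsto e atTop (𝓝 0) ∧ ∀ k i (q : Quotient (G.part i)) (R : G.κ.avail)
      (a : ℕ → G.Ann), mover n k = i → G.κ.K R ≠ ⊤ →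
      ∫ φ, max (G.testGain i q R a (belief μ (G.pub σ k) φ, G.ann σ φ k)) 0 ∂(law μ) ≤ e k := by
  classical
  obtain ⟨e, he, hdev⟩ := hσ.exists_devGain_le hμ
  refine ⟨e, he, ?_⟩
  rintro k _ q R a rfl hK
  have hprob := isProbabilityMeasure_law hμ
  obtain ⟨b, hb, hb'⟩ := G.exists_belief_eq μ σ k
  have hm : (G.pub σ k : MeasurableSpace (FullState Ω)) ≤ Prod.instMeasurableSpace :=
    (G.pub σ).le k
  set H : FullState Ω → ℝ := fun φ =>
    G.testGain (mover n k) q R a (belief μ (G.pub σ k) φ, G.ann σ φ k) with hH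
  set A : Set (Fin k → G.Ann) := {h | 0 < G.testGain (mover n k) q R a (b h, G.lastPrice h)} with hA
  have hAm : MeasurableSet A := measurableSet_lt measurable_const
    ((G.continuous_testGain _ q R a).measurable.comp (hb.prodMk (G.measurable_lastPrice k)))
  have hHA : ∀ φ, G.hist σ φ k ∈ A ↔ 0 < H φ := fun φ => by
    simp only [hH, hb' φ]; rfl
  -- The deviation is carried out only in the cell `q` and after public histories with positive test
  -- gain. Both are known to the mover, the public belief being a function of past announcements.
  set D : Set (G.Info (mover n k) k × unitInterval) :=
    {x | x.1.1 = q ∧ x.1.2.2 ∈ A} with hD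
  have hDm : MeasurableSet D := by
    refine MeasurableSet.inter ?_ ?_
    · exact (show Measurable fun x : G.Info (mover n k) k × unitInterval => x.1.1 by fun_prop)
        (measurableSet_singleton q)
    · exact (show Measurable fun x : G.Info (mover n k) k × unitInterval => x.1.2.2 by fun_prop)
        hAm
  set f : G.Info (mover n k) k × unitInterval → G.κ.avail :=
    fun x => if x ∈ D then R else G.free with hf
  set g : (G.Info (mover n k) k × unitInterval) × ℕ → G.Ann :=
    fun x => if x.1 ∈ D then a x.2 else G.lastPrice x.1.1.2.2 with hg
  have hfm : Measurable f := Measurable.ite hDm measurable_const measurable_const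
  have hgm : Measurable g := by
    refine Measurable.ite (measurable_fst hDm) (Measurable.of_discrete.comp measurable_snd) ?_
    exact (G.measurable_lastPrice k).comp (by fun_prop)
  have h1 := hdev k f g hfm hgm
  set E : FullState Ω → Prop := fun φ => Quotient.mk _ φ.1 = q ∧ G.hist σ φ k ∈ A with hE
  have hED : ∀ φ, G.moverInfo σ k φ ∈ D ↔ E φ := fun φ => Iff.rfl
  have hEm : MeasurableSet {φ | E φ} := G.measurable_moverInfo σ k hDm
  have hann : ∀ φ, G.devAnn σ k f g φ =
      if E φ then a (realize (R.1.prob φ.1) (φ.2.2 k)) else G.ann σ φ k := by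
    intro φ
    by_cases h : E φ
    · have h' := (hED φ).2 h
      simp only [devAnn, hf, hg, if_pos h', if_pos h]
    · have h' := mt (hED φ).1 h
      simp only [devAnn, hf, hg, if_neg h', if_neg h]
      rfl
  have hcost : ∫⁻ φ, G.κ.K (f (G.moverInfo σ k φ)) ∂(law μ) = G.κ.K R * law μ {φ | E φ} := by
    have : ∀ φ, G.κ.K (f (G.moverInfo σ k φ)) = {φ | E φ}.indicator (fun _ => G.κ.K R) φ := by
      intro φ
      by_cases h : E φ
      · have h' := (hED φ).2 h
        simp only [hf, if_pos h', Set.indicator, Set.mem_ofPred_eq, if_pos h]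
      · have h' := mt (hED φ).1 h
        simp only [hf, if_neg h', Set.indicator, Set.mem_ofPred_eq, if_neg h, K_free]
    simp only [this]
    rw [lintegral_indicator_const hEm]
  have hdevm : Measurable (G.devAnn σ k f g) := by
    have : Measurable fun φ : FullState Ω => realize (R.1.prob φ.1) (φ.2.2 k) :=
      measurable_realize.comp (Measurable.prodMk (Measurable.of_discrete.comp measurable_fst)
        (by fun_prop))
    simp only [funext hann]
    exact Measurable.ite hEm (Measurable.of_discrete.comp this) (G.measurable_ann σ k)
  rw [devGain, hcost, ← EReal.coe_ennreal_toReal (ENNReal.mul_ne_top ENNReal.ofReal_ne_top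
    (ENNReal.mul_ne_top hK (measure_ne_top _ _))), ← EReal.coe_sub, EReal.coe_le_coe_iff,
    ENNReal.toReal_mul, ENNReal.toReal_ofReal G.κ.c_pos.le, ENNReal.toReal_mul, expScore,
    ← integral_sub (G.integrable_score μ hdevm) (G.integrable_score μ (G.measurable_ann σ k))] at h1
  set c := G.κ.c * (G.κ.K R).toReal with hc
  -- The event `E` and the old price do not involve the draw of period `k`, so integrating it out
  -- turns the score of the plan into `signalScore`.
  have h2 : ∫ φ, (G.score (G.devAnn σ k f g φ) φ.1 - G.score (G.ann σ φ k) φ.1) ∂(law μ) =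
      ∫ φ, (if E φ then G.signalScore R.1 a φ.1 - G.score (G.ann σ φ k) φ.1 else 0) ∂(law μ) := by
    set F : FullState Ω → unitInterval → ℝ := fun φ v =>
      if E φ then G.score (a (realize (R.1.prob φ.1) v)) φ.1 - G.score (G.ann σ φ k) φ.1 else 0
      with hF
    have hFm : Measurable (Function.uncurry F) := by
      refine Measurable.ite (measurable_fst hEm) (Measurable.sub ?_ ?_) measurable_const
      · refine G.measurable_score.comp (Measurable.prodMk (Measurable.of_discrete.comp
          (measurable_realize.comp (Measurable.prodMk ?_ measurable_snd))) (by fun_prop))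
        exact (Measurable.of_discrete (f := R.1.prob)).comp (measurable_fst.comp measurable_fst)
      · exact G.measurable_score.comp (((G.measurable_ann σ k).comp measurable_fst).prodMk
          (by fun_prop))
    have hbd : ∀ y y' ω, |G.score y ω - G.score y' ω| ≤ G.scoreBound + G.scoreBound :=
      fun y y' ω => (abs_sub _ _).trans (add_le_add (G.abs_score_le _ _) (G.abs_score_le _ _))
    have h3 := integral_redraw μ k (B := G.scoreBound + G.scoreBound) hFm (fun φ v => by
        simp only [hF]
        split_ifs
        · exact hbd _ _ _
        · simpa using add_nonneg G.scoreBound_pos.le G.scoreBound_pos.le) (fun φ v w => by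
        simp only [hF, hE, ann, hist_redraw]
        rfl)
    rw [← integral_congr_ae (ae_of_all _ fun φ => ?_), h3]
    · refine integral_congr_ae (ae_of_all _ fun φ => ?_)
      simp only [hF]
      split_ifs
      · have h4 : Integrable (fun v => G.score (a (realize (R.1.prob φ.1) v)) φ.1)
            (volume : Measure unitInterval) :=
          Integrable.of_bound ((Measurable.of_discrete (f := fun τ => G.score (a τ) φ.1)).comp
            (measurable_realize_right _)).aestronglyMeasurable
            G.scoreBound (ae_of_all _ fun _ => G.abs_score_le _ _)
        rw [integral_sub h4 (integrable_const _), integral_realize (R.1.nonneg _)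
          (R.1.hasSum_one _) (F := fun τ => G.score (a τ) φ.1) fun τ => G.abs_score_le _ _]
        simp [signalScore]
      · simp
    · simp only [hF, hann]
      split_ifs <;> simp
  have h5 : ∫ φ, (if E φ then G.signalScore R.1 a φ.1 - c - G.score (G.ann σ φ k) φ.1 else 0)
      ∂(law μ) ≤ e k := by
    refine le_trans (le_of_eq ?_) h1
    have hi : ∫ φ, {φ | E φ}.indicator (fun _ => c) φ ∂(law μ) = (law μ).real {φ | E φ} * c := by
      rw [integral_indicator_const _ hEm, smul_eq_mul]
    rw [h2, ← mul_assoc, ← hc, mul_comm c, ← measureReal_def, ← hi, ← integral_sub]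
    · refine integral_congr_ae (ae_of_all _ fun φ => ?_)
      by_cases h : E φ
      · simp only [Set.indicator, Set.mem_ofPred_eq, if_pos h]; ring
      · simp only [Set.indicator, Set.mem_ofPred_eq, if_neg h]; ring
    · refine Integrable.of_bound (Measurable.ite hEm (Measurable.sub
        ((Measurable.of_discrete (f := G.signalScore R.1 a)).comp measurable_fst)
        (G.measurable_score.comp
          ((G.measurable_ann σ k).prodMk measurable_fst))) measurable_const).aestronglyMeasurable
        (G.scoreBound + G.scoreBound) (ae_of_all _ fun φ => ?_)
      split_ifs
      · exact (abs_sub _ _).trans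
          (add_le_add (G.abs_signalScore_le _ _ _) (G.abs_score_le _ _))
      · simpa using add_nonneg G.scoreBound_pos.le G.scoreBound_pos.le
    · exact (integrable_const c).indicator hEm
  refine le_trans (le_of_eq ?_) h5
  -- What remains depends on public information and the state only. Averaging the state with the
  -- public belief gives the positive part of the test gain.
  have hApub : MeasurableSet[G.pub σ k] {φ | G.hist σ φ k ∈ A} := ⟨A, hAm, rfl⟩
  have h6 := integral_belief (μ := μ) hm (B := G.scoreBound + |c| + G.scoreBound)
    (F := fun φ ω => if G.hist σ φ k ∈ A then (if Quotient.mk _ ω = q then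
      G.signalScore R.1 a ω - c - G.score (G.ann σ φ k) ω else 0) else 0) ?_ ?_
  · have h7 : ∀ φ, (if E φ then G.signalScore R.1 a φ.1 - c - G.score (G.ann σ φ k) φ.1 else 0) =
        if G.hist σ φ k ∈ A then (if Quotient.mk _ φ.1 = q then
          G.signalScore R.1 a φ.1 - c - G.score (G.ann σ φ k) φ.1 else 0) else 0 := by
      intro φ
      simp only [hE]
      rw [← ite_and]
      exact if_congr and_comm rfl rfl
    have h8 : ∀ φ, max (H φ) 0 = ∑ ω, belief μ (G.pub σ k) φ ω *
        if G.hist σ φ k ∈ A then (if Quotient.mk _ ω = q then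
          G.signalScore R.1 a ω - c - G.score (G.ann σ φ k) ω else 0) else 0 := by
      intro φ
      by_cases h : G.hist σ φ k ∈ A
      · simp only [if_pos h]
        rw [max_eq_left ((hHA φ).1 h).le]
        rfl
      · simp only [if_neg h, mul_zero, Finset.sum_const_zero]
        exact max_eq_right (not_lt.1 (mt (hHA φ).2 h))
    simp only [h7]
    exact (integral_congr_ae (ae_of_all _ h8)).trans h6.symm
  · intro ω
    refine StronglyMeasurable.ite hApub ?_ stronglyMeasurable_const
    split_ifs
    · exact stronglyMeasurable_const.sub
        ((G.continuous_score ω).comp_stronglyMeasurable (G.stronglyMeasurable_ann σ k))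
    · exact stronglyMeasurable_const
  · intro φ ω
    have hB := G.scoreBound_pos
    split_ifs
    · refine (abs_sub _ _).trans (add_le_add ?_ (G.abs_score_le _ _))
      exact (abs_sub _ _).trans (add_le_add_left (G.abs_signalScore_le _ _ _) _)
    · rw [abs_zero]; positivity
    · rw [abs_zero]; positivity

variable {G} in
/-- If `X` is separable, then in every Nash equilibrium the price converges to `X`. -/
theorem IsNash.mean_limitBelief_eq {μ : Ω → ℝ} (hμ : μ ∈ stdSimplex ℝ Ω) {σ : G.Profile}
    (hσ : G.IsNash μ σ) (hG : G.KSeparable) :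
    ∀ᵐ φ ∂(law μ), mean (G.limitBelief μ σ φ) G.X = G.X φ.1 := by
  classical
  have hprob := isProbabilityMeasure_law hμ
  have hm : (⨆ k, G.pub σ k : MeasurableSpace (FullState Ω)) ≤ Prod.instMeasurableSpace :=
    iSup_le fun k => (G.pub σ).le k
  have hsimp : ∀ᵐ φ ∂(law μ), G.limitBelief μ σ φ ∈ stdSimplex ℝ Ω := belief_mem_stdSimplex hm
  have hmeas : Measurable (G.limitBelief μ σ) := measurable_belief hm
  -- The beliefs under which `X` is still uncertain. If the limit belief almost surely avoids them,
  -- its mean is `X` on its support, and the tower property applied to `|mean - X|` concludes.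
  set S : Set (Ω → ℝ) := stdSimplex ℝ Ω ∩ {γ | ∃ ω, 0 < γ ω ∧ G.X ω ≠ mean γ G.X} with hS
  by_cases hS0 : (law μ).map (G.limitBelief μ σ) S = 0
  · have hSm : MeasurableSet S := by
      refine (isCompact_stdSimplex ℝ Ω).measurableSet.inter ?_
      have : {γ : Ω → ℝ | ∃ ω, 0 < γ ω ∧ G.X ω ≠ mean γ G.X} =
          ⋃ ω, {γ | 0 < γ ω} ∩ {γ | mean γ G.X = G.X ω}ᶜ := by
        ext γ; simp [eq_comm]
      rw [this]
      refine MeasurableSet.iUnion fun ω => (measurableSet_lt measurable_const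
        (measurable_pi_apply ω)).inter (measurableSet_eq_fun G.continuous_mean.measurable
          measurable_const).compl
    rw [Measure.map_apply hmeas hSm] at hS0
    have hae : ∀ᵐ φ ∂(law μ), ∀ ω, 0 < G.limitBelief μ σ φ ω →
        G.X ω = mean (G.limitBelief μ σ φ) G.X := by
      filter_upwards [measure_eq_zero_iff_ae_notMem.1 hS0, hsimp] with φ h1 h2 ω hω
      by_contra h3
      exact h1 ⟨h2, ω, hω, h3⟩
    set F : FullState Ω → Ω → ℝ := fun φ ω =>
      |(G.meanAnn (G.limitBelief μ σ φ) : ℝ) - G.X ω| with hF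
    have hann : StronglyMeasurable[⨆ k, G.pub σ k] fun φ => (G.meanAnn (G.limitBelief μ σ φ) : ℝ) :=
      (continuous_subtype_val.comp G.continuous_meanAnn).comp_stronglyMeasurable
        (measurable_belief_self.stronglyMeasurable)
    have hbd : ∀ φ ω, |F φ ω| ≤ (⨆ ω, G.X ω) - ⨅ ω, G.X ω := by
      intro φ ω
      have h1 := (G.meanAnn (G.limitBelief μ σ φ)).2
      have h2 := G.X_mem ω
      rw [hF, abs_abs, abs_le]
      constructor <;> linarith [h1.1, h1.2, h2.1, h2.2]
    have h1 := integral_belief (μ := μ) hm (F := F)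
      (fun ω => (hann.sub stronglyMeasurable_const).norm) hbd
    have h2 : ∫ φ, ∑ ω, belief μ (⨆ k, G.pub σ k) φ ω * F φ ω ∂(law μ) = 0 := by
      rw [← integral_zero (FullState Ω) ℝ (μ := law μ)]
      refine integral_congr_ae ?_
      filter_upwards [hae, hsimp] with φ h3 h4
      refine Finset.sum_eq_zero fun ω _ => ?_
      rcases (h4.1 ω).eq_or_lt with h5 | h5
      · exact mul_eq_zero_of_left h5.symm _
      · refine mul_eq_zero_of_right _ ?_
        rw [hF]
        dsimp only
        rw [G.coe_meanAnn h4, h3 ω h5, sub_self, abs_zero]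
    rw [h2] at h1
    have h6 : Integrable (fun φ => F φ φ.1) (law μ) := by
      refine Integrable.of_bound ?_ _ (ae_of_all _ fun φ => hbd φ φ.1)
      exact (Measurable.sub (hann.mono hm).measurable
        ((Measurable.of_discrete (f := G.X)).comp measurable_fst)).norm.aestronglyMeasurable
    have h7 := (integral_eq_zero_iff_of_nonneg (fun φ => abs_nonneg _) h6).1 h1
    filter_upwards [h7, hsimp] with φ h8 h9
    rw [← G.coe_meanAnn h9]
    exact sub_eq_zero.1 (abs_eq_zero.1 h8)
  · exfalso
    -- A point of `S` in the support of the law of the limit belief: the profitable deviation found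
    -- at `γ` works on a neighbourhood, which has positive probability.
    obtain ⟨γ, hγ, hpos⟩ := exists_mem_forall_mem_nhdsWithin_pos_measure hS0
    obtain ⟨i, q, R, a, hK, hgain⟩ := hG.exists_testGain_pos hγ.1 hγ.2
    obtain ⟨e, he, hle⟩ := hσ.exists_integral_testGain_le hμ
    set H : (Ω → ℝ) × G.Ann → ℝ := G.testGain i q R a with hH
    have hHc : Continuous H := G.continuous_testGain i q R a
    set V : Set (Ω → ℝ) := {γ | 0 < H (γ, G.meanAnn γ)} with hV
    have hVo : IsOpen V := isOpen_lt continuous_const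
      (hHc.comp (continuous_id.prodMk G.continuous_meanAnn))
    have hVpos := hpos V (mem_nhdsWithin_of_mem_nhds (hVo.mem_nhds hgain))
    rw [Measure.map_apply hmeas hVo.measurableSet] at hVpos
    -- Only the turns of trader `i` count. A further subsequence makes the price converge almost
    -- surely, as dominated convergence needs.
    set ν : ℕ → ℕ := fun j => n * j + i with hν
    have hνm : ∀ j, mover n (ν j) = i := fun j => by
      ext
      simp [hν, mover, Fin.ofNat, Nat.mod_eq_of_lt i.2]
    have hνt : Tendsto ν atTop atTop := by
      refine tendsto_atTop_mono (fun j => ?_) tendsto_id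
      have := Nat.le_mul_of_pos_left j (NeZero.pos n)
      simp only [hν, id]
      omega
    have h1 : TendstoInMeasure (law μ) (fun j φ => G.price σ φ (ν j)) atTop
        fun φ => mean (G.limitBelief μ σ φ) G.X := (hσ.isMarketPrediction hμ).comp hνt
    obtain ⟨ns, hns, hae⟩ := h1.exists_seq_tendsto_ae
    have hlim : ∀ᵐ φ ∂(law μ), Tendsto (fun j => max (H (belief μ (G.pub σ (ν (ns j))) φ,
        G.ann σ φ (ν (ns j)))) 0) atTop
        (𝓝 (max (H (G.limitBelief μ σ φ, G.meanAnn (G.limitBelief μ σ φ))) 0)) := by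
      filter_upwards [hae, G.tendsto_belief μ σ, hsimp] with φ h2 h3 h4
      refine Tendsto.max ((hHc.tendsto _).comp (Tendsto.prodMk_nhds ?_ ?_)) tendsto_const_nhds
      · exact h3.comp (hνt.comp hns.tendsto_atTop)
      · rw [tendsto_subtype_rng, G.coe_meanAnn h4]
        simpa only [G.price_eq] using h2
    obtain ⟨C, hC⟩ := ((isCompact_stdSimplex ℝ Ω).prod
      (isCompact_univ : IsCompact (Set.univ : Set G.Ann))).exists_bound_of_continuousOn
      (hHc.max continuous_const).continuousOn (f := fun x => max (H x) 0)
    have hdom := tendsto_integral_of_dominated_convergence (μ := law μ) (fun _ => C)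
      (fun j => ((hHc.max continuous_const).measurable.comp ((measurable_belief
        ((G.pub σ).le (ν (ns j)))).prodMk (G.measurable_ann σ (ν (ns j))))).aestronglyMeasurable)
      (integrable_const C) (fun j => by
        filter_upwards [belief_mem_stdSimplex (μ := μ) ((G.pub σ).le (ν (ns j)))] with φ hφ
        exact hC (_, _) ⟨hφ, trivial⟩) hlim
    -- The expected positive part at the limit is a limit of quantities below `e`, hence zero,
    -- although the integrand is positive on an event of positive probability.
    have h2 : ∫ φ, max (H (G.limitBelief μ σ φ, G.meanAnn (G.limitBelief μ σ φ))) 0 ∂(law μ) ≤ 0 :=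
      le_of_tendsto_of_tendsto' hdom (he.comp (hνt.comp hns.tendsto_atTop))
        fun j => hle _ i q R a (hνm _) hK
    have h3 : Integrable (fun φ => max (H (G.limitBelief μ σ φ,
        G.meanAnn (G.limitBelief μ σ φ))) 0) (law μ) := by
      refine Integrable.of_bound ((hHc.max continuous_const).measurable.comp
        (hmeas.prodMk (G.continuous_meanAnn.measurable.comp hmeas))).aestronglyMeasurable C ?_
      filter_upwards [hsimp] with φ hφ
      exact hC (_, _) ⟨hφ, trivial⟩
    have h4 := (integral_eq_zero_iff_of_nonneg (fun φ => le_max_right _ _) h3).1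
      (le_antisymm h2 (integral_nonneg fun φ => le_max_right _ _))
    refine hVpos.ne' (measure_mono_null (fun φ hφ => ?_) (ae_iff.1 h4))
    change ¬ (max _ 0 = 0)
    have hφ' : 0 < H (G.limitBelief μ σ φ, G.meanAnn (G.limitBelief μ σ φ)) := hφ
    exact (lt_max_of_lt_left hφ').ne'

end Game

/-! ### The poll -/

theorem ae_realize_pos {p : ℕ → ℝ} (h0 : ∀ τ, 0 ≤ p τ) (h1 : HasSum p 1) :
    ∀ᵐ v : unitInterval, 0 < p (realize p v) := by
  rw [ae_iff]
  refine measure_mono_null (t := ⋃ τ : {τ // p τ = 0}, {v | realize p v = τ}) (fun v hv => ?_) ?_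
  · exact Set.mem_iUnion.2 ⟨⟨realize p v, le_antisymm (not_lt.1 hv) (h0 _)⟩, rfl⟩
  · refine measure_iUnion_null fun τ => ?_
    rw [volume_realize_eq h0 h1, τ.2, ENNReal.ofReal_zero]

variable {Ω : Type*} [Fintype Ω]

theorem posterior_nonneg {γ : Ω → ℝ} (hγ : ∀ ω, 0 ≤ γ ω) (R : Signal Ω) (τ : ℕ) (ω : Ω) :
    0 ≤ posterior γ R τ ω :=
  div_nonneg (mul_nonneg (hγ ω) (R.nonneg ω τ)) (marg_nonneg hγ R τ)

theorem posterior_le_one {γ : Ω → ℝ} (hγ : ∀ ω, 0 ≤ γ ω) (R : Signal Ω) (τ : ℕ) (ω : Ω) :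
    posterior γ R τ ω ≤ 1 :=
  div_le_one_of_le₀ (Finset.single_le_sum (f := fun ω => γ ω * R.prob ω τ)
    (fun ω _ => mul_nonneg (hγ ω) (R.nonneg ω τ)) (Finset.mem_univ ω)) (marg_nonneg hγ R τ)

theorem marg_pos {γ : Ω → ℝ} (hγ : ∀ ω, 0 ≤ γ ω) {R : Signal Ω} {τ : ℕ} {ω : Ω} (h : 0 < γ ω)
    (hR : 0 < R.prob ω τ) : 0 < marg γ R τ :=
  lt_of_lt_of_le (mul_pos h hR) (Finset.single_le_sum (f := fun ω => γ ω * R.prob ω τ)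
    (fun ω _ => mul_nonneg (hγ ω) (R.nonneg ω τ)) (Finset.mem_univ ω))

theorem cellBelief_nonneg {P : Setoid Ω} {μ : Ω → ℝ} (hμ : ∀ ω, 0 ≤ μ ω) (ω ω' : Ω) :
    0 ≤ cellBelief P μ ω ω' := by
  unfold cellBelief
  split_ifs
  · exact div_nonneg (hμ ω') (Finset.sum_nonneg fun _ _ => hμ _)
  · exact le_rfl

theorem rel_and_pos_of_cellBelief_pos {P : Setoid Ω} {μ : Ω → ℝ} (hμ : ∀ ω, 0 ≤ μ ω) {ω ω' : Ω}
    (h : 0 < cellBelief P μ ω ω') : P.r ω ω' ∧ 0 < μ ω' := by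
  by_cases hr : P.r ω ω'
  · refine ⟨hr, (hμ ω').lt_of_ne fun h0 => ?_⟩
    rw [cellBelief, if_pos hr, ← h0, zero_div] at h
    exact lt_irrefl _ h
  · rw [cellBelief, if_neg hr] at h
    exact absurd h (lt_irrefl _)

theorem mean_le {γ X : Ω → ℝ} (hγ : γ ∈ stdSimplex ℝ Ω) {x : ℝ} (h : ∀ ω, 0 < γ ω → X ω ≤ x) :
    mean γ X ≤ x := by
  have h1 : mean γ X ≤ ∑ ω, γ ω * x := Finset.sum_le_sum fun ω _ => by
    rcases (hγ.1 ω).eq_or_lt with h0 | h0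
    · rw [← h0, zero_mul, zero_mul]
    · exact mul_le_mul_of_nonneg_left (h ω h0) h0.le
  rwa [← Finset.sum_mul, hγ.2, one_mul] at h1

theorem mean_lt {γ X : Ω → ℝ} (hγ : γ ∈ stdSimplex ℝ Ω) {x : ℝ} (h : ∀ ω, 0 < γ ω → X ω ≤ x)
    {ω' : Ω} (hω' : 0 < γ ω') (hlt : X ω' < x) : mean γ X < x := by
  have h1 : mean γ X < ∑ ω, γ ω * x := by
    refine Finset.sum_lt_sum (fun ω _ => ?_)
      ⟨ω', Finset.mem_univ _, mul_lt_mul_of_pos_left hlt hω'⟩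
    rcases (hγ.1 ω).eq_or_lt with h0 | h0
    · rw [← h0, zero_mul, zero_mul]
    · exact mul_le_mul_of_nonneg_left (h ω h0) h0.le
  rwa [← Finset.sum_mul, hγ.2, one_mul] at h1

namespace Game

variable [MeasurableSpace Ω] [MeasurableSingletonClass Ω] {n : ℕ} [NeZero n] (G : Game Ω n)

/-- Rules out, almost surely, realizations at which the posterior would be a division by zero. -/
theorem ae_realize_signal_pos (μ : Ω → ℝ) (R : Ω → Signal Ω) (k : ℕ) :
    ∀ᵐ φ ∂(law μ), 0 < (R φ.1).prob φ.1 (realize ((R φ.1).prob φ.1) (φ.2.2 k)) := by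
  have hp : Measurable fun φ : FullState Ω => (R φ.1).prob φ.1 :=
    (Measurable.of_discrete (f := fun ω => (R ω).prob ω)).comp measurable_fst
  have hr : Measurable fun φ : FullState Ω => realize ((R φ.1).prob φ.1) (φ.2.2 k) :=
    measurable_realize.comp (hp.prodMk (by fun_prop))
  have hm : MeasurableSet {φ : FullState Ω |
      0 < (R φ.1).prob φ.1 (realize ((R φ.1).prob φ.1) (φ.2.2 k))} :=
    measurableSet_lt measurable_const ((Measurable.of_discrete
      (f := fun x : Ω × ℕ => (R x.1).prob x.1 x.2)).comp (measurable_fst.prodMk hr))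
  have hmp := measurePreserving_redraw (Ω := Ω) μ k
  change law μ {φ : FullState Ω |
    0 < (R φ.1).prob φ.1 (realize ((R φ.1).prob φ.1) (φ.2.2 k))}ᶜ = 0
  rw [← hmp.measure_preimage hm.compl.nullMeasurableSet,
    Measure.measure_prod_null (hmp.measurable hm.compl)]
  refine ae_of_all _ fun φ => ?_
  have h := ae_iff.1 (ae_realize_pos ((R φ.1).nonneg φ.1) ((R φ.1).hasSum_one φ.1))
  refine (congrArg volume ?_).trans h
  ext v
  simp [redraw]

/-- The announcement of trader `i` in the poll. -/
def pollAnn (μ : Ω → ℝ) (ρ : G.PollChoice) (i : Fin n) (φ : FullState Ω) : ℝ :=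
  mean (posterior (cellBelief (G.part i) μ φ.1) (ρ i (Quotient.mk _ φ.1)).1
    (realize ((ρ i (Quotient.mk _ φ.1)).1.prob φ.1) (φ.2.2 i))) G.X

theorem pollPrediction_eq (μ : Ω → ℝ) (ρ : G.PollChoice) (φ : FullState Ω) :
    G.pollPrediction μ ρ φ = (∑ i : Fin n, G.pollAnn μ ρ i φ) / n := rfl

theorem measurable_pollAnn (μ : Ω → ℝ) (ρ : G.PollChoice) (i : Fin n) :
    Measurable (G.pollAnn μ ρ i) := by
  have hp : Measurable fun φ : FullState Ω => (ρ i (Quotient.mk _ φ.1)).1.prob φ.1 :=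
    (Measurable.of_discrete (f := fun ω => (ρ i (Quotient.mk _ ω)).1.prob ω)).comp measurable_fst
  have hr : Measurable fun φ : FullState Ω =>
      realize ((ρ i (Quotient.mk _ φ.1)).1.prob φ.1) (φ.2.2 i) :=
    measurable_realize.comp (hp.prodMk (by fun_prop))
  have hf : Measurable fun x : Ω × ℕ => mean (posterior
    (cellBelief (G.part i) μ x.1) (ρ i (Quotient.mk _ x.1)).1 x.2) G.X := Measurable.of_discrete
  have h : G.pollAnn μ ρ i = (fun x : Ω × ℕ => mean (posterior
      (cellBelief (G.part i) μ x.1) (ρ i (Quotient.mk _ x.1)).1 x.2) G.X) ∘ fun φ => (φ.1,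
        realize ((ρ i (Quotient.mk _ φ.1)).1.prob φ.1) (φ.2.2 i)) := by
    ext φ
    rfl
  rw [h]
  exact hf.comp (measurable_fst.prodMk hr)

theorem abs_pollAnn_le {μ : Ω → ℝ} (hμ : ∀ ω, 0 ≤ μ ω) (ρ : G.PollChoice) (i : Fin n)
    (φ : FullState Ω) : |G.pollAnn μ ρ i φ| ≤ ∑ ω, |G.X ω| := by
  refine (Finset.abs_sum_le_sum_abs _ _).trans (Finset.sum_le_sum fun ω _ => ?_)
  have h := cellBelief_nonneg (P := G.part i) hμ φ.1
  rw [abs_mul, abs_of_nonneg (posterior_nonneg h _ _ _)]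
  exact mul_le_of_le_one_left (abs_nonneg _) (posterior_le_one h _ _ _)

theorem integrable_pollPrediction {μ : Ω → ℝ} (hμ : ∀ ω, 0 ≤ μ ω) (ρ : G.PollChoice) :
    Integrable (G.pollPrediction μ ρ) (law μ) := by
  simp only [funext (G.pollPrediction_eq μ ρ)]
  refine Integrable.div_const (integrable_finsetSum _ fun i _ => ?_) _
  exact Integrable.of_bound (G.measurable_pollAnn μ ρ i).aestronglyMeasurable _
    (ae_of_all _ fun φ => G.abs_pollAnn_le hμ ρ i φ)

theorem integrable_X (μ : Ω → ℝ) : Integrable (fun φ : FullState Ω => G.X φ.1) (law μ) :=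
  Integrable.of_bound ((Measurable.of_discrete (f := G.X)).comp measurable_fst).aestronglyMeasurable
    (∑ ω, |G.X ω|) (ae_of_all _ fun φ => Finset.single_le_sum (f := fun ω => |G.X ω|)
      (fun _ _ => abs_nonneg _) (Finset.mem_univ φ.1))

theorem law_state (μ : Ω → ℝ) (ω : Ω) :
    law μ (Prod.fst ⁻¹' {ω} : Set (FullState Ω)) = ENNReal.ofReal (μ ω) := by
  classical
  have : (Prod.fst ⁻¹' {ω} : Set (FullState Ω)) = {ω} ×ˢ Set.univ := by ext; simp
  rw [this]
  change ((stateLaw μ).prod _) _ = _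
  rw [Measure.prod_prod, measure_univ, mul_one, stateLaw]
  simp [Measure.coe_finsetSum, Finset.sum_apply, Set.indicator, Finset.sum_ite_eq']

/-- Looking at a state with the highest `X` among those of uncertainty makes all errors there point
downwards, so averaging cannot cancel them. -/
theorem accuracy_pollPrediction_lt_one (h₂ : G.κ.NoExclusion) {μ : Ω → ℝ}
    (hμ : μ ∈ stdSimplex ℝ Ω) (hunc : G.SomeTraderUncertain μ) {ρ : G.PollChoice}
    (hρ : ρ.IsOptimal μ) : G.accuracy μ (G.pollPrediction μ ρ) < 1 := by
  classical
  have hprob := isProbabilityMeasure_law hμ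
  set A : Finset Ω := Finset.univ.filter fun ω =>
    ∃ i ω', 0 < μ ω ∧ 0 < μ ω' ∧ (G.part i).r ω ω' ∧ G.X ω ≠ G.X ω' with hA
  have hne : A.Nonempty := by
    obtain ⟨i, ω, ω', h⟩ := hunc
    exact ⟨ω, Finset.mem_filter.2 ⟨Finset.mem_univ _, i, ω', h⟩⟩
  obtain ⟨ω, hωA, hmax⟩ := A.exists_max_image G.X hne
  obtain ⟨-, i, ω', hω, hω', hr, hX⟩ := Finset.mem_filter.1 hωA
  -- A state that trader `j` confuses with `ω` at a different value of `X` is itself a state of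
  -- uncertainty, hence has no larger value by maximality.
  have hle : ∀ j ω'', 0 < cellBelief (G.part j) μ ω ω'' → G.X ω'' ≤ G.X ω := by
    intro j ω'' h
    obtain ⟨h1, h2⟩ := rel_and_pos_of_cellBelief_pos hμ.1 h
    by_cases h3 : G.X ω'' = G.X ω
    · exact h3.le
    · exact hmax ω'' (Finset.mem_filter.2 ⟨Finset.mem_univ _, j, ω, h2, hω, (G.part j).symm h1, h3⟩)
  -- An optimal signal does at least as well as the free one, so its cost is finite and `h₂` makes
  -- its support independent of the state.
  have hK : G.κ.K (ρ i (Quotient.mk _ ω)) ≠ ⊤ := by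
    refine G.K_ne_top_of_netGain_pos (lt_of_lt_of_le ?_ (hρ i ω hω G.free))
    rw [G.netGain_eq (by simp [K_free])]
    exact EReal.bot_lt_coe _
  have hlt : ∀ᵐ φ ∂(law μ), φ.1 = ω → G.pollPrediction μ ρ φ < G.X φ.1 := by
    have h := ae_all_iff.2 fun j : Fin n =>
      ae_realize_signal_pos μ (fun ω => (ρ j (Quotient.mk _ ω)).1) j
    filter_upwards [h] with φ hφ hφω
    have hpost : ∀ (j : Fin n) ω'', 0 < posterior (cellBelief (G.part j) μ φ.1)
        (ρ j (Quotient.mk _ φ.1)).1 (realize ((ρ j (Quotient.mk _ φ.1)).1.prob φ.1) (φ.2.2 j)) ω'' →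
        G.X ω'' ≤ G.X φ.1 := by
      intro j ω'' h1
      rw [hφω] at h1 ⊢
      refine hle j ω'' ((cellBelief_nonneg hμ.1 ω ω'').lt_of_ne fun h0 => ?_)
      rw [posterior, ← h0, zero_mul, zero_div] at h1
      exact lt_irrefl _ h1
    have hmem : ∀ j : Fin n, posterior (cellBelief (G.part j) μ φ.1)
        (ρ j (Quotient.mk _ φ.1)).1 (realize ((ρ j (Quotient.mk _ φ.1)).1.prob φ.1) (φ.2.2 j)) ∈
        stdSimplex ℝ Ω := by
      intro j
      refine posterior_mem_stdSimplex (cellBelief_nonneg hμ.1 _) _ (marg_pos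
        (cellBelief_nonneg hμ.1 _) (ω := φ.1) ?_ (hφ j)).ne'
      rw [hφω]
      exact cellBelief_pos hμ.1 hω ((G.part j).refl ω) hω
    rw [pollPrediction_eq, div_lt_iff₀ (Nat.cast_pos.2 (NeZero.pos n))]
    have hsum : ∑ j : Fin n, G.pollAnn μ ρ j φ < ∑ j : Fin n, G.X φ.1 := by
      refine Finset.sum_lt_sum (fun j _ => mean_le (hmem j) (hpost j)) ⟨i, Finset.mem_univ _, ?_⟩
      refine mean_lt (hmem i) (hpost i) (ω' := ω') ?_ ?_
      · have h1 := hφ i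
        rw [hφω] at h1 ⊢
        -- The realization observed in `ω` is also possible in `ω'`, which therefore stays in the
        -- support of the posterior.
        have h2 : 0 < (ρ i (Quotient.mk _ ω)).1.prob ω'
            (realize ((ρ i (Quotient.mk _ ω)).1.prob ω) (φ.2.2 i)) := by
          refine ((ρ i _).1.nonneg ω' _).lt_of_ne fun h0 => hK (h₂ _ ω ω' fun h3 => ?_)
          have h4 : realize ((ρ i (Quotient.mk _ ω)).1.prob ω) (φ.2.2 i) ∈
            Function.support ((ρ i (Quotient.mk _ ω)).1.prob ω) := h1.ne'
          rw [h3] at h4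
          exact h4 h0.symm
        exact div_pos (mul_pos (cellBelief_pos hμ.1 hω hr hω') h2)
          (marg_pos (cellBelief_nonneg hμ.1 _)
            (cellBelief_pos hμ.1 hω ((G.part i).refl ω) hω) h1)
      · rw [hφω]
        exact lt_of_le_of_ne (hle i ω' (cellBelief_pos hμ.1 hω hr hω')) hX.symm
    simpa [mul_comm] using hsum
  have hint : Integrable (fun φ => |G.pollPrediction μ ρ φ - G.X φ.1|) (law μ) :=
    ((G.integrable_pollPrediction hμ.1 ρ).sub (G.integrable_X μ)).abs
  have hpos : 0 < ∫ φ, |G.pollPrediction μ ρ φ - G.X φ.1| ∂(law μ) := by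
    refine lt_of_le_of_ne (integral_nonneg fun φ => abs_nonneg _) fun h0 => ?_
    have h1 := (integral_eq_zero_iff_of_nonneg (fun φ => abs_nonneg _) hint).1 h0.symm
    have h2 : ∀ᵐ φ ∂(law μ), φ ∉ (Prod.fst ⁻¹' {ω} : Set (FullState Ω)) := by
      filter_upwards [h1, hlt] with φ h3 h4 h5
      exact (h4 h5).ne (sub_eq_zero.1 (abs_eq_zero.1 h3))
    have h3 := measure_eq_zero_iff_ae_notMem.2 h2
    rw [law_state, ENNReal.ofReal_eq_zero] at h3
    linarith
  rw [accuracy, integral_sub (integrable_const 1) hint]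
  simp
  exact hpos

end Game

/-! ### The value of information -/

section RandPost

variable {Ω : Type*} [Fintype Ω] {γ : Ω → ℝ}

theorem tsum_ofReal_marg (hγ : γ ∈ stdSimplex ℝ Ω) (R : Signal Ω) :
    ∑' τ, ENNReal.ofReal (marg γ R τ) = 1 := by
  have h := hasSum_marg γ R
  rw [← ENNReal.ofReal_tsum_of_nonneg (marg_nonneg hγ.1 R) h.summable, h.tsum_eq, hγ.2,
    ENNReal.ofReal_one]

open Classical in
theorem summable_randPost (hγ : ∀ ω, 0 ≤ γ ω) (R : Signal Ω) (δ : Ω → ℝ) :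
    Summable fun τ => if posterior γ R τ = δ then marg γ R τ else 0 := by
  refine Summable.of_nonneg_of_le (fun τ => ?_) (fun τ => ?_) (hasSum_marg γ R).summable
  · split_ifs
    exacts [marg_nonneg hγ R τ, le_rfl]
  · split_ifs
    exacts [le_rfl, marg_nonneg hγ R τ]

theorem randPost_nonneg (hγ : ∀ ω, 0 ≤ γ ω) (R : Signal Ω) (δ : Ω → ℝ) : 0 ≤ randPost γ R δ := by
  classical
  refine tsum_nonneg fun τ => ?_
  split_ifs
  exacts [marg_nonneg hγ R τ, le_rfl]

theorem randPost_le (hγ : ∀ ω, 0 ≤ γ ω) (R : Signal Ω) (δ : Ω → ℝ) :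
    randPost γ R δ ≤ ∑ ω, γ ω := by
  classical
  rw [← (hasSum_marg γ R).tsum_eq]
  refine (summable_randPost hγ R δ).tsum_le_tsum (fun τ => ?_) (hasSum_marg γ R).summable
  split_ifs
  exacts [le_rfl, marg_nonneg hγ R τ]

theorem sum_posterior_le_one (γ : Ω → ℝ) (R : Signal Ω) (τ : ℕ) : ∑ ω, posterior γ R τ ω ≤ 1 := by
  simp only [posterior]
  rw [← Finset.sum_div]
  exact div_self_le_one _

/-- Regroups realizations by the posterior they induce. It is needed because `SequentialProof`
determines only the distribution of posteriors, not the labels. -/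
theorem tsum_randPost_mul (hγ : ∀ ω, 0 ≤ γ ω) (R : Signal Ω) (V : (Ω → ℝ) → ℝ≥0∞) :
    ∑' δ, ENNReal.ofReal (randPost γ R δ) * V δ =
      ∑' τ, ENNReal.ofReal (marg γ R τ) * V (posterior γ R τ) := by
  classical
  have h : ∀ δ, ENNReal.ofReal (randPost γ R δ) * V δ =
      ∑' τ, if δ = posterior γ R τ then ENNReal.ofReal (marg γ R τ) * V δ else 0 := by
    intro δ
    rw [randPost, ENNReal.ofReal_tsum_of_nonneg _ (summable_randPost hγ R δ),
      ← ENNReal.tsum_mul_right]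
    · refine tsum_congr fun τ => ?_
      by_cases h : posterior γ R τ = δ
      · rw [if_pos h, if_pos h.symm]
      · rw [if_neg h, if_neg (Ne.symm h), ENNReal.ofReal_zero, zero_mul]
    · intro τ
      split_ifs
      exacts [marg_nonneg hγ R τ, le_rfl]
  simp only [h]
  rw [ENNReal.tsum_comm]
  refine tsum_congr fun τ => ?_
  rw [tsum_eq_single (posterior γ R τ)]
  · simp
  · intro δ hδ
    rw [if_neg hδ]

theorem ofReal_tsum_marg_mul_randPost (hγ : ∀ ω, 0 ≤ γ ω) (R : Signal Ω) (S : ℕ → Signal Ω)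
    (δ : Ω → ℝ) :
    ENNReal.ofReal (∑' τ, marg γ R τ * randPost (posterior γ R τ) (S τ) δ) =
      ∑' τ, ENNReal.ofReal (marg γ R τ) *
        ENNReal.ofReal (randPost (posterior γ R τ) (S τ) δ) := by
  have hp := fun τ => posterior_nonneg hγ R τ
  rw [ENNReal.ofReal_tsum_of_nonneg]
  · exact tsum_congr fun τ => ENNReal.ofReal_mul (marg_nonneg hγ R τ)
  · exact fun τ => mul_nonneg (marg_nonneg hγ R τ) (randPost_nonneg (hp τ) _ _)
  · refine Summable.of_nonneg_of_le
      (fun τ => mul_nonneg (marg_nonneg hγ R τ) (randPost_nonneg (hp τ) _ _)) (fun τ => ?_)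
      (hasSum_marg γ R).summable
    exact mul_le_of_le_one_right (marg_nonneg hγ R τ)
      ((randPost_le (hp τ) _ _).trans (sum_posterior_le_one γ R τ))

end RandPost

namespace Game

section Value

variable {Ω : Type*} [Fintype Ω] {n : ℕ} (G : Game Ω n) {γ : Ω → ℝ}

/-- The score, shifted so as to be nonnegative. -/
def posScore (y : G.Ann) (ω : Ω) : ℝ≥0∞ := ENNReal.ofReal (G.score y ω + G.scoreBound)

theorem score_add_nonneg (y : G.Ann) (ω : Ω) : 0 ≤ G.score y ω + G.scoreBound := by
  linarith [neg_abs_le (G.score y ω), G.abs_score_le y ω]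

/-- Shifted scores live in `ℝ≥0∞`, where series can be interchanged freely and infinite costs need
no separate treatment; this translates back to real scores. -/
theorem sum_mul_posScore (hγ : γ ∈ stdSimplex ℝ Ω) (y : G.Ann) :
    ∑ ω, ENNReal.ofReal (γ ω) * G.posScore y ω =
      ENNReal.ofReal (∑ ω, γ ω * G.score y ω + G.scoreBound) := by
  have h : ∑ ω, γ ω * G.score y ω + G.scoreBound = ∑ ω, γ ω * (G.score y ω + G.scoreBound) := by
    simp only [mul_add, Finset.sum_add_distrib]
    rw [← Finset.sum_mul, hγ.2, one_mul]
  rw [h, ENNReal.ofReal_sum_of_nonneg fun ω _ => mul_nonneg (hγ.1 ω) (G.score_add_nonneg y ω)]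
  exact Finset.sum_congr rfl fun ω _ => (ENNReal.ofReal_mul (hγ.1 ω)).symm

/-- Expected (shifted) score of the best announcement at the belief `γ`. -/
def beliefValue (γ : Ω → ℝ) : ℝ≥0∞ := ∑ ω, ENNReal.ofReal (γ ω) * G.posScore (G.meanAnn γ) ω

theorem sum_mul_posScore_le (hγ : γ ∈ stdSimplex ℝ Ω) (y : G.Ann) :
    ∑ ω, ENNReal.ofReal (γ ω) * G.posScore y ω ≤ G.beliefValue γ := by
  rw [beliefValue, G.sum_mul_posScore hγ, G.sum_mul_posScore hγ]
  exact ENNReal.ofReal_le_ofReal (by linarith [G.sum_score_le hγ y])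

theorem beliefValue_le (hγ : γ ∈ stdSimplex ℝ Ω) :
    G.beliefValue γ ≤ ENNReal.ofReal (G.scoreBound + G.scoreBound) := by
  rw [beliefValue, G.sum_mul_posScore hγ]
  refine ENNReal.ofReal_le_ofReal (add_le_add_left ?_ _)
  calc ∑ ω, γ ω * G.score (G.meanAnn γ) ω ≤ ∑ ω, γ ω * G.scoreBound :=
        Finset.sum_le_sum fun ω _ => mul_le_mul_of_nonneg_left
          ((le_abs_self _).trans (G.abs_score_le _ _)) (hγ.1 ω)
    _ = G.scoreBound := by rw [← Finset.sum_mul, hγ.2, one_mul]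

/-- Expected (shifted) score at the belief `γ` if `R` is acquired. -/
def signalValue (γ : Ω → ℝ) (R : Signal Ω) : ℝ≥0∞ :=
  ∑' τ, ENNReal.ofReal (marg γ R τ) * G.beliefValue (posterior γ R τ)

theorem signalValue_le (hγ : γ ∈ stdSimplex ℝ Ω) (R : Signal Ω) :
    G.signalValue γ R ≤ ENNReal.ofReal (G.scoreBound + G.scoreBound) := by
  calc G.signalValue γ R
      ≤ ∑' τ, ENNReal.ofReal (marg γ R τ) * ENNReal.ofReal (G.scoreBound + G.scoreBound) := by
        refine ENNReal.tsum_le_tsum fun τ => ?_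
        by_cases h : marg γ R τ = 0
        · simp [h]
        · gcongr
          exact G.beliefValue_le (posterior_mem_stdSimplex hγ.1 R h)
    _ = ENNReal.ofReal (G.scoreBound + G.scoreBound) := by
        rw [ENNReal.tsum_mul_right, tsum_ofReal_marg hγ, one_mul]

theorem signalValue_eq (hγ : γ ∈ stdSimplex ℝ Ω) (R : Signal Ω) :
    G.signalValue γ R = ENNReal.ofReal (∑ ω, γ ω *
      G.signalScore R (fun τ => G.meanAnn (posterior γ R τ)) ω + G.scoreBound) := by
  have h1 : ∀ τ, ENNReal.ofReal (marg γ R τ) * G.beliefValue (posterior γ R τ) =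
      ENNReal.ofReal (∑ ω, γ ω * (R.prob ω τ * G.score (G.meanAnn (posterior γ R τ)) ω +
        R.prob ω τ * G.scoreBound)) := by
    intro τ
    have h2 : ∀ ω, γ ω * (R.prob ω τ * G.score (G.meanAnn (posterior γ R τ)) ω +
        R.prob ω τ * G.scoreBound) = marg γ R τ * (posterior γ R τ ω *
          (G.score (G.meanAnn (posterior γ R τ)) ω + G.scoreBound)) := by
      intro ω
      rw [← mul_assoc, marg_mul_posterior hγ.1]
      ring
    simp only [h2]
    rw [← Finset.mul_sum, ENNReal.ofReal_mul (marg_nonneg hγ.1 R τ), ENNReal.ofReal_sum_of_nonneg]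
    · congr 1
      exact Finset.sum_congr rfl fun ω _ =>
        (ENNReal.ofReal_mul (posterior_nonneg hγ.1 R τ ω)).symm
    · exact fun ω _ => mul_nonneg (posterior_nonneg hγ.1 R τ ω) (G.score_add_nonneg _ _)
  have h3 : HasSum (fun τ => ∑ ω, γ ω * (R.prob ω τ * G.score (G.meanAnn (posterior γ R τ)) ω +
        R.prob ω τ * G.scoreBound)) (∑ ω, γ ω *
      (G.signalScore R (fun τ => G.meanAnn (posterior γ R τ)) ω + 1 * G.scoreBound)) :=
    hasSum_sum fun ω _ => (((G.summable_signalScore R _ ω).hasSum.add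
      ((R.hasSum_one ω).mul_right _)).mul_left _)
  rw [signalValue, tsum_congr h1, ← ENNReal.ofReal_tsum_of_nonneg _ h3.summable, h3.tsum_eq]
  · congr 1
    simp only [mul_add, Finset.sum_add_distrib, one_mul]
    rw [← Finset.sum_mul, hγ.2, one_mul]
  · intro τ
    refine Finset.sum_nonneg fun ω _ => mul_nonneg (hγ.1 ω) ?_
    rw [← mul_add]
    exact mul_nonneg (R.nonneg ω τ) (G.score_add_nonneg _ _)

theorem posterior_free (hγ : γ ∈ stdSimplex ℝ Ω) {τ : ℕ} (h : marg γ G.free.1 τ ≠ 0) :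
    posterior γ G.free.1 τ = γ := by
  have hm : ∀ ω, marg γ G.free.1 τ = G.free.1.prob ω τ := by
    intro ω
    simp only [marg, fun ω' => G.free_prob ω' ω]
    rw [← Finset.sum_mul, hγ.2, one_mul]
  ext ω
  rw [posterior, ← hm ω, mul_div_assoc, div_self h, mul_one]

theorem signalValue_free (hγ : γ ∈ stdSimplex ℝ Ω) :
    G.signalValue γ G.free.1 = G.beliefValue γ := by
  have : ∀ τ, ENNReal.ofReal (marg γ G.free.1 τ) * G.beliefValue (posterior γ G.free.1 τ) =
      ENNReal.ofReal (marg γ G.free.1 τ) * G.beliefValue γ := by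
    intro τ
    by_cases h : marg γ G.free.1 τ = 0
    · simp [h]
    · rw [G.posterior_free hγ h]
  rw [signalValue, tsum_congr this, ENNReal.tsum_mul_right, tsum_ofReal_marg hγ, one_mul]

/-- The cost of the signal `R`. -/
def cost (R : G.κ.avail) : ℝ≥0∞ := ENNReal.ofReal G.κ.c * G.κ.K R

theorem cost_free : G.cost G.free = 0 := by rw [cost, K_free, mul_zero]

/-- Value of the best signal at the belief `γ`, net of its cost. -/
def optValue (γ : Ω → ℝ) : ℝ≥0∞ := ⨆ R : G.κ.avail, (G.signalValue γ R.1 - G.cost R)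

theorem signalValue_le_optValue_add (γ : Ω → ℝ) (R : G.κ.avail) :
    G.signalValue γ R.1 ≤ G.optValue γ + G.cost R :=
  tsub_le_iff_right.1 (le_iSup (fun R : G.κ.avail => G.signalValue γ R.1 - G.cost R) R)

theorem beliefValue_le_optValue (hγ : γ ∈ stdSimplex ℝ Ω) : G.beliefValue γ ≤ G.optValue γ := by
  have := G.signalValue_le_optValue_add γ G.free
  rwa [G.signalValue_free hγ, cost_free, add_zero] at this

theorem optValue_le (hγ : γ ∈ stdSimplex ℝ Ω) :
    G.optValue γ ≤ ENNReal.ofReal (G.scoreBound + G.scoreBound) :=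
  iSup_le fun R => tsub_le_self.trans (G.signalValue_le hγ R.1)

theorem exists_optValue_add_le (hγ : γ ∈ stdSimplex ℝ Ω) {ε : ℝ≥0∞} (hε : ε ≠ 0) :
    ∃ S : G.κ.avail, G.optValue γ + G.cost S ≤ G.signalValue γ S.1 + ε := by
  by_cases h0 : G.optValue γ = 0
  · exact ⟨G.free, by rw [h0, cost_free, zero_add]; exact zero_le⟩
  · have hne : G.optValue γ ≠ ⊤ := ne_top_of_le_ne_top ENNReal.ofReal_ne_top (G.optValue_le hγ)
    obtain ⟨S, hS⟩ := lt_iSup_iff.1 (ENNReal.sub_lt_self hne h0 hε)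
    refine ⟨S, ?_⟩
    -- The difference is positive by the choice of `S`, so the subtraction was not truncated.
    have h1 : G.cost S ≤ G.signalValue γ S.1 := (tsub_pos_iff_lt.1 (lt_of_le_of_lt zero_le hS)).le
    have h2 := tsub_le_iff_right.1 hS.le
    calc G.optValue γ + G.cost S ≤ G.signalValue γ S.1 - G.cost S + ε + G.cost S :=
        add_le_add h2 le_rfl
      _ = G.signalValue γ S.1 - G.cost S + G.cost S + ε := by ring
      _ = G.signalValue γ S.1 + ε := by rw [tsub_add_cancel_of_le h1]

/-- Acquiring information sequentially does not help. -/
theorem tsum_optValue_posterior_le (h₁ : G.κ.SequentialProof) (hγ : γ ∈ stdSimplex ℝ Ω)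
    (R : G.κ.avail) :
    ∑' τ, ENNReal.ofReal (marg γ R.1 τ) * G.optValue (posterior γ R.1 τ) ≤
      G.optValue γ + G.cost R := by
  refine ENNReal.le_of_forall_pos_le_add fun ε hε _ => ?_
  have hε' : (ε : ℝ≥0∞) ≠ 0 := by simpa using hε.ne'
  -- The supremum in `optValue` need not be attained, so an `ε`-optimal continuation is chosen after
  -- each realization. Assumption 1 merges these with `R` into the single signal `R'`.
  have hex : ∀ τ, ∃ S : G.κ.avail, marg γ R.1 τ ≠ 0 →
      G.optValue (posterior γ R.1 τ) + G.cost S ≤ G.signalValue (posterior γ R.1 τ) S.1 + ε := by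
    intro τ
    by_cases h : marg γ R.1 τ = 0
    · exact ⟨G.free, fun h' => absurd h h'⟩
    · obtain ⟨S, hS⟩ := G.exists_optValue_add_le (posterior_mem_stdSimplex hγ.1 R.1 h) hε'
      exact ⟨S, fun _ => hS⟩
  choose S hS using hex
  obtain ⟨R', hR', hK⟩ := h₁ γ hγ R S
  have hval : G.signalValue γ R'.1 = ∑' τ, ENNReal.ofReal (marg γ R.1 τ) *
      G.signalValue (posterior γ R.1 τ) (S τ).1 := by
    simp only [signalValue]
    rw [← tsum_randPost_mul hγ.1 R'.1 G.beliefValue]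
    simp only [hR', ofReal_tsum_marg_mul_randPost hγ.1, ← ENNReal.tsum_mul_right]
    rw [ENNReal.tsum_comm]
    refine tsum_congr fun τ => ?_
    rw [← tsum_randPost_mul (posterior_nonneg hγ.1 R.1 τ), ← ENNReal.tsum_mul_left]
    exact tsum_congr fun δ => mul_assoc _ _ _
  set Q : ℝ≥0∞ := ∑' τ, ENNReal.ofReal (marg γ R.1 τ) * G.cost (S τ) with hQ
  have hcost : G.cost R' ≤ G.cost R + Q := by
    have : Q = ENNReal.ofReal G.κ.c * ∑' τ, ENNReal.ofReal (marg γ R.1 τ) * G.κ.K (S τ) := by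
      rw [← ENNReal.tsum_mul_left]
      exact tsum_congr fun τ => by rw [cost]; ring
    rw [this, cost, cost, ← mul_add]
    gcongr
  have hsum : ∑' τ, ENNReal.ofReal (marg γ R.1 τ) * G.optValue (posterior γ R.1 τ) + Q ≤
      G.signalValue γ R'.1 + ε := by
    rw [hQ, ← ENNReal.tsum_add, hval]
    calc ∑' τ, (ENNReal.ofReal (marg γ R.1 τ) * G.optValue (posterior γ R.1 τ) +
          ENNReal.ofReal (marg γ R.1 τ) * G.cost (S τ))
        ≤ ∑' τ, (ENNReal.ofReal (marg γ R.1 τ) * G.signalValue (posterior γ R.1 τ) (S τ).1 +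
          ENNReal.ofReal (marg γ R.1 τ) * ε) := by
          refine ENNReal.tsum_le_tsum fun τ => ?_
          rw [← mul_add, ← mul_add]
          by_cases h : marg γ R.1 τ = 0
          · simp [h]
          · exact mul_le_mul' le_rfl (hS τ h)
      _ = _ := by
          rw [ENNReal.tsum_add, ENNReal.tsum_mul_right, tsum_ofReal_marg hγ, one_mul]
  -- Finiteness of the expected continuation cost allows it to be cancelled.
  have hQfin : Q ≠ ⊤ := by
    refine ne_top_of_le_ne_top (ENNReal.add_ne_top.2 ⟨?_, ENNReal.coe_ne_top⟩)
      ((le_add_left le_rfl).trans hsum)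
    exact ne_top_of_le_ne_top ENNReal.ofReal_ne_top (G.signalValue_le hγ R'.1)
  refine (ENNReal.add_le_add_iff_right hQfin).1 (hsum.trans ?_)
  calc G.signalValue γ R'.1 + ε ≤ G.optValue γ + (G.cost R + Q) + ε := by
        gcongr
        exact (G.signalValue_le_optValue_add γ R').trans (by gcongr)
    _ = G.optValue γ + G.cost R + ε + Q := by ring

theorem optValue_le_beliefValue (hγ : γ ∈ stdSimplex ℝ Ω)
    (h : ∀ R : G.κ.avail, G.netGain γ R ≤ 0) : G.optValue γ ≤ G.beliefValue γ := by
  refine iSup_le fun R => tsub_le_iff_right.2 ?_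
  by_cases hK : G.κ.K R = ⊤
  · rw [cost, hK, ENNReal.mul_top (by simpa using G.κ.c_pos), add_top]
    exact le_top
  · have h1 := h R
    rw [G.netGain_eq hK, ← EReal.coe_zero, EReal.coe_le_coe_iff, G.gain_eq hγ] at h1
    simp only [mul_sub, Finset.sum_sub_distrib] at h1
    have h2 : G.cost R = ENNReal.ofReal (G.κ.c * (G.κ.K R).toReal) := by
      rw [ENNReal.ofReal_mul G.κ.c_pos.le, ENNReal.ofReal_toReal hK, cost]
    rw [G.signalValue_eq hγ, beliefValue, G.sum_mul_posScore hγ, h2]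
    refine (ENNReal.ofReal_le_ofReal ?_).trans ENNReal.ofReal_add_le
    linarith

end Value

end Game

namespace Game

variable {Ω : Type*} [Fintype Ω] [MeasurableSpace Ω] [MeasurableSingletonClass Ω] {n : ℕ}
  [NeZero n] (G : Game Ω n)

/-! ### Play as a tree -/

section Tree

variable (σ : G.Profile) (ω : Ω) (ι : ℕ → unitInterval)

/-- Expectation in state `ω`, after the records `h` of the first `k` periods and given the private
randomizations `ι`, of the sum of `r` over the next `m` periods and of `g` after these periods. -/
def treeSum (g r : (k : ℕ) → (Fin k → G.Record) → ℝ≥0∞) :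
    ℕ → (k : ℕ) → (Fin k → G.Record) → ℝ≥0∞
  | 0, k, h => g k h
  | m + 1, k, h => r k h + ∑' τ, ENNReal.ofReal ((G.chosen σ ω ι k h).1.prob ω τ) *
      treeSum g r m (k + 1) (Fin.snoc (α := fun _ => G.Record) h (G.respond σ ω ι k h τ))

variable {g r : (k : ℕ) → (Fin k → G.Record) → ℝ≥0∞}

theorem measurable_treeSum (hg : ∀ k, Measurable (g k)) (hr : ∀ k, Measurable (r k)) (m : ℕ) :
    ∀ k, Measurable (G.treeSum σ ω ι g r m k) := by
  induction m with
  | zero => exact hg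
  | succ m ih =>
    intro k
    have h1 : Measurable fun h : Fin k → G.Record => G.chosen σ ω ι k h :=
      (G.measurable_chosen σ k).comp (f := fun h => ((ω, ι), h)) (by fun_prop)
    refine (hr k).add (Measurable.tsum fun τ => Measurable.mul ?_ ?_)
    · exact ENNReal.measurable_ofReal.comp ((measurable_pi_apply τ).comp
        ((Signal.measurable_prob ω).comp (measurable_subtype_coe.comp h1)))
    · have h2 : Measurable fun h : Fin k → G.Record => G.respond σ ω ι k h τ :=
        (G.measurable_respond σ k).comp (f := fun h => (((ω, ι), h), τ)) (by fun_prop)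
      exact (ih (k + 1)).comp (measurable_snoc measurable_id h2)

theorem measurable_play_right (k : ℕ) :
    Measurable fun u : ℕ → unitInterval => G.play σ (ω, ι, u) k :=
  (G.measurable_play σ k).comp (f := fun u => (ω, ι, u)) (by fun_prop)

/-- Past records and the choice of signal do not use the draw of period `k`; integrating it out
leaves a sum over realizations, one level of the tree. -/
theorem lintegral_play_succ (k : ℕ) {F : (Fin (k + 1) → G.Record) → ℝ≥0∞} (hF : Measurable F) :
    ∫⁻ u, F (G.play σ (ω, ι, u) (k + 1))
        ∂(Measure.infinitePi fun _ : ℕ => (volume : Measure unitInterval)) =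
      ∫⁻ u, ∑' τ, ENNReal.ofReal ((G.chosen σ ω ι k (G.play σ (ω, ι, u) k)).1.prob ω τ) *
        F (Fin.snoc (α := fun _ => G.Record) (G.play σ (ω, ι, u) k)
          (G.respond σ ω ι k (G.play σ (ω, ι, u) k) τ))
        ∂(Measure.infinitePi fun _ : ℕ => (volume : Measure unitInterval)) := by
  have hmp := measurePreserving_update k
  have hm : Measurable fun u => F (G.play σ (ω, ι, u) (k + 1)) :=
    hF.comp (G.measurable_play_right σ ω ι (k + 1))
  have hmc : Measurable fun x : (ℕ → unitInterval) × unitInterval =>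
      F (G.play σ (ω, ι, Function.update x.1 k x.2) (k + 1)) := hm.comp hmp.measurable
  rw [← hmp.lintegral_comp hm, lintegral_prod _ hmc.aemeasurable]
  refine lintegral_congr fun u => ?_
  have h1 : ∀ v, G.play σ (ω, ι, Function.update u k v) k = G.play σ (ω, ι, u) k :=
    fun v => G.play_redraw σ (ω, ι, u) k v
  have h2 : ∀ v, F (G.play σ (ω, ι, Function.update u k v) (k + 1)) =
      (fun τ => F (Fin.snoc (α := fun _ => G.Record) (G.play σ (ω, ι, u) k)
        (G.respond σ ω ι k (G.play σ (ω, ι, u) k) τ)))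
        (realize ((G.chosen σ ω ι k (G.play σ (ω, ι, u) k)).1.prob ω) v) := by
    intro v
    rw [play, h1, step_eq]
    simp
  have h3 := lintegral_realize ((G.chosen σ ω ι k (G.play σ (ω, ι, u) k)).1.nonneg ω)
    ((G.chosen σ ω ι k (G.play σ (ω, ι, u) k)).1.hasSum_one ω)
    (fun τ => F (Fin.snoc (α := fun _ => G.Record) (G.play σ (ω, ι, u) k)
      (G.respond σ ω ι k (G.play σ (ω, ι, u) k) τ)))
  exact (lintegral_congr h2).trans h3

theorem lintegral_treeSum (hg : ∀ k, Measurable (g k)) (hr : ∀ k, Measurable (r k)) (m : ℕ) :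
    ∀ k, ∫⁻ u, G.treeSum σ ω ι g r m k (G.play σ (ω, ι, u) k)
        ∂(Measure.infinitePi fun _ : ℕ => (volume : Measure unitInterval)) =
      ∫⁻ u, (∑ j ∈ Finset.range m, r (k + j) (G.play σ (ω, ι, u) (k + j)) +
        g (k + m) (G.play σ (ω, ι, u) (k + m)))
        ∂(Measure.infinitePi fun _ : ℕ => (volume : Measure unitInterval)) := by
  induction m with
  | zero => intro k; simp [treeSum]
  | succ m ih =>
    intro k
    have hrk : Measurable fun u => r k (G.play σ (ω, ι, u) k) :=
      (hr k).comp (G.measurable_play_right σ ω ι k)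
    simp only [treeSum]
    rw [lintegral_add_left hrk,
      ← G.lintegral_play_succ σ ω ι k (G.measurable_treeSum σ ω ι hg hr m (k + 1)), ih (k + 1),
      ← lintegral_add_left hrk]
    refine lintegral_congr fun u => ?_
    rw [Finset.sum_range_succ', ← add_assoc]
    have h3 : ∀ j, k + 1 + j = k + (j + 1) := fun j => by ring
    have h4 : ∀ a b, a = b → r a (G.play σ (ω, ι, u) a) = r b (G.play σ (ω, ι, u) b) := by
      rintro a _ rfl; rfl
    have h5 : ∀ a b, a = b → g a (G.play σ (ω, ι, u) a) = g b (G.play σ (ω, ι, u) b) := by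
      rintro a _ rfl; rfl
    rw [h5 _ _ (h3 m), Finset.sum_congr rfl fun j _ => h4 _ _ (h3 j), add_zero]
    ring

theorem treeSum_zero (hg : ∀ k, Measurable (g k)) (hr : ∀ k, Measurable (r k)) (m : ℕ) :
    G.treeSum σ ω ι g r m 0 Fin.elim0 =
      ∫⁻ u, (∑ j ∈ Finset.range m, r j (G.play σ (ω, ι, u) j) + g m (G.play σ (ω, ι, u) m))
        ∂(Measure.infinitePi fun _ : ℕ => (volume : Measure unitInterval)) := by
  have h := G.lintegral_treeSum σ ω ι hg hr m 0
  simp only [play, lintegral_const, measure_univ, mul_one] at h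
  rw [h]
  refine lintegral_congr fun u => ?_
  have h3 : ∀ j, 0 + j = j := fun j => by ring
  have h4 : ∀ a b, a = b → r a (G.play σ (ω, ι, u) a) = r b (G.play σ (ω, ι, u) b) := by
    rintro a _ rfl; rfl
  have h5 : ∀ a b, a = b → g a (G.play σ (ω, ι, u) a) = g b (G.play σ (ω, ι, u) b) := by
    rintro a _ rfl; rfl
  rw [h5 _ _ (h3 m), Finset.sum_congr rfl fun j _ => h4 _ _ (h3 j)]

end Tree

/-- The (shifted) score of the last announcement. -/
def lastScore (ω : Ω) (k : ℕ) (h : Fin k → G.Record) : ℝ≥0∞ :=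
  G.posScore (G.lastPrice fun j => (h j).2) ω

theorem measurable_posScore (ω : Ω) : Measurable fun y : G.Ann => G.posScore y ω :=
  ENNReal.measurable_ofReal.comp ((G.continuous_score ω).measurable.add_const _)

theorem measurable_lastScore (ω : Ω) (k : ℕ) : Measurable (G.lastScore ω k) :=
  (G.measurable_posScore ω).comp ((G.measurable_lastPrice k).comp (by fun_prop))

/-- The cost of the signal acquired after the records `h`. -/
def chosenCost (σ : G.Profile) (ω : Ω) (ι : ℕ → unitInterval) (k : ℕ) (h : Fin k → G.Record) :
    ℝ≥0∞ := G.cost (G.chosen σ ω ι k h)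

theorem measurable_cost : Measurable G.cost :=
  Measurable.const_mul G.κ.measurable_K _

theorem measurable_chosenCost (σ : G.Profile) (ω : Ω) (ι : ℕ → unitInterval) (k : ℕ) :
    Measurable (G.chosenCost σ ω ι k) :=
  G.measurable_cost.comp
    ((G.measurable_chosen σ k).comp (f := fun h => ((ω, ι), h)) (by fun_prop))

/-- If the play does not depend on the state, within the support of the belief `γ`, except through
the realizations of the signals, then the expected final score is at most the value of the best
signal at `γ` plus the expected cost of the acquired signals. -/
theorem sum_treeSum_le (h₁ : G.κ.SequentialProof) {σ : G.Profile} {ι : ℕ → unitInterval}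
    {A : Set Ω} (hR : ∀ ω ∈ A, ∀ ω' ∈ A, ∀ k h, G.chosen σ ω ι k h = G.chosen σ ω' ι k h)
    (hA : ∀ ω ∈ A, ∀ ω' ∈ A, ∀ k h τ, G.respond σ ω ι k h τ = G.respond σ ω' ι k h τ) (m : ℕ) :
    ∀ (γ : Ω → ℝ) (k : ℕ) (h : Fin k → G.Record), γ ∈ stdSimplex ℝ Ω → (∀ ω, γ ω ≠ 0 → ω ∈ A) →
      ∑ ω, ENNReal.ofReal (γ ω) * G.treeSum σ ω ι (G.lastScore ω) (fun _ _ => 0) m k h ≤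
      G.optValue γ + ∑ ω, ENNReal.ofReal (γ ω) *
        G.treeSum σ ω ι (fun _ _ => 0) (G.chosenCost σ ω ι) m k h := by
  induction m with
  | zero =>
    intro γ k h hγ _
    -- At the final node the announcement is at best the mean under the current belief, and the free
    -- signal already achieves that value.
    refine le_add_right ?_
    exact (G.sum_mul_posScore_le hγ _).trans (G.beliefValue_le_optValue hγ)
  | succ m ih =>
    intro γ k h hγ hsupp
    obtain ⟨ω₀, hω₀⟩ : ∃ ω, γ ω ≠ 0 := by
      by_contra! h0
      have := hγ.2
      simp [h0] at this
    have hω₀A := hsupp ω₀ hω₀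
    set R := G.chosen σ ω₀ ι k h with hRdef
    set next : ℕ → Fin (k + 1) → G.Record := fun τ =>
      Fin.snoc (α := fun _ => G.Record) h (G.respond σ ω₀ ι k h τ) with hnext
    -- Bayes' rule: drawing the state and then the realization is the same as drawing the
    -- realization and then the state from the posterior. Within the support, signal and record are
    -- those of the reference state `ω₀`.
    have hswap : ∀ T : Ω → (Fin (k + 1) → G.Record) → ℝ≥0∞,
        ∑ ω, ENNReal.ofReal (γ ω) * ∑' τ, ENNReal.ofReal ((G.chosen σ ω ι k h).1.prob ω τ) *
          T ω (Fin.snoc (α := fun _ => G.Record) h (G.respond σ ω ι k h τ)) =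
        ∑' τ, ENNReal.ofReal (marg γ R.1 τ) *
          ∑ ω, ENNReal.ofReal (posterior γ R.1 τ ω) * T ω (next τ) := by
      intro T
      have h1 : ∀ ω, ENNReal.ofReal (γ ω) *
          ∑' τ, ENNReal.ofReal ((G.chosen σ ω ι k h).1.prob ω τ) *
          T ω (Fin.snoc (α := fun _ => G.Record) h (G.respond σ ω ι k h τ)) =
          ∑' τ, ENNReal.ofReal (marg γ R.1 τ) * (ENNReal.ofReal (posterior γ R.1 τ ω) *
            T ω (next τ)) := by
        intro ω
        by_cases h0 : γ ω = 0
        · simp [h0, posterior]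
        · rw [← ENNReal.tsum_mul_left]
          refine tsum_congr fun τ => ?_
          rw [hR ω (hsupp ω h0) ω₀ hω₀A, hA ω (hsupp ω h0) ω₀ hω₀A, ← mul_assoc, ← mul_assoc,
            ← ENNReal.ofReal_mul (hγ.1 ω), ← ENNReal.ofReal_mul (marg_nonneg hγ.1 _ _),
            marg_mul_posterior hγ.1]
      simp only [h1, Finset.mul_sum]
      exact (Summable.tsum_finsetSum fun ω _ => ENNReal.summable).symm
    simp only [treeSum, zero_add, mul_add, Finset.sum_add_distrib]
    rw [hswap fun ω => G.treeSum σ ω ι (G.lastScore ω) (fun _ _ => 0) m (k + 1),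
      hswap fun ω => G.treeSum σ ω ι (fun _ _ => 0) (G.chosenCost σ ω ι) m (k + 1)]
    have hcost : ∑ ω, ENNReal.ofReal (γ ω) * G.chosenCost σ ω ι k h = G.cost R := by
      have h1 : ∀ ω, ENNReal.ofReal (γ ω) * G.chosenCost σ ω ι k h =
          ENNReal.ofReal (γ ω) * G.cost R := by
        intro ω
        by_cases h0 : γ ω = 0
        · simp [h0]
        · rw [chosenCost, hR ω (hsupp ω h0) ω₀ hω₀A]
      simp only [h1]
      rw [← Finset.sum_mul, ← ENNReal.ofReal_sum_of_nonneg fun ω _ => hγ.1 ω, hγ.2,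
        ENNReal.ofReal_one, one_mul]
    rw [hcost, ← add_assoc]
    -- Induction at each posterior; the expected value of optimal continuations is then at most the
    -- optimal value at `γ` plus the cost of `R`, by `tsum_optValue_posterior_le`.
    calc ∑' τ, ENNReal.ofReal (marg γ R.1 τ) * ∑ ω, ENNReal.ofReal (posterior γ R.1 τ ω) *
          G.treeSum σ ω ι (G.lastScore ω) (fun _ _ => 0) m (k + 1) (next τ)
        ≤ ∑' τ, ENNReal.ofReal (marg γ R.1 τ) * (G.optValue (posterior γ R.1 τ) +
          ∑ ω, ENNReal.ofReal (posterior γ R.1 τ ω) *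
          G.treeSum σ ω ι (fun _ _ => 0) (G.chosenCost σ ω ι) m (k + 1) (next τ)) := by
          refine ENNReal.tsum_le_tsum fun τ => ?_
          by_cases h0 : marg γ R.1 τ = 0
          · simp [h0]
          · refine mul_le_mul' le_rfl (ih _ _ _ (posterior_mem_stdSimplex hγ.1 _ h0) ?_)
            intro ω hω
            refine hsupp ω fun h1 => hω ?_
            rw [posterior, h1, zero_mul, zero_div]
      _ ≤ _ := by
          simp only [mul_add]
          rw [ENNReal.tsum_add]
          exact add_le_add (G.tsum_optValue_posterior_le h₁ hγ R) le_rfl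

end Game

open Classical in
theorem sum_cell_mul {Ω : Type*} [Fintype Ω] {P : Setoid Ω} {μ : Ω → ℝ} (hμ : ∀ ω, 0 ≤ μ ω)
    {ω₀ : Ω} (h : 0 < μ ω₀) (F : Ω → ℝ≥0∞) :
    ∑ ω with Quotient.mk P ω = Quotient.mk P ω₀, ENNReal.ofReal (μ ω) * F ω =
      ENNReal.ofReal (cellMass P μ ω₀) * ∑ ω, ENNReal.ofReal (cellBelief P μ ω₀ ω) * F ω := by
  rw [Finset.mul_sum, Finset.sum_filter]
  refine Finset.sum_congr rfl fun ω _ => ?_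
  rw [← mul_assoc, ← ENNReal.ofReal_mul (cellMass_pos hμ h).le, cellMass_mul_cellBelief hμ h]
  have : Quotient.mk P ω = Quotient.mk P ω₀ ↔ P.r ω₀ ω := by
    rw [Quotient.eq]
    exact ⟨fun h => P.symm h, fun h => P.symm h⟩
  by_cases hr : P.r ω₀ ω
  · rw [if_pos (this.2 hr), if_pos hr]
  · rw [if_neg (mt this.1 hr), if_neg hr, ENNReal.ofReal_zero, zero_mul]

namespace Game

variable {Ω : Type*} [Fintype Ω] [MeasurableSpace Ω] [MeasurableSingletonClass Ω] {n : ℕ}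
  [NeZero n] (G : Game Ω n)

/-! ### An equilibrium without information acquisition -/

/-- The last of the announcements `h`, or `v` if there is none. -/
def echoPrice (v : G.Ann) : {k : ℕ} → (Fin k → G.Ann) → G.Ann
  | 0, _ => v
  | k + 1, h => h (Fin.last k)

theorem measurable_echoPrice (v : G.Ann) : (k : ℕ) → Measurable (G.echoPrice v (k := k))
  | 0 => measurable_const
  | k + 1 => measurable_pi_apply (Fin.last k)

/-- Acquire no information, announce `v` in the first period and repeat the last announcement in
all others. -/
def echo (v : G.Ann) (i : Fin n) : G.Strategy i where
  signal _ _ := G.free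
  announce _ a := G.echoPrice v a.1.1.2.2
  measurable_signal _ := measurable_const
  measurable_announce k := (G.measurable_echoPrice v k).comp (by fun_prop)

variable (v : G.Ann) {i : Fin n} (τ : G.Strategy i)

/-- Trader `i` plays `τ` and all others play `echo`. -/
def echoExcept : G.Profile := Function.update (G.echo v) i τ

theorem echoExcept_of_ne {j : Fin n} (h : j ≠ i) : G.echoExcept v τ j = G.echo v j :=
  Function.update_of_ne h _ _

theorem infoOf_congr {ω ω' : Ω} (h : (G.part i).r ω ω') {k : ℕ} (x : Fin k → G.Record) :
    G.infoOf i ω x = G.infoOf i ω' x := by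
  unfold infoOf
  rw [Quotient.sound (s := G.part i) h]

/-- `echo` ignores the cell and `i` does not distinguish states of his own cell. Hence, within it,
play depends on the state only through realizations, as `sum_treeSum_le` requires. -/
theorem echoExcept_chosen_congr {ω ω' : Ω} (h : (G.part i).r ω ω') (ι : ℕ → unitInterval) (k : ℕ)
    (x : Fin k → G.Record) :
    G.chosen (G.echoExcept v τ) ω ι k x = G.chosen (G.echoExcept v τ) ω' ι k x := by
  have : ∀ j, ((G.echoExcept v τ) j).signal k (G.infoOf j ω x, ι k) =
      ((G.echoExcept v τ) j).signal k (G.infoOf j ω' x, ι k) := by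
    intro j
    by_cases hj : j = i
    · subst hj
      rw [G.infoOf_congr h]
    · rw [G.echoExcept_of_ne v τ hj]
      rfl
  exact this _

theorem echoExcept_respond_congr {ω ω' : Ω} (h : (G.part i).r ω ω') (ι : ℕ → unitInterval) (k : ℕ)
    (x : Fin k → G.Record) (t : ℕ) :
    G.respond (G.echoExcept v τ) ω ι k x t = G.respond (G.echoExcept v τ) ω' ι k x t := by
  have : ∀ j, ((G.echoExcept v τ) j).announce k ((G.infoOf j ω x, ι k), t) =
      ((G.echoExcept v τ) j).announce k ((G.infoOf j ω' x, ι k), t) := by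
    intro j
    by_cases hj : j = i
    · subst hj
      rw [G.infoOf_congr h]
    · rw [G.echoExcept_of_ne v τ hj]
      rfl
  unfold respond
  rw [G.echoExcept_chosen_congr v τ h, this]

theorem echo_step {σ : G.Profile} {k : ℕ} (hk : σ (mover n k) = G.echo v (mover n k))
    (φ : FullState Ω) :
    G.acquired σ φ k = G.free ∧ G.ann σ φ (k + 1) = if k = 0 then v else G.ann σ φ k := by
  rw [ann_succ, acquired]
  simp only [step, hk]
  refine ⟨rfl, ?_⟩
  cases k with
  | zero => rfl
  | succ k => rfl

/-- Expected score of the constant announcement `v`. -/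
def constScore (μ : Ω → ℝ) : ℝ := ∫ φ, G.score v φ.1 ∂(law μ)

theorem expScore_of_echo {μ : Ω → ℝ} {σ : G.Profile} {k : ℕ}
    (hk : σ (mover n k) = G.echo v (mover n k)) :
    G.expScore μ σ (k + 1) = if k = 0 then G.constScore v μ else G.expScore μ σ k := by
  simp only [expScore, constScore, (G.echo_step v hk _).2]
  split_ifs <;> rfl

theorem periodCost_of_echo {μ : Ω → ℝ} {σ : G.Profile} {k : ℕ}
    (hk : σ (mover n k) = G.echo v (mover n k)) : G.periodCost μ σ k = 0 := by
  simp [periodCost, (G.echo_step v hk _).1, K_free]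

theorem lintegral_posScore {μ : Ω → ℝ} (hμ : μ ∈ stdSimplex ℝ Ω) {y : FullState Ω → G.Ann}
    (hy : Measurable y) : ∫⁻ φ, G.posScore (y φ) φ.1 ∂(law μ) =
      ENNReal.ofReal (∫ φ, G.score (y φ) φ.1 ∂(law μ) + G.scoreBound) := by
  have := isProbabilityMeasure_law hμ
  have hi := G.integrable_score μ hy
  have h : ∫ φ, G.score (y φ) φ.1 ∂(law μ) + G.scoreBound =
      ∫ φ, (G.score (y φ) φ.1 + G.scoreBound) ∂(law μ) := by
    rw [integral_add hi (integrable_const _)]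
    simp
  rw [h]
  exact (ofReal_integral_eq_lintegral_ofReal (hi.add (integrable_const G.scoreBound))
    (ae_of_all _ fun φ => G.score_add_nonneg _ _)).symm

theorem periodCost_eq (μ : Ω → ℝ) (σ : G.Profile) (k : ℕ) :
    G.periodCost μ σ k = ∫⁻ φ, G.cost (G.acquired σ φ k) ∂(law μ) := by
  exact (lintegral_const_mul _ (G.κ.measurable_K.comp (G.measurable_acquired σ k))).symm

variable {v} in
/-- If there is no information acquisition at `μ` and all the traders expect `v`, then the expected
final score, gross of the cost of information, of a trader who alone acquires information is at
most that of `v`, plus the cost. -/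
theorem sum_lintegral_posScore_le (h₁ : G.κ.SequentialProof) {μ : Ω → ℝ} (hμ : μ ∈ stdSimplex ℝ Ω)
    (hv : ∀ ω, 0 < μ ω → mean (cellBelief (G.part i) μ ω) G.X = v) (hacq : G.NoAcquisition μ)
    (ι : ℕ → unitInterval) (m : ℕ) :
    ∑ ω, ENNReal.ofReal (μ ω) * ∫⁻ u, G.posScore (G.ann (G.echoExcept v τ) (ω, ι, u) m) ω
        ∂(Measure.infinitePi fun _ : ℕ => (volume : Measure unitInterval)) ≤
      ∑ ω, ENNReal.ofReal (μ ω) * ∫⁻ u, (G.posScore v ω +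
        ∑ j ∈ Finset.range m, G.cost (G.acquired (G.echoExcept v τ) (ω, ι, u) j))
        ∂(Measure.infinitePi fun _ : ℕ => (volume : Measure unitInterval)) := by
  classical
  set σ := G.echoExcept v τ with hσ
  have hf : ∀ ω, ∫⁻ u, G.posScore (G.ann σ (ω, ι, u) m) ω
      ∂(Measure.infinitePi fun _ : ℕ => (volume : Measure unitInterval)) =
      G.treeSum σ ω ι (G.lastScore ω) (fun _ _ => 0) m 0 Fin.elim0 := by
    intro ω
    rw [G.treeSum_zero σ ω ι (G.measurable_lastScore ω) (fun _ => measurable_const)]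
    simp only [Finset.sum_const_zero, zero_add]
    rfl
  have hg : ∀ ω, ∫⁻ u, (G.posScore v ω + ∑ j ∈ Finset.range m, G.cost (G.acquired σ (ω, ι, u) j))
      ∂(Measure.infinitePi fun _ : ℕ => (volume : Measure unitInterval)) =
      G.posScore v ω + G.treeSum σ ω ι (fun _ _ => 0) (G.chosenCost σ ω ι) m 0 Fin.elim0 := by
    intro ω
    rw [G.treeSum_zero σ ω ι (fun _ => measurable_const) (G.measurable_chosenCost σ ω ι),
      lintegral_add_left measurable_const, lintegral_const, measure_univ, mul_one]
    simp only [add_zero]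
    rfl
  simp only [hf, hg]
  -- The bound is proved cell by cell: at each cell belief no signal pays, so the optimal value is
  -- that of announcing the cell mean `v`.
  rw [← Finset.sum_fiberwise Finset.univ (Quotient.mk (G.part i)),
    ← Finset.sum_fiberwise Finset.univ (Quotient.mk (G.part i))]
  refine Finset.sum_le_sum fun q _ => ?_
  by_cases hq : ∃ ω₀, Quotient.mk (G.part i) ω₀ = q ∧ 0 < μ ω₀
  · obtain ⟨ω₀, rfl, hω₀⟩ := hq
    rw [sum_cell_mul hμ.1 hω₀, sum_cell_mul hμ.1 hω₀]
    refine mul_le_mul' le_rfl ?_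
    have hγ := cellBelief_mem_stdSimplex (P := G.part i) hμ.1 hω₀
    have hA : ∀ ω ∈ {ω | (G.part i).r ω₀ ω}, ∀ ω' ∈ {ω | (G.part i).r ω₀ ω}, (G.part i).r ω ω' :=
      fun ω h ω' h' => (G.part i).trans ((G.part i).symm h) h'
    have h2 := G.sum_treeSum_le h₁ (σ := σ) (ι := ι) (A := {ω | (G.part i).r ω₀ ω})
      (fun ω h ω' h' => G.echoExcept_chosen_congr v τ (hA ω h ω' h') ι)
      (fun ω h ω' h' => G.echoExcept_respond_congr v τ (hA ω h ω' h') ι) m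
      (cellBelief (G.part i) μ ω₀) 0 Fin.elim0 hγ (fun ω hω =>
        (rel_and_pos_of_cellBelief_pos hμ.1
          ((cellBelief_nonneg hμ.1 ω₀ ω).lt_of_ne hω.symm)).1)
    refine h2.trans ?_
    simp only [mul_add, Finset.sum_add_distrib]
    refine add_le_add ((G.optValue_le_beliefValue hγ (hacq ω₀ hω₀ i)).trans (le_of_eq ?_)) le_rfl
    have hm : G.meanAnn (cellBelief (G.part i) μ ω₀) = v :=
      Subtype.ext (by rw [G.coe_meanAnn hγ, hv ω₀ hω₀])
    rw [beliefValue, hm]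
  · push Not at hq
    rw [Finset.sum_eq_zero fun ω hω => ?_]
    · exact zero_le
    · rw [ENNReal.ofReal_of_nonpos (hq ω (Finset.mem_filter.1 hω).2), zero_mul]

variable {v} in
theorem expScore_echoExcept_le (h₁ : G.κ.SequentialProof) {μ : Ω → ℝ} (hμ : μ ∈ stdSimplex ℝ Ω)
    (hv : ∀ ω, 0 < μ ω → mean (cellBelief (G.part i) μ ω) G.X = v) (hacq : G.NoAcquisition μ)
    (hfin : ∀ k, G.periodCost μ (G.echoExcept v τ) k ≠ ⊤) (m : ℕ) :
    G.expScore μ (G.echoExcept v τ) m ≤ G.constScore v μ +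
      ∑ j ∈ Finset.range m, (G.periodCost μ (G.echoExcept v τ) j).toReal := by
  set σ := G.echoExcept v τ with hσ
  have hms : Measurable fun φ : FullState Ω => G.posScore (G.ann σ φ m) φ.1 :=
    ENNReal.measurable_ofReal.comp ((G.measurable_score.comp
      ((G.measurable_ann σ m).prodMk measurable_fst)).add_const _)
  have hmc : ∀ j, Measurable fun φ : FullState Ω => G.cost (G.acquired σ φ j) := fun j =>
    G.measurable_cost.comp (G.measurable_acquired σ j)
  have hmv : Measurable fun φ : FullState Ω => G.posScore v φ.1 :=
    (Measurable.of_discrete (f := G.posScore v)).comp measurable_fst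
  have hmr : Measurable fun φ : FullState Ω => G.posScore v φ.1 +
      ∑ j ∈ Finset.range m, G.cost (G.acquired σ φ j) :=
    hmv.add (Finset.measurable_sum _ fun j _ => hmc j)
  have hι : ∀ {F : FullState Ω → ℝ≥0∞}, Measurable F → ∀ ω, Measurable fun ι =>
      ∫⁻ u, F (ω, ι, u) ∂(Measure.infinitePi fun _ : ℕ => (volume : Measure unitInterval)) :=
    fun {F} hF ω => Measurable.lintegral_prod_right'
      (f := fun x : (ℕ → unitInterval) × (ℕ → unitInterval) => F (ω, x))
      (hF.comp (f := fun x => (ω, x)) (by fun_prop))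
  have hle : ∫⁻ φ, G.posScore (G.ann σ φ m) φ.1 ∂(law μ) ≤ ∫⁻ φ, (G.posScore v φ.1 +
      ∑ j ∈ Finset.range m, G.cost (G.acquired σ φ j)) ∂(law μ) := by
    rw [lintegral_law μ hms, lintegral_law μ hmr]
    have hpull : ∀ {F : FullState Ω → ℝ≥0∞}, Measurable F →
        ∑ ω, ENNReal.ofReal (μ ω) * ∫⁻ ι, ∫⁻ u, F (ω, ι, u)
          ∂(Measure.infinitePi fun _ : ℕ => (volume : Measure unitInterval))
          ∂(Measure.infinitePi fun _ : ℕ => (volume : Measure unitInterval)) =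
        ∫⁻ ι, ∑ ω, ENNReal.ofReal (μ ω) * ∫⁻ u, F (ω, ι, u)
          ∂(Measure.infinitePi fun _ : ℕ => (volume : Measure unitInterval))
          ∂(Measure.infinitePi fun _ : ℕ => (volume : Measure unitInterval)) := by
      intro F hF
      rw [lintegral_finsetSum _ fun ω _ => (hι hF ω).const_mul _]
      exact Finset.sum_congr rfl fun ω _ => (lintegral_const_mul _ (hι hF ω)).symm
    rw [hpull hms, hpull hmr]
    exact lintegral_mono fun ι => G.sum_lintegral_posScore_le τ h₁ hμ hv hacq ι m
  rw [G.lintegral_posScore hμ (G.measurable_ann σ m), lintegral_add_left hmv,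
    G.lintegral_posScore hμ (y := fun _ => v) measurable_const,
    lintegral_finsetSum _ fun j _ => hmc j] at hle
  simp only [← G.periodCost_eq] at hle
  have h3 : ∑ j ∈ Finset.range m, G.periodCost μ σ j =
      ENNReal.ofReal (∑ j ∈ Finset.range m, (G.periodCost μ σ j).toReal) := by
    rw [ENNReal.ofReal_sum_of_nonneg fun _ _ => ENNReal.toReal_nonneg]
    exact Finset.sum_congr rfl fun j _ => (ENNReal.ofReal_toReal (hfin j)).symm
  have h4 : 0 ≤ ∑ j ∈ Finset.range m, (G.periodCost μ σ j).toReal :=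
    Finset.sum_nonneg fun _ _ => ENNReal.toReal_nonneg
  have h5 : 0 ≤ ∫ φ, G.score v φ.1 ∂(law μ) + G.scoreBound := by
    have hprob := isProbabilityMeasure_law hμ
    have h6 := norm_integral_le_of_norm_le_const (μ := law μ) (C := G.scoreBound)
      (f := fun φ : FullState Ω => G.score v φ.1) (ae_of_all _ fun φ => G.abs_score_le _ _)
    simp only [probReal_univ, mul_one, Real.norm_eq_abs] at h6
    linarith [neg_abs_le (∫ φ, G.score v φ.1 ∂(law μ))]
  rw [h3, ← ENNReal.ofReal_add h5 h4, ENNReal.ofReal_le_ofReal_iff (add_nonneg h5 h4)] at hle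
  unfold expScore constScore
  linarith

/-- At every horizon a deviator's score advantage over `v`, net of the costs incurred so far, is
nonpositive in expectation. Summation by parts extends this to discounted payoffs, since the weights
decrease. -/
theorem echo_isNash (h₁ : G.κ.SequentialProof) {μ : Ω → ℝ} (hμ : μ ∈ stdSimplex ℝ Ω)
    (hv : ∀ i ω, 0 < μ ω → mean (cellBelief (G.part i) μ ω) G.X = v) (hacq : G.NoAcquisition μ) :
    G.IsNash μ (G.echo v) := by
  intro i τ
  change G.payoff μ (G.echoExcept v τ) i ≤ _
  -- The first mover also earns the change of the score from `y₀` to `v`; it is the only nonzero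
  -- payoff on the equilibrium path.
  set D : ℝ := if mover n 0 = i then G.β * (G.constScore v μ - G.expScore μ (G.echo v) 0) else 0
    with hD
  have heq : G.payoff μ (G.echo v) i = (D : EReal) := by
    refine (tendsto_const_nhds.congr' ?_).liminf_eq
    filter_upwards [eventually_ge_atTop 1] with N hN
    rw [sum_stagePayoff (fun k _ => by rw [G.periodCost_of_echo v rfl]; exact ENNReal.zero_ne_top)]
    congr 1
    obtain ⟨N, rfl⟩ := Nat.exists_eq_add_of_le' hN
    rw [partialPayoff, Finset.sum_filter, Finset.sum_range_succ', Finset.sum_eq_zero]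
    · simp only [G.periodCost_of_echo v rfl, G.expScore_of_echo v (k := 0) rfl, hD]
      simp
    · intro k _
      simp [G.periodCost_of_echo v rfl, G.expScore_of_echo v (k := k + 1) rfl]
  rw [heq]
  set σ := G.echoExcept v τ with hσ
  by_cases hfin : ∀ k, mover n k = i → G.periodCost μ σ k ≠ ⊤
  swap
  · push Not at hfin
    obtain ⟨k, rfl, hk⟩ := hfin
    rw [payoff_of_periodCost_eq_top hk]
    exact bot_le
  have hecho : ∀ k, mover n k ≠ i → σ (mover n k) = G.echo v (mover n k) := fun k hk =>
    G.echoExcept_of_ne v τ hk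
  have hfin' : ∀ k, G.periodCost μ σ k ≠ ⊤ := fun k => by
    by_cases hk : mover n k = i
    · exact hfin k hk
    · rw [G.periodCost_of_echo v (hecho k hk)]
      exact ENNReal.zero_ne_top
  set C : ℕ → ℝ := fun k => (G.periodCost μ σ k).toReal with hC
  -- After period 0, `b` changes only in periods of `i`, by exactly his undiscounted stage payoff.
  set b : ℕ → ℝ := fun N =>
    G.expScore μ σ N - G.constScore v μ - ∑ j ∈ Finset.range N, C j with hb
  have hb0 : ∀ N, b N ≤ 0 := fun N => by
    have := G.expScore_echoExcept_le τ h₁ hμ (hv i) hacq hfin' N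
    simp only [hb, hC]
    linarith
  have h0 : G.expScore μ σ 0 = G.expScore μ (G.echo v) 0 := rfl
  have hmain : ∀ N, partialPayoff G.β (G.expScore μ σ) C i (N + 1) ≤
      D + G.β ^ (N + 1) * b (N + 1) := by
    intro N
    induction N with
    | zero =>
      rw [partialPayoff, Finset.sum_filter]
      simp only [zero_add, Finset.range_one, Finset.sum_singleton, pow_one, hb, hD]
      split_ifs with hi
      · rw [h0]
        exact le_of_eq (by ring)
      · have hc0 : C 0 = 0 := by simp [hC, G.periodCost_of_echo v (hecho 0 hi)]
        have := G.expScore_of_echo v (μ := μ) (hecho 0 hi)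
        simp only [zero_add, if_true] at this
        rw [this, hc0]
        simp
    | succ N ih =>
      have hstep : partialPayoff G.β (G.expScore μ σ) C i (N + 1 + 1) =
          partialPayoff G.β (G.expScore μ σ) C i (N + 1) +
            G.β ^ (N + 1 + 1) * (b (N + 1 + 1) - b (N + 1)) := by
        have hdiff : b (N + 1 + 1) - b (N + 1) =
            G.expScore μ σ (N + 1 + 1) - G.expScore μ σ (N + 1) - C (N + 1) := by
          simp only [hb]
          rw [Finset.sum_range_succ _ (N + 1)]
          ring
        rw [hdiff, partialPayoff, partialPayoff, Finset.sum_filter, Finset.sum_filter,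
          Finset.sum_range_succ _ (N + 1)]
        split_ifs with hi
        · rfl
        · have hc0 : C (N + 1) = 0 := by simp [hC, G.periodCost_of_echo v (hecho (N + 1) hi)]
          have := G.expScore_of_echo v (μ := μ) (hecho (N + 1) hi)
          rw [if_neg (by omega)] at this
          rw [this, hc0]
          simp
      rw [hstep]
      -- Since `b (N + 1) ≤ 0`, replacing its weight by the smaller one weakens the bound in the
      -- right direction.
      have hpow : G.β ^ (N + 1 + 1) ≤ G.β ^ (N + 1) :=
        pow_le_pow_of_le_one G.β_pos.le G.β_le_one (by omega)
      nlinarith [hb0 (N + 1)]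
  refine liminf_le_of_frequently_le' (Eventually.frequently ?_)
  filter_upwards [eventually_ge_atTop 1] with N hN
  obtain ⟨N, rfl⟩ := Nat.exists_eq_add_of_le' hN
  rw [sum_stagePayoff hfin, EReal.coe_le_coe_iff]
  refine (hmain N).trans ?_
  have := mul_nonpos_of_nonneg_of_nonpos (pow_pos G.β_pos (N + 1)).le (hb0 (N + 1))
  linarith

end Game

namespace Game

variable {Ω : Type*} [Fintype Ω] [MeasurableSpace Ω] [MeasurableSingletonClass Ω] {n : ℕ}
  [NeZero n] (G : Game Ω n)

/-! ### Comparison of the market and the poll -/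

/-- Limits in probability are almost surely unique, so every prediction equals `X`. Only a lower
bound is claimed, as the infimum is `⊤` when there is no equilibrium. -/
theorem one_le_marketAccuracy (hG : G.KSeparable) {μ : Ω → ℝ} (hμ : μ ∈ stdSimplex ℝ Ω) :
    1 ≤ G.marketAccuracy μ := by
  have := isProbabilityMeasure_law hμ
  refine le_iInf fun σ => le_iInf fun hσ => le_iInf fun p => le_iInf fun hp => ?_
  have h : ∀ᵐ φ ∂(law μ), p φ = G.X φ.1 := by
    filter_upwards [tendstoInMeasure_ae_unique hp (hσ.isMarketPrediction hμ),
      hσ.mean_limitBelief_eq hμ hG] with φ h1 h2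
    rw [h1, h2]
  have h1 : G.accuracy μ p = 1 := by
    rw [accuracy, integral_congr_ae (g := fun _ => (1 : ℝ)) (h.mono fun φ hφ => by simp [hφ])]
    simp
  rw [h1]
  rfl

theorem ae_state_pos {μ : Ω → ℝ} (hμ : ∀ ω, 0 ≤ μ ω) : ∀ᵐ φ ∂(law μ), 0 < μ φ.1 := by
  have h : ∀ ω, ∀ᵐ φ ∂(law μ), φ.1 = ω → 0 < μ φ.1 := by
    intro ω
    rcases (hμ ω).eq_or_lt with h0 | h0
    · have h1 : law μ (Prod.fst ⁻¹' {ω} : Set (FullState Ω)) = 0 := by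
        rw [law_state, ← h0, ENNReal.ofReal_zero]
      filter_upwards [measure_eq_zero_iff_ae_notMem.1 h1] with φ hφ h2
      exact absurd h2 hφ
    · exact ae_of_all _ fun φ h2 => h2 ▸ h0
  filter_upwards [ae_all_iff.2 h] with φ hφ
  exact hφ _ rfl

theorem netGain_free {γ : Ω → ℝ} (hγ : γ ∈ stdSimplex ℝ Ω) : G.netGain γ G.free = 0 := by
  have h : G.gain γ G.free.1 = 0 := by
    refine (tsum_congr fun τ => ?_).trans tsum_zero
    by_cases h0 : marg γ G.free.1 τ = 0
    · rw [h0, zero_mul]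
    · simp [G.posterior_free hγ h0]
  rw [G.netGain_eq (by simp [K_free]), h, K_free]
  simp

/-- The poll in which no trader acquires information. -/
def freePoll : G.PollChoice := fun _ _ => G.free

theorem freePoll_isOptimal {μ : Ω → ℝ} (hμ : μ ∈ stdSimplex ℝ Ω) (hacq : G.NoAcquisition μ) :
    G.freePoll.IsOptimal μ := by
  intro i ω hω R
  rw [freePoll, G.netGain_free (cellBelief_mem_stdSimplex hμ.1 hω)]
  exact hacq ω hω i R

theorem pollPrediction_freePoll {μ : Ω → ℝ} (hμ : μ ∈ stdSimplex ℝ Ω) {v : ℝ}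
    (hv : ∀ i ω, 0 < μ ω → mean (cellBelief (G.part i) μ ω) G.X = v) :
    ∀ᵐ φ ∂(law μ), G.pollPrediction μ G.freePoll φ = v := by
  filter_upwards [ae_state_pos hμ.1,
    ae_all_iff.2 fun k => ae_realize_signal_pos μ (fun _ => G.free.1) k] with φ h0 h1
  have h2 : ∀ i, G.pollAnn μ G.freePoll i φ = v := by
    intro i
    have hγ := cellBelief_mem_stdSimplex (P := G.part i) hμ.1 h0
    have hm := marg_pos hγ.1 (cellBelief_pos hμ.1 h0 ((G.part i).refl φ.1) h0) (h1 i)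
    rw [pollAnn, freePoll, G.posterior_free hγ hm.ne', hv i φ.1 h0]
  have hn : (n : ℝ) ≠ 0 := Nat.cast_ne_zero.2 (NeZero.ne n)
  simp only [pollPrediction_eq, h2, Finset.sum_const, Finset.card_univ, Fintype.card_fin,
    nsmul_eq_mul]
  field_simp

theorem price_echo (v : G.Ann) (φ : FullState Ω) (k : ℕ) : G.price (G.echo v) φ (k + 1) = v := by
  induction k with
  | zero => rw [price_eq, (G.echo_step v rfl φ).2, if_pos rfl]
  | succ k ih =>
    rw [price_eq, (G.echo_step v rfl φ).2, if_neg k.succ_ne_zero, ← ih, price_eq]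

theorem isMarketPrediction_echo (μ : Ω → ℝ) (v : G.Ann) :
    G.IsMarketPrediction μ (G.echo v) fun _ => (v : ℝ) := by
  intro ε hε
  refine tendsto_const_nhds.congr' ?_
  filter_upwards [eventually_ge_atTop 1] with k hk
  obtain ⟨k, rfl⟩ := Nat.exists_eq_add_of_le' hk
  simp only [price_echo, edist_self]
  simp [hε.ne']

/-- If all traders knew `X`, trader `0`'s cell mean at a state with `X ω ≠ v` would be `X ω` rather
than `v`. -/
theorem someTraderUncertain {μ : Ω → ℝ} (hμ : μ ∈ stdSimplex ℝ Ω) (h : G.NonSeparableAt μ) :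
    G.SomeTraderUncertain μ := by
  obtain ⟨v, ⟨ω, hω, hne⟩, hv⟩ := h
  by_contra hcon
  refine hne ?_
  have hγ := cellBelief_mem_stdSimplex (P := G.part 0) hμ.1 hω
  have h1 : mean (cellBelief (G.part 0) μ ω) G.X = G.X ω := by
    have h2 : ∀ ω', cellBelief (G.part 0) μ ω ω' * G.X ω' =
        cellBelief (G.part 0) μ ω ω' * G.X ω := by
      intro ω'
      rcases (hγ.1 ω').eq_or_lt with h0 | h0
      · rw [← h0, zero_mul, zero_mul]
      · obtain ⟨h3, h4⟩ := rel_and_pos_of_cellBelief_pos hμ.1 h0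
        by_contra h5
        exact hcon ⟨0, ω, ω', hω, h4, h3, fun h6 => h5 (by rw [h6])⟩
    rw [mean, Finset.sum_congr rfl fun ω' _ => h2 ω', ← Finset.sum_mul, hγ.2, one_mul]
  rw [← h1, hv 0 ω hω]

/-- If `X` is non-separable and there is no information acquisition, then the market can do as badly
as the poll. -/
theorem marketAccuracy_le (h₁ : G.κ.SequentialProof) {μ : Ω → ℝ} (hμ : μ ∈ stdSimplex ℝ Ω)
    (hns : G.NonSeparableAt μ) (hacq : G.NoAcquisition μ) :
    G.marketAccuracy μ ≤ G.accuracy μ (G.pollPrediction μ G.freePoll) := by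
  obtain ⟨v, ⟨ω, hω, -⟩, hv⟩ := hns
  set w : G.Ann := G.meanAnn (cellBelief (G.part 0) μ ω) with hw
  have hwv : (w : ℝ) = v := by
    rw [hw, G.coe_meanAnn (cellBelief_mem_stdSimplex hμ.1 hω), hv 0 ω hω]
  have hv' : ∀ i ω, 0 < μ ω → mean (cellBelief (G.part i) μ ω) G.X = w := by rwa [hwv]
  refine (iInf₂_le (G.echo w) (G.echo_isNash w h₁ hμ hv' hacq)).trans
    ((iInf₂_le _ (G.isMarketPrediction_echo μ w)).trans (le_of_eq ?_))
  congr 1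
  refine integral_congr_ae ?_
  filter_upwards [G.pollPrediction_freePoll hμ hv'] with φ hφ
  rw [hφ]

end Game

end InfoMarket
end

theorem mainTheorem5 {Ω : Type*} [Fintype Ω] [MeasurableSpace Ω] [MeasurableSingletonClass Ω]
    {n : ℕ} [NeZero n] (G : InfoMarket.Game Ω n)
    (h₁ : G.κ.SequentialProof) (h₂ : G.κ.NoExclusion) :
    (∀ μ ∈ stdSimplex ℝ Ω, ∀ σ : G.Profile, G.IsNash μ σ →
      ∃ p, G.IsMarketPrediction μ σ p) ∧
    (G.KSeparable ↔
      ∀ μ ∈ stdSimplex ℝ Ω, G.SomeTraderUncertain μ →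
        ∀ ρ : G.PollChoice, ρ.IsOptimal μ →
          (G.accuracy μ (G.pollPrediction μ ρ) : EReal) < G.marketAccuracy μ) := by
  refine ⟨fun μ hμ σ hσ => ⟨_, hσ.isMarketPrediction hμ⟩, fun hG μ hμ hunc ρ hρ => ?_, ?_⟩
  · refine lt_of_lt_of_le ?_ (G.one_le_marketAccuracy hG hμ)
    exact_mod_cast G.accuracy_pollPrediction_lt_one h₂ hμ hunc hρ
  · rintro h ⟨μ, hμ, hns, hacq⟩
    exact (h μ hμ (G.someTraderUncertain hμ hns) _ (G.freePoll_isOptimal hμ hacq)).not_ge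
      (G.marketAccuracy_le h₁ hμ hns hacq)
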